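/- Let $\kappa=1+\sqrt{2-2/\sqrt5}\approx 2.0514$ and let $\log$ denote the logarithm to base $2$. Let $T$ be a finite tree with $n\ge 1$ nodes, without prescribed order of the edges around its nodes, let $r$ be any node of $T$, chosen as root, and at every non-leaf let a *heavy* edge be selected, leading to a child with a largest subtree (ties broken arbitrarily); the other edges to children, and these children, are *light*. The heavy edges form the heavy paths (a single node is allowed); the *top node* of a heavy path is its node closest to $r$. Then $T$ has a planar straight-line drawing in the plane that 1. has perfect angular resolution: any two edges at a node $v$ are separated by an angle of at least $2\pi/\deg(v)$; 2. has no edge of length smaller than $1$; 3. is covered by a disk of radius $n^2\cdot n^{\log\kappa}$, where $n^2\cdot n^{\log\kappa}<n^{3.0367}$ if $n\ge2$; 4. is produced by the greedy balloon layout within the heavy-path framework, in the following sense. *Framework.* For every top node $u$ there is an *exclusive disk* of radius $X_u$ centred at $u$ that contains the drawing of the subtree rooted at $u$; $X_u=1$ if $u$ is a leaf of the rooted tree; and if $u\ne r$, the parent of $u$ is not in the interior of the disk, so that the edge to the parent crosses its boundary orthogonally. At every node $z$, the $\deg(z)$ edges lie on evenly spaced rays (spokes), and the exclusive disks of the light children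 of $z$ are arranged around $z$ by the greedy balloon layout (up to rotation and reflection); the edges to the parent and to the heavy child, where they exist, are on the free spokes. Let $x_z$ be the radius of the smallest disk centred at $z$ that covers these exclusive disks ($0$ if there are none). The disks of radius $x_z$ about the nodes $z$ of one heavy path have disjoint interiors and are contained in the exclusive disk of that path. *Greedy balloon layout.* Given are $d$ evenly spaced spokes from the origin, $f\in\{1,2\}$ of which have to stay free, and balloons (disks) of radii $r_1\le\dots\le r_{d-f}$. Put $\alpha(\varphi)=\frac{1+\sin(\varphi/2)}{\sin(\varphi/2)}$. Start with the list $S$ of all spokes in cyclic order and with $\mathrm{safe}=0$. While $|S|>f+2$, play a round: the spokes of even position in $S$ receive, in order, the smallest remaining balloons; on spoke $s$ the balloon of radius $\rho$ gets its centre at distance $c=\max\{\alpha(\varphi)\rho-\rho,\ \mathrm{safe}+\rho\}$, where $\varphi$ is the minimum of $\pi$ and twice the smallest angle between $s$ and another spoke of $S$; then $\mathrm{safe}$ becomes the largest of its old value and all $c+\rho$ of the round, and $S$ becomes the list of the spokes of odd position with the last one moved to the front. The round is a *wedge round* if $c>\mathrm{safe}+\rho$ (old value) for one of its balloons. Then,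 with $S=(s_1,s_2,\dots)$ and $\rho'\le\rho$ the remaining radii (only $\rho$ if one is left): - $f=1$, $|S|=2$: $\rho$ on $s_1$ at distance $\mathrm{safe}+\rho$. - $f=1$, $|S|=3$: $\rho$ at distance $\mathrm{safe}+\rho$ on $s_3$ if $\angle s_1s_2\le\angle s_2s_3$ and on $s_1$ otherwise, and $\rho'$ on the other one of $s_1,s_3$ at distance $\max\{\alpha(\pi/3)\rho'-\rho',\mathrm{safe}+\rho'\}$. - $f=2$, $|S|=3$: $\rho$ on $s_2$ at distance $\max\{\alpha(4\pi/5)\rho-\rho,\ t+\rho\}$, where $t=\mathrm{safe}\cdot\frac{\sin\beta+\cos\beta}{\sin\beta+1}$ with $\beta=2\pi/(2\ell-1)$ if there was a preceding round, it was a wedge round, and it started with $\ell$ spokes, and $t=\mathrm{safe}$ otherwise. - $f=2$, $|S|=4$: $\rho'$ on $s_2$ at distance $\max\{\alpha(4\pi/7)\rho'-\rho',\mathrm{safe}+\rho'\}$, and $\rho$ on $s_4$ at distance $\mathrm{safe}+\rho$. The remaining spokes stay free; if there are no balloons, all spokes do. -/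

import Mathlib

/-!
Around a single node, balloons of total radius `σ` are covered by a disk of radius `κ * σ`. A
balloon of radius `ρ` either touches the safe disk, or touches the boundary of the wedge about its
spoke and then reaches out to `α φ * ρ`. This is much larger than `ρ` only in a narrow wedge, and
then many balloons that are no smaller than this one take part; the extreme case is a single balloon
between two free spokes, where `α (4 * π / 5) = κ`. The wedges of one round do not overlap, and
later balloons are separated from them by lines orthogonal to the later spokes, so that the balloons
have disjoint interiors and leave the free spokes free.

Let the heavy edges of a path end at distances from the top node that are prescribed in such a way
that the star at every node has room in an annulus of its own about the top node. Since two free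
spokes form an angle of at least `2 * π / 3`, a heavy path can turn left and right such that all its
edges point within `π / 3` of a fixed axis. A heavy edge can then reach the prescribed distance, it
leaves the annulus of its lower end outwards, and the height along the axis increases. Hence
what is drawn beyond a node of the path is high or far, and does not cross the edges before it.

If a node has heavy child `v` and its light children need exclusive disks of radii of sum `σ`, the
annuli lead to `X u ≤ X v + (4 * κ - 1) * (1 + σ)`. As `4 * κ = 2 ^ (2 + log κ)`, the bound
`X u ≤ n ^ (2 + log κ)` for the subtree of size `n` follows by induction from
`a ^ e + (2 ^ e - 1) * b ^ e ≤ (a + b) ^ e` for `b ≤ a`: the light subtrees, and the node itself,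
are no larger than the heavy subtree.
-/

namespace BalloonTree

/-! ### Straight-line drawings of a graph in the plane -/

section Drawing

variable {V : Type*}

/-- The point set covered by the straight-line drawing of `G` with vertex positions `p`. -/
def drawing (G : SimpleGraph V) (p : V → ℂ) : Set ℂ :=
  Set.range p ∪ {z | ∃ u v, G.Adj u v ∧ z ∈ segment ℝ (p u) (p v)}

/-- `p` is a plane straight-line drawing of `G`: vertices are distinct points, an edge contains
no vertices but its ends, and two different edges meet at most in a common end. -/
structure IsPlanarStraightLine (G : SimpleGraph V) (p : V → ℂ) : Prop where
  injective : Function.Injective p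
  vertex_edge : ∀ u v w, G.Adj u v → p w ∈ segment ℝ (p u) (p v) → w = u ∨ w = v
  edge_edge : ∀ u v u' v', G.Adj u v → G.Adj u' v' → s(u, v) ≠ s(u', v') →
    segment ℝ (p u) (p v) ∩ segment ℝ (p u') (p v') ⊆ p '' (({u, v} : Set V) ∩ {u', v'})

/-- The number of edges incident to `v`. -/
noncomputable def deg (G : SimpleGraph V) (v : V) : ℕ := (G.neighborSet v).ncard

/-- Any two edges at a vertex `v` are separated by an angle of at least `2π / deg v`. -/
def HasPerfectAngularResolution (G : SimpleGraph V) (p : V → ℂ) : Prop :=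
  ∀ v u w, G.Adj v u → G.Adj v w → u ≠ w →
    2 * Real.pi / (deg G v : ℝ) ≤ EuclideanGeometry.angle (p u) (p v) (p w)

end Drawing

/-! ### The greedy balloon layout with free spokes

A star with `d` evenly spaced spokes is given by the spoke numbers `0, …, d - 1`; the direction of
spoke `s` is `2π s / d`, up to a rotation and possibly a reflection of the whole star. -/

/-- The constant `κ = 1 + √(2 - 2/√5) ≈ 2.0514`. -/
noncomputable def kappa : ℝ := 1 + √(2 - 2 / √5)

/-- A disk of radius `r` with centre on the axis of a wedge with opening angle `φ ≤ π` that touches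
the boundary of the wedge is covered by the disk of radius `alpha φ * r` about the apex. -/
noncomputable def alpha (φ : ℝ) : ℝ := (1 + Real.sin (φ / 2)) / Real.sin (φ / 2)

/-- The number of steps of size `2π / d` from spoke `a` to spoke `b` in cyclic direction. -/
def gap (d a b : ℕ) : ℕ := (b + d - a) % d

/-- The minimal angle, in steps of size `2π / d`, between `s` and another spoke of `S`. -/
def minGap (d : ℕ) (S : List ℕ) (s : ℕ) : ℕ :=
  ((S.filter (· ≠ s)).map fun t => min (gap d s t) (gap d t s)).foldr min d

/-- The spokes with even index (counted from one): those used in the current round. -/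
def usedSpokes : List ℕ → List ℕ
  | _ :: b :: t => b :: usedSpokes t
  | _ => []

/-- The spokes with odd index (counted from one). -/
def oddSpokes : List ℕ → List ℕ
  | a :: _ :: t => a :: oddSpokes t
  | l => l

/-- The spokes left for the following rounds: those with odd index, the last one put in front. -/
def keptSpokes (S : List ℕ) : List ℕ := (oddSpokes S).rotate ((oddSpokes S).length - 1)

theorem length_oddSpokes_lt : ∀ S : List ℕ,
    (oddSpokes S).length ≤ S.length ∧ (1 < S.length → (oddSpokes S).length < S.length)
  | [] => by simp [oddSpokes]
  | [_] => by simp [oddSpokes]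
  | _ :: _ :: t => by
    have := (length_oddSpokes_lt t).1
    simp only [oddSpokes, List.length_cons]
    omega

theorem length_keptSpokes_lt {S : List ℕ} (h : 1 < S.length) :
    (keptSpokes S).length < S.length := by
  simpa [keptSpokes] using (length_oddSpokes_lt S).2 h

/-- The distance from the origin at which a balloon of radius `r` is placed on the spoke `s` when
the spokes `S` are available and the safe disk has radius `safe`: the balloon touches the safe disk,
or else it is moved outwards until it lies in the wedge centred at `s` whose opening angle is twice
the minimal angle between `s` and a neighbouring spoke. (A wedge of opening angle at least `π`
imposes no condition.) -/
noncomputable def centerDist (d : ℕ) (S : List ℕ) (safe : ℝ) (s : ℕ) (r : ℝ) : ℝ :=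
  max (alpha (min (2 * (2 * Real.pi * (minGap d S s : ℝ) / (d : ℝ))) Real.pi) * r - r) (safe + r)

/-- A balloon layout: for each balloon, in the order of the list of radii, its spoke and the distance
of its centre from the origin; and the list of free spokes. -/
structure Layout where
  placed : List (ℕ × ℝ)
  free : List ℕ

/-- How far out the last balloon may start when three spokes and one balloon are left. If the
preceding round, played with `ℓ` spokes, produced a wedge layer, then the last balloon may be pushed
into the safe disk, up to a line whose distance from the origin is determined by the angle
`β = 2π / (2ℓ - 1)`. -/
noncomputable def pushed (safe : ℝ) : Option ℕ → ℝ
  | none => safe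
  | some l =>
    safe * (Real.sin (2 * Real.pi / (2 * (l : ℝ) - 1)) + Real.cos (2 * Real.pi / (2 * (l : ℝ) - 1)))
      / (Real.sin (2 * Real.pi / (2 * (l : ℝ) - 1)) + 1)

/-- The terminal cases, for `f` free spokes: two spokes and one balloon, three spokes and two
balloons (`f = 1`); three spokes and one balloon, four spokes and two balloons (`f = 2`);
no balloon at all. The spokes are listed such that the (at most two) smaller angles
are those between the first and second and between the second and third spoke. -/
noncomputable def terminalLayout (d f : ℕ) (S : List ℕ) (safe : ℝ) (wedge : Option ℕ)
    (rs : List ℝ) : Layout :=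
  match f, S, rs with
  | 1, [a, b], [r] => ⟨[(a, safe + r)], [b]⟩
  | 1, [a, b, c], [r', r] =>
    if gap d a b ≤ gap d b c then
      ⟨[(a, max (alpha (Real.pi / 3) * r' - r') (safe + r')), (c, safe + r)], [b]⟩
    else
      ⟨[(c, max (alpha (Real.pi / 3) * r' - r') (safe + r')), (a, safe + r)], [b]⟩
  | 2, [a, b, c], [r] =>
    ⟨[(b, max (alpha (4 * Real.pi / 5) * r - r) (pushed safe wedge + r))], [a, c]⟩
  | 2, [a, b, c, e], [r', r] =>
    ⟨[(b, max (alpha (4 * Real.pi / 7) * r' - r') (safe + r')), (e, safe + r)], [a, c]⟩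
  | _, S, _ => ⟨[], S⟩

open Classical in
/-- The rounds of the greedy strategy, for the remaining spokes `S` and the remaining radii `rs` in
increasing order. `safe` is the radius of the safe disk; `wedge` is `some ℓ` if the
preceding round was played with `ℓ` spokes and produced a wedge layer. -/
noncomputable def greedyRounds (d f : ℕ) (S : List ℕ) (safe : ℝ) (wedge : Option ℕ)
    (rs : List ℝ) : Layout :=
  if _h : f + 2 < S.length then
    let used := usedSpokes S
    let now := List.zip used (rs.take used.length)
    let safe' := (now.map fun q => centerDist d S safe q.1 q.2 + q.2).foldr max safe
    let wedge' := if ∃ q ∈ now, safe + q.2 < centerDist d S safe q.1 q.2 then some S.length else none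
    let rest := greedyRounds d f (keptSpokes S) safe' wedge' (rs.drop used.length)
    ⟨(now.map fun q => (q.1, centerDist d S safe q.1 q.2)) ++ rest.placed, rest.free⟩
  else terminalLayout d f S safe wedge rs
termination_by S.length
decreasing_by exact length_keptSpokes_lt (by omega)

/-- The greedy balloon layout of balloons with radii `rs` (in increasing order) on `d` spokes, `f`
of which stay free. -/
noncomputable def greedyLayout (d f : ℕ) (rs : List ℝ) : Layout :=
  greedyRounds d f (List.range d) 0 none rs

/-- The radius of the smallest disk about the origin that covers all balloons of the layout. -/
noncomputable def Layout.coverRadius (lay : Layout) (rs : List ℝ) : ℝ :=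
  (List.zipWith (fun q r => q.2 + r) lay.placed rs).foldr max 0

/-- The unit vector in direction of spoke `s` of a star with `d` spokes, rotated by `θ`, and with
spokes numbered counterclockwise (`ε = 1`) or clockwise (`ε = -1`). -/
noncomputable def spokeDir (d : ℕ) (θ ε : ℝ) (s : ℕ) : ℂ :=
  Complex.exp (((θ + ε * (2 * Real.pi * (s : ℝ) / (d : ℝ)) : ℝ) : ℂ) * Complex.I)

/-! ### Heavy-path decomposition of a rooted tree -/

section Tree

variable {V : Type*}

/-- `v` is a child of `u` in the tree `G` with root `r`. -/
def IsChild (G : SimpleGraph V) (r u v : V) : Prop :=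
  G.Adj u v ∧ G.dist r v = G.dist r u + 1

/-- The vertices of the subtree rooted at `u`: those whose path from the root visits `u`. -/
def subtree (G : SimpleGraph V) (r u : V) : Set V :=
  {w | G.dist r w = G.dist r u + G.dist u w}

/-- `h` selects at every non-leaf `u` a child with largest subtree, the other end of the heavy edge
below `u` (ties are broken arbitrarily). -/
structure IsHeavyChoice (G : SimpleGraph V) (r : V) (h : V → Option V) : Prop where
  isChild : ∀ u v, h u = some v → IsChild G r u v
  largest : ∀ u v, h u = some v → ∀ w, IsChild G r u w →
    (subtree G r w).ncard ≤ (subtree G r v).ncard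
  exists_of_child : ∀ u v, IsChild G r u v → h u ≠ none

/-- `v` is a child of `u` through a light edge. -/
def IsLightChild (G : SimpleGraph V) (r : V) (h : V → Option V) (u v : V) : Prop :=
  IsChild G r u v ∧ h u ≠ some v

/-- `u` is the top node of its heavy path, that is, the root or a light child. -/
def IsTop (h : V → Option V) (u : V) : Prop := ∀ w, h w ≠ some u

/-- `z` lies on the heavy path that starts at `u`. -/
def OnHeavyPath (h : V → Option V) (u z : V) : Prop :=
  Relation.ReflTransGen (fun a b => h a = some b) u z

/-! ### Drawings produced by the greedy layout within the heavy-path framework -/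

/-- The edges at `u` are drawn by the greedy balloon layout, where `X` gives the radii of the
exclusive disks of the light children: there are `deg u` evenly spaced spokes, the balloon of a
light child `c` is the disk of radius `X c` about `c`, and the remaining edges at `u` (the
heavy edge to a child and the edge to the parent, as far as they exist) leave along
the free spokes. The radius of the disk about `u` that covers the layout is `x`. -/
def IsGreedyStar (G : SimpleGraph V) (r : V) (h : V → Option V) (p : V → ℂ) (X : V → ℝ)
    (u : V) (x : ℝ) : Prop :=
  ∃ (L F : List V) (θ ε : ℝ), (ε = 1 ∨ ε = -1) ∧
    L.Nodup ∧ (∀ v, v ∈ L ↔ IsLightChild G r h u v) ∧ (L.map X).Pairwise (· ≤ ·) ∧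
    F.Nodup ∧ (∀ v, v ∈ F ↔ G.Adj u v ∧ ¬ IsLightChild G r h u v) ∧
    List.Forall₂ (fun v q => p v = p u + (q.2 : ℂ) * spokeDir (deg G u) θ ε q.1) L
      (greedyLayout (deg G u) F.length (L.map X)).placed ∧
    List.Forall₂ (fun v s => ∃ t : ℝ, 0 < t ∧ p v = p u + (t : ℂ) * spokeDir (deg G u) θ ε s) F
      (greedyLayout (deg G u) F.length (L.map X)).free ∧
    x = (greedyLayout (deg G u) F.length (L.map X)).coverRadius (L.map X)

/-- The drawing `p` of the tree `G` with root `r` arises from the heavy-path decomposition `h` and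
the greedy balloon layout. `X u` is the radius of the exclusive disk of the subtree of
a heavy path with top node `u`; the disk is centred at `u`, so that an edge from `u` to a
point outside crosses its boundary orthogonally. `x z` is the radius of the disk about `z` that
covers the balloon layout at `z`. -/
structure IsGreedyHeavyPathDrawing (G : SimpleGraph V) (r : V) (h : V → Option V) (p : V → ℂ)
    (X x : V → ℝ) : Prop where
  /-- A degenerate heavy path, a single leaf, has an exclusive disk of radius one. -/
  leaf : ∀ u, IsTop h u → h u = none → X u = 1
  /-- Around every vertex the light subtrees are arranged by the greedy balloon layout. -/
  star : ∀ u, IsGreedyStar G r h p X u (x u)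
  /-- The covering disks of the balloon layouts on a heavy path have disjoint interiors, -/
  cover_disjoint : ∀ u z z', IsTop h u → OnHeavyPath h u z → OnHeavyPath h u z' → z ≠ z' →
    x z + x z' ≤ dist (p z) (p z')
  /-- and they are contained in the exclusive disk of the heavy path. -/
  cover_subset : ∀ u z, IsTop h u → OnHeavyPath h u z → dist (p u) (p z) + x z ≤ X u
  /-- The drawing of the subtree of a heavy path lies in its exclusive disk. -/
  subtree_subset : ∀ u, IsTop h u → ∀ w ∈ subtree G r u, p w ∈ Metric.closedBall (p u) (X u)
  /-- The light parent edge leaves the exclusive disk. -/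
  parent_outside : ∀ u v, IsLightChild G r h u v → X v ≤ dist (p u) (p v)

end Tree

end BalloonTree

namespace BalloonTree

open Real

section Kappa

theorem kappa_sub_one_sq : (kappa - 1) ^ 2 = 2 - 2 * √5 / 5 := by
  have h_sqrt : √5 ^ 2 = 5 := sq_sqrt (by norm_num)
  have h_lt : √5 < 5 := by nlinarith [sqrt_nonneg 5]
  have h_div : 2 - 2 / √5 = 2 - 2 * √5 / 5 := by
    field_simp
    nlinarith
  rw [kappa, add_sub_cancel_left, h_div, sq_sqrt (by linarith)]

theorem one_le_kappa : 1 ≤ kappa := le_add_of_nonneg_right (sqrt_nonneg _)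

theorem two_lt_kappa : 2 < kappa := by
  have h_sqrt : √5 < 2.2361 := (sqrt_lt' (by norm_num)).2 (by norm_num)
  nlinarith [kappa_sub_one_sq, one_le_kappa]

theorem kappa_pos : 0 < kappa := two_pos.trans two_lt_kappa

theorem kappa_lt : kappa < 2.0515 := by
  have h_sqrt : 2.236 < √5 := (lt_sqrt (by norm_num)).2 (by norm_num)
  nlinarith [kappa_sub_one_sq]

theorem one_le_logb_kappa : 1 ≤ logb 2 kappa := by
  rw [le_logb_iff_rpow_le one_lt_two kappa_pos, rpow_one]
  exact two_lt_kappa.le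

theorem logb_kappa_lt : logb 2 kappa < 1.0367 := by
  -- `113 / 109` approximates `1.0367` from below, so that `2.0515 ^ 109 < 2 ^ 113` suffices.
  have h_pow : (2.0515 : ℝ) ^ 109 < (2 ^ (113 / 109 : ℝ)) ^ 109 := by
    rw [← rpow_mul_natCast two_pos.le]
    norm_num
  have h_logb : logb 2 kappa < 113 / 109 := by
    rw [logb_lt_iff_lt_rpow one_lt_two kappa_pos]
    exact kappa_lt.trans (lt_of_pow_lt_pow_left₀ 109 (by positivity) h_pow)
  exact h_logb.trans (by norm_num)

theorem sq_mul_rpow_logb_kappa_lt {x : ℝ} (hx : 1 < x) :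
    x ^ 2 * x ^ logb 2 kappa < x ^ (3.0367 : ℝ) := by
  rw [← rpow_two, ← rpow_add (by linarith)]
  exact rpow_lt_rpow_of_exponent_lt hx (by linarith [logb_kappa_lt])

theorem two_rpow_two_add_logb_kappa : (2 : ℝ) ^ (2 + logb 2 kappa) = 4 * kappa := by
  rw [rpow_add two_pos, rpow_logb two_pos (by norm_num) kappa_pos]
  norm_num

theorem sin_two_pi_div_five_mul_kappa_sub_one : sin (2 * π / 5) * (kappa - 1) = 1 := by
  have h_sqrt : √5 ^ 2 = 5 := sq_sqrt (by norm_num)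
  have h_cos : cos (2 * π / 5) = (√5 - 1) / 4 := by
    rw [show 2 * π / 5 = 2 * (π / 5) by ring, cos_two_mul, cos_pi_div_five]
    nlinarith
  have h_sin : 0 < sin (2 * π / 5) :=
    sin_pos_of_pos_of_lt_pi (by positivity) (by linarith [pi_pos])
  have h_sq : (sin (2 * π / 5) * (kappa - 1)) ^ 2 = 1 := by
    rw [mul_pow, sin_sq, h_cos, kappa_sub_one_sq]
    nlinarith
  have h_nonneg := mul_nonneg h_sin.le (sub_nonneg.2 one_le_kappa)
  exact (pow_eq_one_iff_of_nonneg h_nonneg two_ne_zero).1 h_sq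

theorem alpha_mul_sub {φ : ℝ} (hφ : sin (φ / 2) ≠ 0) (r : ℝ) :
    alpha φ * r - r = r / sin (φ / 2) := by
  rw [alpha]
  field_simp
  ring

theorem alpha_four_pi_div_five : alpha (4 * π / 5) = kappa := by
  have h := sin_two_pi_div_five_mul_kappa_sub_one
  have h_sin : sin (2 * π / 5) ≠ 0 := left_ne_zero_of_mul_eq_one h
  rw [alpha, show 4 * π / 5 / 2 = 2 * π / 5 by ring, div_eq_iff h_sin]
  linarith

end Kappa

section PowerSums

theorem rpow_add_two_rpow_sub_one_mul_rpow_le {e a b : ℝ} (he : 1 ≤ e) (hb : 0 ≤ b) (hba : b ≤ a) :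
    a ^ e + (2 ^ e - 1) * b ^ e ≤ (a + b) ^ e := by
  rcases (hb.trans hba).eq_or_lt with rfl | ha
  · obtain rfl : b = 0 := le_antisymm hba hb
    simp [zero_rpow (by linarith : e ≠ 0)]
  -- The points `a` and `2 * b` lie between `b` and `a + b` and have the same sum.
  have h_convex := (convexOn_rpow he).2 hb (add_nonneg ha.le hb)
  have h_nonneg : 0 ≤ b / a := by positivity
  have h_le_one : 0 ≤ 1 - b / a := sub_nonneg.2 ((div_le_one ha).2 hba)
  have h_a : b / a * b + (1 - b / a) * (a + b) = a := by
    field_simp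
    ring
  have h_b : (1 - b / a) * b + b / a * (a + b) = 2 * b := by
    field_simp
    ring
  have h₁ := h_convex h_nonneg h_le_one (add_sub_cancel _ _)
  have h₂ := h_convex h_le_one h_nonneg (sub_add_cancel _ _)
  simp only [smul_eq_mul, h_a, h_b, mul_rpow two_pos.le hb] at h₁ h₂
  linarith

theorem rpow_add_two_rpow_sub_one_mul_sum_rpow_le {e a : ℝ} (he : 1 ≤ e) {l : List ℝ}
    (hl : ∀ b ∈ l, 0 ≤ b ∧ b ≤ a) :
    a ^ e + (2 ^ e - 1) * (l.map (· ^ e)).sum ≤ (a + l.sum) ^ e := by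
  induction l with
  | nil => simp
  | cons b l ih =>
    rw [List.forall_mem_cons] at hl
    have h_sum : 0 ≤ l.sum := List.sum_nonneg fun c hc => (hl.2 c hc).1
    have h_step := rpow_add_two_rpow_sub_one_mul_rpow_le he hl.1.1
      (by linarith [hl.1.2] : b ≤ a + l.sum)
    rw [List.map_cons, List.sum_cons, List.sum_cons, add_left_comm, add_comm b]
    linarith [ih hl.2]

end PowerSums

section ListExtrema

variable {α : Type*} [LinearOrder α] {l : List α} {b c : α}

theorem foldr_max_le_iff : l.foldr max b ≤ c ↔ b ≤ c ∧ ∀ a ∈ l, a ≤ c := by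
  induction l with
  | nil => simp
  | cons a l ih => simp only [List.foldr_cons, max_le_iff, ih, List.forall_mem_cons]; tauto

theorem le_foldr_min_iff : c ≤ l.foldr min b ↔ c ≤ b ∧ ∀ a ∈ l, c ≤ a :=
  foldr_max_le_iff (α := αᵒᵈ)

theorem foldr_max_eq_or_mem : l.foldr max b = b ∨ l.foldr max b ∈ l := by
  induction l with
  | nil => simp
  | cons a l ih =>
    rw [List.foldr_cons]
    rcases max_choice a (l.foldr max b) with h | h <;> rw [h]
    · exact Or.inr List.mem_cons_self
    · exact ih.imp_right (List.mem_cons_of_mem a)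

end ListExtrema

section Gap

variable {d s t : ℕ} {μ : ℝ}

theorem gap_self (d s : ℕ) : gap d s s = 0 := by
  rw [gap, Nat.add_sub_cancel_left, Nat.mod_self]

theorem gap_of_lt (hst : s < t) (ht : t < d) : gap d s t = t - s := by
  rw [gap, show t + d - s = t - s + d by omega, Nat.add_mod_right, Nat.mod_eq_of_lt (by omega)]

theorem gap_of_gt (hst : t < s) (hs : s < d) : gap d s t = d - (s - t) := by
  rw [gap, Nat.mod_eq_of_lt (by omega)]
  omega

theorem gap_add_gap (hs : s < d) (ht : t < d) (hst : s ≠ t) : gap d s t + gap d t s = d := by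
  rcases hst.lt_or_gt with h | h
  · rw [gap_of_lt h ht, gap_of_gt h ht]
    omega
  · rw [gap_of_gt h hs, gap_of_lt h hs]
    omega

theorem minGap_le {S : List ℕ} (ht : t ∈ S) (hts : t ≠ s) :
    minGap d S s ≤ min (gap d s t) (gap d t s) :=
  (le_foldr_min_iff.1 le_rfl).2 _
    (List.mem_map_of_mem (List.mem_filter.2 ⟨ht, decide_eq_true hts⟩))

theorem le_minGap {S : List ℕ} {g : ℕ} (hg : g ≤ d)
    (h : ∀ t ∈ S, t ≠ s → g ≤ min (gap d s t) (gap d t s)) : g ≤ minGap d S s := by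
  refine le_foldr_min_iff.2 ⟨hg, List.forall_mem_map.2 fun t ht => ?_⟩
  rw [List.mem_filter, decide_eq_true_eq] at ht
  exact h t ht.1 ht.2

/-- The cosine of the angle between the spokes `s` and `t` of a star with `d` spokes. -/
noncomputable def spokeCos (d s t : ℕ) : ℝ := cos (2 * π * ((s : ℝ) - t) / d)

theorem spokeCos_comm (d s t : ℕ) : spokeCos d s t = spokeCos d t s := by
  rw [spokeCos, spokeCos, ← cos_neg]
  congr 1
  ring

theorem spokeCos_le_one (d s t : ℕ) : spokeCos d s t ≤ 1 := cos_le_one _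

theorem cos_le_cos_of_le_of_le_two_pi_sub {x : ℝ} (hμ : 0 ≤ μ) (hμx : μ ≤ x)
    (hx : x ≤ 2 * π - μ) : cos x ≤ cos μ := by
  rcases le_total x π with h | h
  · exact cos_le_cos_of_nonneg_of_le_pi hμ h hμx
  · rw [← cos_two_pi_sub x]
    exact cos_le_cos_of_nonneg_of_le_pi hμ (by linarith) (by linarith)

theorem spokeCos_le_cos (hs : s < d) (ht : t < d) (hμ : 0 ≤ μ)
    (hst : μ * d ≤ 2 * π * gap d s t) (hts : μ * d ≤ 2 * π * gap d t s) :
    spokeCos d s t ≤ cos μ := by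
  wlog h : s ≤ t generalizing s t
  · rw [spokeCos_comm]
    exact this ht hs hts hst (le_of_not_ge h)
  have hd : (0 : ℝ) < d := by exact_mod_cast (Nat.zero_le s).trans_lt hs
  rcases h.eq_or_lt with rfl | h
  · rw [gap_self, Nat.cast_zero, mul_zero] at hst
    rw [le_antisymm (nonpos_of_mul_nonpos_left hst hd) hμ, cos_zero]
    exact spokeCos_le_one _ _ _
  rw [gap_of_lt h ht, Nat.cast_sub h.le] at hst
  rw [gap_of_gt h ht, Nat.cast_sub (by omega), Nat.cast_sub h.le] at hts
  rw [spokeCos_comm]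
  apply cos_le_cos_of_le_of_le_two_pi_sub hμ
  · rwa [le_div_iff₀ hd]
  · rw [div_le_iff₀ hd]
    linarith

theorem spokeCos_le_cos_mul_pi_div {m k : ℕ} (hk : 0 < k) (hs : s < d) (ht : t < d)
    (hst : m * d ≤ 2 * k * gap d s t) (hts : m * d ≤ 2 * k * gap d t s) :
    spokeCos d s t ≤ cos (m * π / k) := by
  have hk' : (0 : ℝ) < k := by exact_mod_cast hk
  have h_mul : ∀ g : ℕ, m * d ≤ 2 * k * g → m * π / k * d ≤ 2 * π * g := by
    intro g hg
    have hg' : (m * d : ℝ) ≤ 2 * k * g := by exact_mod_cast hg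
    rw [div_mul_eq_mul_div, div_le_iff₀ hk']
    nlinarith [mul_le_mul_of_nonneg_left hg' pi_nonneg]
  exact spokeCos_le_cos hs ht (by positivity) (h_mul _ hst) (h_mul _ hts)

theorem spokeCos_le_cos_two_pi_div (hs : s < d) (ht : t < d) (hst : s ≠ t) :
    spokeCos d s t ≤ cos (2 * π / d) := by
  have one_le_gap : ∀ s t, s < d → t < d → s ≠ t → 1 ≤ gap d s t := by
    intro s t hs ht hst
    rcases hst.lt_or_gt with h | h
    · rw [gap_of_lt h ht]
      omega
    · rw [gap_of_gt h hs]
      omega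
  have h_mul : ∀ g, 1 ≤ g → 2 * d ≤ 2 * d * g := fun g hg => Nat.le_mul_of_pos_right _ hg
  exact_mod_cast spokeCos_le_cos_mul_pi_div (m := 2) (Nat.zero_lt_of_lt hs) hs ht
    (h_mul _ (one_le_gap s t hs ht hst)) (h_mul _ (one_le_gap t s ht hs hst.symm))

theorem two_pi_div_le_pi (hd : 2 ≤ d) : 2 * π / d ≤ π := by
  have hd' : (2 : ℝ) ≤ d := Nat.ofNat_le_cast.2 hd
  rw [div_le_iff₀ (by linarith)]
  nlinarith [pi_pos]

theorem spokeCos_lt_one (hs : s < d) (ht : t < d) (hst : s ≠ t) : spokeCos d s t < 1 := by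
  have hd : (0 : ℝ) < d := by exact_mod_cast Nat.zero_lt_of_lt hs
  refine (spokeCos_le_cos_two_pi_div hs ht hst).trans_lt ?_
  rw [← cos_zero]
  exact cos_lt_cos_of_nonneg_of_le_pi le_rfl (two_pi_div_le_pi (by omega)) (by positivity)

end Gap

section UsedKept

theorem getElem?_oddSpokes (S : List ℕ) (i : ℕ) : (oddSpokes S)[i]? = S[2 * i]? := by
  induction S using oddSpokes.induct generalizing i with
  | case1 a b t ih =>
    cases i with
    | zero => rfl
    | succ i => simpa only [oddSpokes, List.getElem?_cons_succ, Nat.mul_succ] using ih i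
  | case2 l hl =>
    match l, i with
    | [], _ => simp only [oddSpokes, List.getElem?_nil]
    | [a], 0 => rfl
    | [a], i + 1 => rfl
    | a :: b :: t, _ => exact (hl a b t rfl).elim

theorem getElem?_usedSpokes (S : List ℕ) (i : ℕ) : (usedSpokes S)[i]? = S[2 * i + 1]? := by
  induction S using oddSpokes.induct generalizing i with
  | case1 a b t ih =>
    cases i with
    | zero => rfl
    | succ i => simpa only [usedSpokes, List.getElem?_cons_succ, Nat.mul_succ] using ih i
  | case2 l hl =>
    match l with
    | [] => rfl
    | [a] => rfl
    | a :: b :: t => exact (hl a b t rfl).elim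

theorem length_oddSpokes (S : List ℕ) : (oddSpokes S).length = (S.length + 1) / 2 := by
  induction S using oddSpokes.induct with
  | case1 a b t ih => simp only [oddSpokes, List.length_cons, ih]; omega
  | case2 l hl =>
    match l with
    | [] => rfl
    | [_] => simp only [oddSpokes, List.length_singleton]
    | a :: b :: t => exact (hl a b t rfl).elim

theorem length_usedSpokes (S : List ℕ) : (usedSpokes S).length = S.length / 2 := by
  induction S using oddSpokes.induct with
  | case1 a b t ih => simp only [usedSpokes, List.length_cons, ih]; omega
  | case2 l hl =>
    match l with
    | [] => rfl
    | [_] => simp only [usedSpokes, List.length_nil, List.length_singleton]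
    | a :: b :: t => exact (hl a b t rfl).elim

theorem length_keptSpokes (S : List ℕ) : (keptSpokes S).length = (S.length + 1) / 2 := by
  rw [keptSpokes, List.length_rotate, length_oddSpokes]

theorem usedSpokes_append_oddSpokes_perm (S : List ℕ) : (usedSpokes S ++ oddSpokes S).Perm S := by
  induction S using oddSpokes.induct with
  | case1 a b t ih =>
    exact (List.perm_middle.cons b).trans ((List.Perm.swap a b _).trans ((ih.cons b).cons a))
  | case2 l hl =>
    match l with
    | [] => rfl
    | [a] => rfl
    | a :: b :: t => exact (hl a b t rfl).elim

theorem usedSpokes_append_keptSpokes_perm (S : List ℕ) :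
    (usedSpokes S ++ keptSpokes S).Perm S :=
  ((List.rotate_perm _ _).append_left _).trans (usedSpokes_append_oddSpokes_perm S)

variable {S : List ℕ} {i : ℕ}

theorem getElem_usedSpokes (hi : i < (usedSpokes S).length) :
    (usedSpokes S)[i] = S[2 * i + 1]'(by rw [length_usedSpokes] at hi; omega) :=
  Option.some_injective _ (by
    rw [← List.getElem?_eq_getElem, ← List.getElem?_eq_getElem, getElem?_usedSpokes])

theorem getElem_oddSpokes (hi : i < (oddSpokes S).length) :
    (oddSpokes S)[i] = S[2 * i]'(by rw [length_oddSpokes] at hi; omega) :=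
  Option.some_injective _ (by
    rw [← List.getElem?_eq_getElem, ← List.getElem?_eq_getElem, getElem?_oddSpokes])

theorem getElem_keptSpokes_zero (hS : 0 < S.length) :
    (keptSpokes S)[0]'(by rw [length_keptSpokes]; omega) =
      S[2 * ((S.length + 1) / 2 - 1)]'(by omega) := by
  simp only [keptSpokes, List.getElem_rotate, getElem_oddSpokes, length_oddSpokes]
  congr 2
  rw [zero_add, Nat.mod_eq_of_lt (by omega)]

theorem getElem_keptSpokes_succ (hi : i + 1 < (keptSpokes S).length) :
    (keptSpokes S)[i + 1] = S[2 * i]'(by rw [length_keptSpokes] at hi; omega) := by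
  rw [length_keptSpokes] at hi
  simp only [keptSpokes, List.getElem_rotate, getElem_oddSpokes, length_oddSpokes]
  congr 2
  rw [show i + 1 + ((S.length + 1) / 2 - 1) = i + (S.length + 1) / 2 by omega,
    Nat.add_mod_right, Nat.mod_eq_of_lt (by omega)]

end UsedKept

section Spread

/-- The partial sums of the sequence of gaps `g₁, g₂, G, G, …`. -/
def offset (g₁ g₂ G : ℕ) : ℕ → ℕ
  | 0 => 0
  | 1 => g₁
  | i + 2 => g₁ + g₂ + i * G

/-- The spokes `S` follow each other with gaps `g₁, g₂, G, …, G` (including the gap from the last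
spoke back to the first), where `G / 2 ≤ g₁, g₂ ≤ G`. This is the invariant of the rounds of the
greedy strategy; it starts with `g₁ = g₂ = G = 1`. -/
structure IsSpread (d : ℕ) (S : List ℕ) (g₁ g₂ G : ℕ) : Prop where
  two_le_length : 2 ≤ S.length
  pos : 0 < G
  fst_le : g₁ ≤ G
  snd_le : g₂ ≤ G
  le_two_mul_fst : G ≤ 2 * g₁
  le_two_mul_snd : G ≤ 2 * g₂
  offset_length : offset g₁ g₂ G S.length = d
  lt : ∀ s ∈ S, s < d
  gap_getElem : ∀ (i j : ℕ) (_ : i < j) (_ : j < S.length),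
    gap d S[i] S[j] = offset g₁ g₂ G j - offset g₁ g₂ G i

theorem isSpread_range {d : ℕ} (hd : 2 ≤ d) : IsSpread d (List.range d) 1 1 1 := by
  have h_offset : ∀ i, offset 1 1 1 i = i
    | 0 => rfl
    | 1 => rfl
    | i + 2 => by simp only [offset]; omega
  refine ⟨?_, one_pos, le_rfl, le_rfl, one_le_two, one_le_two, ?_, fun s => List.mem_range.1, ?_⟩
  · rwa [List.length_range]
  · rw [List.length_range, h_offset]
  · intro i j hij hj
    rw [List.getElem_range, List.getElem_range, h_offset, h_offset,
      gap_of_lt hij (by rwa [List.length_range] at hj)]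

namespace IsSpread

variable {d : ℕ} {S : List ℕ} {g₁ g₂ G : ℕ}

theorem strictMono (h : IsSpread d S g₁ g₂ G) : StrictMono (offset g₁ g₂ G) := by
  have := h.pos
  have := h.le_two_mul_fst
  have := h.le_two_mul_snd
  refine strictMono_nat_of_lt_succ fun i => ?_
  match i with
  | 0 => simp only [offset]; omega
  | 1 => simp only [offset]; omega
  | i + 2 => simp only [offset]; nlinarith

theorem offset_lt (h : IsSpread d S g₁ g₂ G) {i : ℕ} (hi : i < S.length) :
    offset g₁ g₂ G i < d :=
  (h.strictMono hi).trans_eq h.offset_length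

theorem spokeCount_pos (h : IsSpread d S g₁ g₂ G) : 0 < d :=
  (Nat.zero_le _).trans_lt (h.offset_lt (two_pos.trans_le h.two_le_length))

theorem getElem_ne (h : IsSpread d S g₁ g₂ G) {i j : ℕ} (hij : i < j) (hj : j < S.length) :
    S[i] ≠ S[j] := by
  intro h_eq
  have h_gap := h.gap_getElem i j hij hj
  rw [h_eq, gap_self] at h_gap
  exact (Nat.sub_pos_of_lt (h.strictMono hij)).ne h_gap

theorem nodup (h : IsSpread d S g₁ g₂ G) : S.Nodup :=
  List.pairwise_iff_getElem.2 fun _ _ _ hj hij => h.getElem_ne hij hj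

theorem gap_getElem_of_gt (h : IsSpread d S g₁ g₂ G) (i j : ℕ) (hij : i < j)
    (hj : j < S.length) :
    gap d S[j] S[i] = d - (offset g₁ g₂ G j - offset g₁ g₂ G i) := by
  rw [← h.gap_getElem i j hij hj]
  have := gap_add_gap (h.lt _ (List.getElem_mem (hij.trans hj))) (h.lt _ (List.getElem_mem hj))
    (h.getElem_ne hij hj)
  omega

theorem exists_isSpread_keptSpokes (h : IsSpread d S g₁ g₂ G) (hS : 3 ≤ S.length) :
    ∃ g, IsSpread d (keptSpokes S) g (g₁ + g₂) (2 * G) := by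
  obtain ⟨m, hm⟩ : ∃ m, (S.length + 1) / 2 = m + 2 := ⟨(S.length + 1) / 2 - 2, by omega⟩
  have h_length : (keptSpokes S).length = m + 2 := by rw [length_keptSpokes, hm]
  obtain ⟨g, h_offset, h_ge, h_le⟩ :
      ∃ g, offset g₁ g₂ G (2 * m + 2) + g = d ∧ G ≤ g ∧ g ≤ 2 * G := by
    have h_sum := h.offset_length
    rcases (by omega : S.length = 2 * m + 3 ∨ S.length = 2 * m + 4) with hl | hl <;>
      rw [hl] at h_sum <;> simp only [offset] at h_sum ⊢
    · exact ⟨G, by rw [← h_sum]; ring, le_rfl, by omega⟩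
    · exact ⟨2 * G, by rw [← h_sum]; ring, by omega, le_rfl⟩
  have h_double : ∀ i, offset g (g₁ + g₂) (2 * G) (i + 1) = g + offset g₁ g₂ G (2 * i)
    | 0 => rfl
    | i + 1 => by simp only [offset, Nat.mul_succ]; ring
  refine ⟨g, h_length ▸ Nat.le_add_left _ _, by linarith [h.pos], h_le, by
    linarith [h.fst_le, h.snd_le], by omega, by linarith [h.le_two_mul_fst, h.le_two_mul_snd], ?_,
    fun s hs => h.lt s ((usedSpokes_append_keptSpokes_perm S).subset
      (List.mem_append_right _ hs)), ?_⟩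
  · rw [h_length, h_double, ← h_offset, add_comm]
    rfl
  intro i j hij hj
  rw [h_length] at hj
  obtain ⟨j, rfl⟩ : ∃ j', j = j' + 1 := ⟨j - 1, by omega⟩
  rw [getElem_keptSpokes_succ, h_double]
  cases i with
  | zero =>
    simp only [getElem_keptSpokes_zero (by omega : 0 < S.length), hm]
    rw [h.gap_getElem_of_gt (2 * j) (2 * (m + 2 - 1)) (by omega) (by omega)]
    have := h.strictMono.monotone (by omega : 2 * j ≤ 2 * m + 2)
    simp only [show m + 2 - 1 = m + 1 by omega, Nat.mul_succ, offset] at this h_offset ⊢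
    omega
  | succ i =>
    rw [getElem_keptSpokes_succ, h_double, h.gap_getElem _ _ (by omega), Nat.add_sub_add_left]

theorem minGap_getElem (h : IsSpread d S g₁ g₂ G) {k : ℕ} (hk : k + 1 < S.length) :
    minGap d S S[k + 1] = min (offset g₁ g₂ G (k + 1) - offset g₁ g₂ G k)
      (offset g₁ g₂ G (k + 2) - offset g₁ g₂ G (k + 1)) := by
  have h_last : offset g₁ g₂ G (k + 2) ≤ d := h.offset_length ▸ h.strictMono.monotone hk
  have h_prev_lt : offset g₁ g₂ G k < offset g₁ g₂ G (k + 1) := h.strictMono (Nat.lt_add_one _)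
  have h_succ_lt : offset g₁ g₂ G (k + 1) < offset g₁ g₂ G (k + 2) :=
    h.strictMono (Nat.lt_add_one _)
  have h_le : ∀ {j : ℕ} (hj : j < S.length), S[j] ≠ S[k + 1] →
      minGap d S S[k + 1] ≤ min (gap d S[k + 1] S[j]) (gap d S[j] S[k + 1]) :=
    fun hj => minGap_le (List.getElem_mem hj)
  apply le_antisymm
  · have h_prev := (h_le (Nat.lt_of_succ_lt hk)
      (h.getElem_ne (Nat.lt_add_one k) hk)).trans (min_le_right _ _)
    rw [h.gap_getElem _ _ (Nat.lt_add_one k)] at h_prev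
    refine le_min h_prev ?_
    rcases Nat.lt_or_ge (k + 2) S.length with hk' | hk'
    · have h_next := (h_le hk' (h.getElem_ne (Nat.lt_add_one _) hk').symm).trans (min_le_left _ _)
      rwa [h.gap_getElem _ _ (Nat.lt_add_one _)] at h_next
    -- The successor of the last spoke is the first one.
    · have h_first := (h_le (Nat.zero_lt_of_lt hk)
        (h.getElem_ne (Nat.succ_pos k) hk)).trans (min_le_left _ _)
      rw [h.gap_getElem_of_gt _ _ (Nat.succ_pos k)] at h_first
      have h_wrap : offset g₁ g₂ G (k + 2) = d := by
        rw [← h.offset_length, show S.length = k + 2 by omega]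
      rwa [h_wrap]
  · refine le_minGap (by omega) fun t ht hts => ?_
    obtain ⟨i, hi, rfl⟩ := List.getElem_of_mem ht
    have h_lt_d := h.offset_lt hi
    rcases lt_trichotomy i (k + 1) with hik | rfl | hik
    · have : offset g₁ g₂ G i ≤ offset g₁ g₂ G k := h.strictMono.monotone (Nat.le_of_lt_succ hik)
      rw [h.gap_getElem _ _ hik, h.gap_getElem_of_gt _ _ hik]
      omega
    · exact (hts rfl).elim
    · have : offset g₁ g₂ G (k + 2) ≤ offset g₁ g₂ G i := h.strictMono.monotone hik
      rw [h.gap_getElem _ _ hik, h.gap_getElem_of_gt _ _ hik]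
      omega

theorem pairwise_minGap_add_minGap_le (h : IsSpread d S g₁ g₂ G) :
    (usedSpokes S).Pairwise fun s t =>
      minGap d S s + minGap d S t ≤ min (gap d s t) (gap d t s) := by
  refine List.pairwise_iff_getElem.2 fun i j hi hj hij => ?_
  rw [getElem_usedSpokes, getElem_usedSpokes, h.minGap_getElem, h.minGap_getElem,
    h.gap_getElem _ _ (by omega), h.gap_getElem_of_gt _ _ (by omega)]
  rw [length_usedSpokes] at hj
  have h_le : ∀ {a b : ℕ}, a ≤ b → offset g₁ g₂ G a ≤ offset g₁ g₂ G b :=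
    fun hab => h.strictMono.monotone hab
  have := h_le (by omega : 2 * i ≤ 2 * i + 1)
  have := h_le (by omega : 2 * i + 1 ≤ 2 * i + 2)
  have := h_le (by omega : 2 * i + 2 ≤ 2 * j)
  have := h_le (by omega : 2 * j ≤ 2 * j + 1)
  have := h_le (by omega : 2 * j + 1 ≤ 2 * j + 2)
  have := h_le (by omega : 2 * j + 2 ≤ S.length)
  have := h.offset_length
  omega

theorem minGap_getElem_usedSpokes_zero (h : IsSpread d S g₁ g₂ G)
    (hS : 0 < (usedSpokes S).length) : minGap d S (usedSpokes S)[0] = min g₁ g₂ := by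
  rw [getElem_usedSpokes, h.minGap_getElem]
  simp only [offset]
  omega

theorem minGap_getElem_usedSpokes_of_ne_zero (h : IsSpread d S g₁ g₂ G) {i : ℕ} (hi₀ : i ≠ 0)
    (hi : i < (usedSpokes S).length) : minGap d S (usedSpokes S)[i] = G := by
  obtain ⟨k, rfl⟩ := Nat.exists_eq_succ_of_ne_zero hi₀
  rw [getElem_usedSpokes, h.minGap_getElem]
  simp only [Nat.mul_succ, offset, add_mul]
  omega

theorem exists_length_eq (h : IsSpread d S g₁ g₂ G) :
    ∃ m, S.length = m + 2 ∧ d = g₁ + g₂ + m * G := by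
  obtain ⟨m, hm⟩ := Nat.exists_eq_add_of_le' h.two_le_length
  exact ⟨m, hm, by rw [← h.offset_length, hm, offset]⟩

theorem le_mul_minGap_getElem_usedSpokes (h : IsSpread d S g₁ g₂ G) {i : ℕ} (hi₀ : i ≠ 0)
    (hi : i < (usedSpokes S).length) :
    d ≤ S.length * minGap d S (usedSpokes S)[i] := by
  obtain ⟨m, h_length, rfl⟩ := h.exists_length_eq
  rw [h.minGap_getElem_usedSpokes_of_ne_zero hi₀, h_length, add_mul]
  linarith [h.fst_le, h.snd_le]

theorem le_mul_minGap_of_mem_usedSpokes (h : IsSpread d S g₁ g₂ G) {s : ℕ}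
    (hs : s ∈ usedSpokes S) :
    d ≤ (2 * S.length - 1) * minGap d S s := by
  obtain ⟨i, hi, rfl⟩ := List.getElem_of_mem hs
  rcases eq_or_ne i 0 with rfl | hi₀
  · obtain ⟨m, h_length, rfl⟩ := h.exists_length_eq
    rw [h.minGap_getElem_usedSpokes_zero hi, h_length, show 2 * (m + 2) - 1 = 2 * m + 3 by omega]
    have h_min : G ≤ 2 * min g₁ g₂ := by
      have := h.le_two_mul_fst
      have := h.le_two_mul_snd
      omega
    have h_sum : g₁ + g₂ ≤ 3 * min g₁ g₂ := by
      have := h.fst_le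
      have := h.snd_le
      omega
    nlinarith
  · exact (h.le_mul_minGap_getElem_usedSpokes hi₀ hi).trans
      (Nat.mul_le_mul_right _ (by have := h.two_le_length; omega))

end IsSpread

end Spread

section Separation

/-- A disk of a star: the spoke and the distance from the origin of its centre, and its radius. -/
structure Balloon where
  spoke : ℕ
  dist : ℝ
  radius : ℝ

/-- The squared distance, given by the law of cosines, between the points at distance `a` from the
origin on the spoke `s` and at distance `b` on the spoke `t` of a star with `d` spokes. -/
noncomputable def sqDist (d s t : ℕ) (a b : ℝ) : ℝ := a ^ 2 + b ^ 2 - 2 * a * b * spokeCos d s t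

theorem sqDist_comm (d s t : ℕ) (a b : ℝ) : sqDist d s t a b = sqDist d t s b a := by
  rw [sqDist, sqDist, spokeCos_comm]
  ring

theorem sq_sub_mul_spokeCos_le_sqDist (d s t : ℕ) (a b : ℝ) :
    (b - a * spokeCos d s t) ^ 2 ≤ sqDist d s t a b := by
  have h_sq : spokeCos d s t ^ 2 ≤ 1 := cos_sq_le_one _
  rw [sqDist]
  nlinarith [mul_nonneg (sq_nonneg a) (sub_nonneg.2 h_sq)]

namespace Balloon

/-- The ray along the spoke `t` avoids the interior of the balloon `q`. -/
def RayAvoids (d : ℕ) (q : Balloon) (t : ℕ) : Prop :=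
  ∀ a : ℝ, 0 ≤ a → q.radius ^ 2 ≤ sqDist d q.spoke t q.dist a

/-- Two balloons have disjoint interiors, and neither interior meets the segment from the origin to
the centre of the other balloon. -/
structure Separated (d : ℕ) (q q' : Balloon) : Prop where
  disks : (q.radius + q'.radius) ^ 2 ≤ sqDist d q.spoke q'.spoke q.dist q'.dist
  left : ∀ a : ℝ, 0 ≤ a → a ≤ q'.dist → q.radius ^ 2 ≤ sqDist d q.spoke q'.spoke q.dist a
  right : ∀ a : ℝ, 0 ≤ a → a ≤ q.dist → q'.radius ^ 2 ≤ sqDist d q'.spoke q.spoke q'.dist a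

/-- The balloon `q` lies in the wedge of half-angle `μ ≤ π / 2` about its spoke. -/
structure InWedge (q : Balloon) (μ : ℝ) : Prop where
  angle_nonneg : 0 ≤ μ
  angle_le : μ ≤ π / 2
  radius_nonneg : 0 ≤ q.radius
  dist_nonneg : 0 ≤ q.dist
  radius_le : q.radius ≤ q.dist * sin μ

variable {d t : ℕ} {q q' : Balloon} {μ μ' P : ℝ}

theorem Separated.symm (h : Separated d q q') : Separated d q' q :=
  ⟨by rw [add_comm, sqDist_comm]; exact h.disks, h.right, h.left⟩

namespace InWedge

theorem sin_nonneg (h : InWedge q μ) : 0 ≤ sin μ :=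
  sin_nonneg_of_nonneg_of_le_pi h.angle_nonneg (by linarith [h.angle_le, pi_pos])

theorem cos_nonneg (h : InWedge q μ) : 0 ≤ cos μ :=
  cos_nonneg_of_neg_pi_div_two_le_of_le (by linarith [h.angle_nonneg, pi_pos]) h.angle_le

theorem rayAvoids (h : InWedge q μ) (h_cos : spokeCos d q.spoke t ≤ cos μ) : RayAvoids d q t := by
  intro a ha
  have h_radius : q.radius ^ 2 ≤ (q.dist * sin μ) ^ 2 :=
    pow_le_pow_left₀ h.radius_nonneg h.radius_le 2
  have h_inner := mul_le_mul_of_nonneg_left h_cos (mul_nonneg ha h.dist_nonneg)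
  have h_sin : (q.dist * sin μ) ^ 2 = q.dist ^ 2 - (q.dist * cos μ) ^ 2 := by
    rw [mul_pow, sin_sq]
    ring
  rw [sqDist]
  nlinarith [sq_nonneg (a - q.dist * cos μ)]

theorem separated (h : InWedge q μ) (h' : InWedge q' μ')
    (h_cos : spokeCos d q.spoke q'.spoke ≤ cos (μ + μ')) : Separated d q q' := by
  have h_angle : μ + μ' ≤ π := by linarith [h.angle_le, h'.angle_le]
  have h_left : spokeCos d q.spoke q'.spoke ≤ cos μ := h_cos.trans <|
    cos_le_cos_of_nonneg_of_le_pi h.angle_nonneg h_angle (le_add_of_nonneg_right h'.angle_nonneg)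
  have h_right : spokeCos d q'.spoke q.spoke ≤ cos μ' := (spokeCos_comm _ _ _).trans_le <|
    h_cos.trans <|
    cos_le_cos_of_nonneg_of_le_pi h'.angle_nonneg h_angle (le_add_of_nonneg_left h.angle_nonneg)
  refine ⟨?_, fun a ha _ => h.rayAvoids h_left a ha, fun a ha _ => h'.rayAvoids h_right a ha⟩
  have h_radii : (q.radius + q'.radius) ^ 2 ≤ (q.dist * sin μ + q'.dist * sin μ') ^ 2 :=
    pow_le_pow_left₀ (add_nonneg h.radius_nonneg h'.radius_nonneg)
      (add_le_add h.radius_le h'.radius_le) 2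
  have h_inner := mul_le_mul_of_nonneg_left h_cos (mul_nonneg h.dist_nonneg h'.dist_nonneg)
  rw [cos_add] at h_inner
  have h_sin : (q.dist * sin μ + q'.dist * sin μ') ^ 2 =
      q.dist ^ 2 + q'.dist ^ 2 - (q.dist * cos μ - q'.dist * cos μ') ^ 2
        - 2 * (q.dist * q'.dist * (cos μ * cos μ' - sin μ * sin μ')) := by
    linear_combination q.dist ^ 2 * sin_sq_add_cos_sq μ + q'.dist ^ 2 * sin_sq_add_cos_sq μ'
  rw [sqDist]
  nlinarith [sq_nonneg (q.dist * cos μ - q'.dist * cos μ')]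

end InWedge

/-- The line orthogonal to the spoke of `q'` at distance `P` from the origin separates the two
balloons. -/
theorem RayAvoids.separated (h_ray : RayAvoids d q q'.spoke) (hq : 0 ≤ q.radius)
    (hq' : 0 ≤ q'.radius) (hP : 0 ≤ P)
    (h_proj : q.dist * spokeCos d q.spoke q'.spoke + q.radius ≤ P)
    (h_inner : P ≤ q'.dist - q'.radius) : Separated d q q' := by
  refine ⟨?_, fun a ha _ => h_ray a ha, fun a ha haq => ?_⟩
  · have h_sum : q.radius + q'.radius ≤ q'.dist - q.dist * spokeCos d q.spoke q'.spoke := by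
      linarith
    exact (pow_le_pow_left₀ (by positivity) h_sum 2).trans (sq_sub_mul_spokeCos_le_sqDist _ _ _ _ _)
  · have h_le : q'.radius ≤ q'.dist - a * spokeCos d q.spoke q'.spoke := by
      rcases le_total 0 (spokeCos d q.spoke q'.spoke) with h | h
      · linarith [mul_le_mul_of_nonneg_right haq h]
      · linarith [mul_nonpos_of_nonneg_of_nonpos ha h]
    rw [sqDist_comm]
    exact (pow_le_pow_left₀ hq' h_le 2).trans (sq_sub_mul_spokeCos_le_sqDist _ _ _ _ _)

end Balloon

end Separation

section Wedge

/-- Half the opening angle of the wedge that is reserved for a balloon on the spoke `s` in a round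
played with the spokes `S`. -/
noncomputable def wedgeAngle (d : ℕ) (S : List ℕ) (s : ℕ) : ℝ :=
  min (2 * π * minGap d S s / d) (π / 2)

variable {d s t : ℕ} {S : List ℕ} {safe r : ℝ}

theorem wedgeAngle_nonneg (d : ℕ) (S : List ℕ) (s : ℕ) : 0 ≤ wedgeAngle d S s :=
  le_min (by positivity) (by positivity)

theorem wedgeAngle_le_pi_div_two (d : ℕ) (S : List ℕ) (s : ℕ) : wedgeAngle d S s ≤ π / 2 :=
  min_le_right _ _

theorem wedgeAngle_mul_le (hd : 0 < d) (S : List ℕ) (s : ℕ) :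
    wedgeAngle d S s * d ≤ 2 * π * minGap d S s :=
  (le_div_iff₀ (by positivity)).1 (min_le_left _ _)

theorem sin_wedgeAngle_pos (h : 0 < wedgeAngle d S s) : 0 < sin (wedgeAngle d S s) :=
  sin_pos_of_pos_of_lt_pi h (by linarith [wedgeAngle_le_pi_div_two d S s, pi_pos])

theorem centerDist_eq (h : 0 < wedgeAngle d S s) (safe r : ℝ) :
    centerDist d S safe s r = max (r / sin (wedgeAngle d S s)) (safe + r) := by
  have h_half : min (2 * (2 * π * minGap d S s / d)) π / 2 = wedgeAngle d S s := by
    rw [wedgeAngle, ← min_div_div_right two_pos.le, mul_div_cancel_left₀ _ two_ne_zero]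
  rw [centerDist, alpha_mul_sub (h_half ▸ (sin_wedgeAngle_pos h).ne'), h_half]

theorem add_le_centerDist (d : ℕ) (S : List ℕ) (s : ℕ) (safe r : ℝ) :
    safe + r ≤ centerDist d S safe s r :=
  le_max_right _ _

theorem inWedge_centerDist (h : 0 < wedgeAngle d S s) (h_safe : 0 ≤ safe) (hr : 0 ≤ r) :
    Balloon.InWedge ⟨s, centerDist d S safe s r, r⟩ (wedgeAngle d S s) where
  angle_nonneg := h.le
  angle_le := wedgeAngle_le_pi_div_two d S s
  radius_nonneg := hr
  dist_nonneg := (add_nonneg h_safe hr).trans (add_le_centerDist d S s safe r)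
  radius_le := by
    rw [← div_le_iff₀ (sin_wedgeAngle_pos h), centerDist_eq h]
    exact le_max_left _ _

theorem spokeCos_le_cos_wedgeAngle (hs : s < d) (ht : t < d) (htS : t ∈ S) (hts : t ≠ s) :
    spokeCos d s t ≤ cos (wedgeAngle d S s) := by
  have h_gap := le_min_iff.1 (minGap_le (d := d) htS hts)
  have h_mul := wedgeAngle_mul_le (hs.trans_le' (Nat.zero_le s)) S s
  refine spokeCos_le_cos hs ht (wedgeAngle_nonneg d S s) (h_mul.trans ?_) (h_mul.trans ?_)
  · gcongr
    exact h_gap.1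
  · gcongr
    exact h_gap.2

theorem le_wedgeAngle {m : ℕ} (hd : 0 < d) (hm : 4 ≤ m) (h : d ≤ m * minGap d S s) :
    2 * π / m ≤ wedgeAngle d S s := by
  have hm' : (4 : ℝ) ≤ m := by exact_mod_cast hm
  have h' : (d : ℝ) ≤ m * minGap d S s := by exact_mod_cast h
  apply le_min
  · rw [div_le_div_iff₀ (by positivity) (by positivity)]
    nlinarith [pi_pos]
  · rw [div_le_div_iff₀ (by positivity) two_pos]
    nlinarith [pi_pos]

namespace IsSpread

variable {g₁ g₂ G : ℕ}

theorem pairwise_spokeCos_le (h : IsSpread d S g₁ g₂ G) :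
    (usedSpokes S).Pairwise fun s t =>
      spokeCos d s t ≤ cos (wedgeAngle d S s + wedgeAngle d S t) := by
  have h_mem : ∀ s ∈ usedSpokes S, s < d := fun s hs =>
    h.lt s ((usedSpokes_append_keptSpokes_perm S).subset (List.mem_append_left _ hs))
  refine h.pairwise_minGap_add_minGap_le.imp_of_mem fun {s t} hs ht hst => ?_
  have h_mul : (wedgeAngle d S s + wedgeAngle d S t) * d ≤
      2 * π * (minGap d S s + minGap d S t : ℕ) := by
    push_cast
    linarith [wedgeAngle_mul_le h.spokeCount_pos S s, wedgeAngle_mul_le h.spokeCount_pos S t]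
  refine spokeCos_le_cos (h_mem s hs) (h_mem t ht)
    (add_nonneg (wedgeAngle_nonneg d S s) (wedgeAngle_nonneg d S t))
    (h_mul.trans ?_) (h_mul.trans ?_)
  · gcongr
    exact hst.trans (min_le_left _ _)
  · gcongr
    exact hst.trans (min_le_right _ _)

theorem le_wedgeAngle_of_mem_usedSpokes (h : IsSpread d S g₁ g₂ G) (hS : 3 ≤ S.length)
    (hs : s ∈ usedSpokes S) : 2 * π / (2 * S.length - 1) ≤ wedgeAngle d S s := by
  have h_le := le_wedgeAngle h.spokeCount_pos (by omega) (h.le_mul_minGap_of_mem_usedSpokes hs)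
  rw [Nat.cast_sub (by omega)] at h_le
  exact_mod_cast h_le

theorem wedgeAngle_pos_of_mem_usedSpokes (h : IsSpread d S g₁ g₂ G) (hS : 3 ≤ S.length)
    (hs : s ∈ usedSpokes S) : 0 < wedgeAngle d S s := by
  have hS' : (3 : ℝ) ≤ S.length := by exact_mod_cast hS
  exact (div_pos two_pi_pos (by linarith)).trans_le (h.le_wedgeAngle_of_mem_usedSpokes hS hs)

end IsSpread

end Wedge

section Pushed

theorem pushed_le {safe : ℝ} (h : 0 ≤ safe) (w : Option ℕ) : pushed safe w ≤ safe := by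
  cases w with
  | none => exact le_rfl
  | some l =>
    rw [pushed, mul_div_assoc]
    refine mul_le_of_le_one_right h (div_le_one_of_le₀ ?_ ?_)
    · exact add_le_add_right (cos_le_one _) _
    · linarith [neg_one_le_sin (2 * π / (2 * (l : ℝ) - 1))]

theorem one_le_sin_add_cos {μ : ℝ} (h_nonneg : 0 ≤ μ) (h_le : μ ≤ π / 2) : 1 ≤ sin μ + cos μ := by
  have h_sin := sin_nonneg_of_nonneg_of_le_pi h_nonneg (by linarith [pi_pos])
  have h_cos := cos_nonneg_of_neg_pi_div_two_le_of_le (by linarith) h_le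
  nlinarith [sin_sq_add_cos_sq μ]

theorem antitoneOn_sin_add_cos_div_sin_add_one :
    AntitoneOn (fun μ => (sin μ + cos μ) / (sin μ + 1)) (Set.Icc 0 (π / 2)) := by
  rintro β ⟨hβ, hβ'⟩ μ ⟨hμ, hμ'⟩ hβμ
  have h_sinβ := sin_nonneg_of_nonneg_of_le_pi hβ (by linarith)
  have h_sinμ := sin_nonneg_of_nonneg_of_le_pi hμ (by linarith)
  have h_sin_sub := sin_nonneg_of_nonneg_of_le_pi (sub_nonneg.2 hβμ) (by linarith)
  have h_cos : cos μ ≤ cos β := cos_le_cos_of_nonneg_of_le_pi hβ (by linarith) hβμ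
  have h_sin : sin μ ≤ sin β + sin (μ - β) := by
    rw [show sin μ = sin (μ - β) * cos β + cos (μ - β) * sin β by rw [← sin_add, sub_add_cancel]]
    nlinarith [cos_le_one β, cos_le_one (μ - β)]
  rw [sin_sub] at h_sin
  rw [div_le_div_iff₀ (by linarith) (by linarith)]
  linarith

theorem Balloon.InWedge.mul_cos_add_le_pushed {q : Balloon} {μ safe : ℝ} {l : ℕ}
    (h : q.InWedge μ) (hl : 1 ≤ l) (hlμ : 2 * π / (2 * l - 1) ≤ μ)
    (h_safe : q.dist + q.radius ≤ safe) :
    q.dist * cos μ + q.radius ≤ pushed safe (some l) := by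
  have h_sin := h.sin_nonneg
  have h_cos := h.cos_nonneg
  have hl' : (1 : ℝ) ≤ l := by exact_mod_cast hl
  have hβ : 0 ≤ 2 * π / (2 * (l : ℝ) - 1) := div_nonneg two_pi_pos.le (by linarith)
  have h_mul : (q.dist * cos μ + q.radius) * (sin μ + 1) ≤ safe * (sin μ + cos μ) := by
    have h_prod := mul_nonneg (sub_nonneg.2 (cos_le_one μ)) (sub_nonneg.2 h.radius_le)
    nlinarith [mul_le_mul_of_nonneg_right h_safe (add_nonneg h_sin h_cos)]
  have h_div : q.dist * cos μ + q.radius ≤ safe * ((sin μ + cos μ) / (sin μ + 1)) := by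
    rwa [← mul_div_assoc, le_div_iff₀ (by linarith)]
  rw [pushed, mul_div_assoc]
  refine h_div.trans (mul_le_mul_of_nonneg_left ?_ ?_)
  · exact antitoneOn_sin_add_cos_div_sin_add_one ⟨hβ, hlμ.trans h.angle_le⟩
      ⟨h.angle_nonneg, h.angle_le⟩ hlμ
  · linarith [h.dist_nonneg, h.radius_nonneg]

end Pushed

section Round

/-- The balloons of the layout `lay` of balloons with radii `rs`. -/
def Layout.balloons (lay : Layout) (rs : List ℝ) : List Balloon :=
  List.zipWith (fun q r => ⟨q.1, q.2, r⟩) lay.placed rs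

/-- The balloons that are placed in a round played with the spokes `S`. -/
noncomputable def roundBalloons (d : ℕ) (S : List ℕ) (safe : ℝ) (rs : List ℝ) : List Balloon :=
  List.zipWith (fun s r => ⟨s, centerDist d S safe s r, r⟩) (usedSpokes S) rs

/-- The radius of the safe disk after a round played with the spokes `S`. -/
noncomputable def roundSafe (d : ℕ) (S : List ℕ) (safe : ℝ) (rs : List ℝ) : ℝ :=
  ((roundBalloons d S safe rs).map fun q => q.dist + q.radius).foldr max safe

open Classical in
/-- The record `some ℓ` of a wedge round played with `ℓ` spokes, `none` for any other round. -/
noncomputable def roundWedge (d : ℕ) (S : List ℕ) (safe : ℝ) (rs : List ℝ) : Option ℕ :=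
  if ∃ q ∈ roundBalloons d S safe rs, safe + q.radius < q.dist then some S.length else none

/-- The layout of the balloons that remain after a round played with the spokes `S`. -/
noncomputable def roundRest (d f : ℕ) (S : List ℕ) (safe : ℝ) (rs : List ℝ) : Layout :=
  greedyRounds d f (keptSpokes S) (roundSafe d S safe rs) (roundWedge d S safe rs)
    (rs.drop (usedSpokes S).length)

variable {d f : ℕ} {S : List ℕ} {safe : ℝ} {wedge : Option ℕ} {rs : List ℝ}

theorem zip_take_length {α β : Type*} : ∀ (l : List α) (l' : List β),
    List.zip l (l'.take l.length) = List.zip l l'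
  | [], _ => by simp only [List.zip_nil_left]
  | _ :: _, [] => by simp only [List.take_nil, List.zip_nil_right]
  | a :: l, b :: l' => by
    rw [List.length_cons, List.take_succ_cons, List.zip_cons_cons, List.zip_cons_cons,
      zip_take_length l l']

theorem roundBalloons_eq_map_zip (d : ℕ) (S : List ℕ) (safe : ℝ) (rs : List ℝ) :
    roundBalloons d S safe rs = (List.zip (usedSpokes S) rs).map
      fun q => ⟨q.1, centerDist d S safe q.1 q.2, q.2⟩ := by
  rw [List.map_zip_eq_zipWith]
  rfl

theorem Layout.balloons_eq_map_zip (lay : Layout) (rs : List ℝ) :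
    lay.balloons rs = (List.zip lay.placed rs).map fun q => ⟨q.1.1, q.1.2, q.2⟩ := by
  rw [List.map_zip_eq_zipWith]
  rfl

theorem greedyRounds_of_lt (h : f + 2 < S.length) (safe : ℝ) (wedge : Option ℕ) (rs : List ℝ) :
    greedyRounds d f S safe wedge rs =
      ⟨((roundBalloons d S safe rs).map fun q => (q.spoke, q.dist)) ++
        (roundRest d f S safe rs).placed, (roundRest d f S safe rs).free⟩ := by
  rw [greedyRounds, dif_pos h]
  simp only [roundRest, roundSafe, roundWedge, zip_take_length, roundBalloons_eq_map_zip,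
    List.map_map, List.mem_map, exists_exists_and_eq_and, Function.comp_def]

theorem greedyRounds_of_not_lt (h : ¬ f + 2 < S.length) (safe : ℝ) (wedge : Option ℕ)
    (rs : List ℝ) : greedyRounds d f S safe wedge rs = terminalLayout d f S safe wedge rs := by
  rw [greedyRounds, dif_neg h]

theorem length_roundBalloons (hS : (usedSpokes S).length ≤ rs.length) :
    (roundBalloons d S safe rs).length = (usedSpokes S).length := by
  rw [roundBalloons, List.length_zipWith, min_eq_left hS]

theorem map_spoke_roundBalloons (hS : (usedSpokes S).length ≤ rs.length) :
    (roundBalloons d S safe rs).map Balloon.spoke = usedSpokes S :=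
  List.map_zipWith.trans (List.map_zip_eq_zipWith.symm.trans (List.map_fst_zip hS))

theorem balloons_greedyRounds (h : f + 2 < S.length) (hS : (usedSpokes S).length ≤ rs.length)
    (safe : ℝ) (wedge : Option ℕ) :
    (greedyRounds d f S safe wedge rs).balloons rs =
      roundBalloons d S safe rs ++
        (roundRest d f S safe rs).balloons (rs.drop (usedSpokes S).length) := by
  have h_now : List.zipWith (fun q r => (⟨q.1, q.2, r⟩ : Balloon))
      ((roundBalloons d S safe rs).map fun q => (q.spoke, q.dist))
      (rs.take (usedSpokes S).length) = roundBalloons d S safe rs := by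
    rw [roundBalloons]
    clear h
    generalize usedSpokes S = u at hS ⊢
    induction u generalizing rs with
    | nil => rfl
    | cons s u ih => cases rs with
      | nil => rfl
      | cons r rs =>
        simp only [List.zipWith_cons_cons, List.map_cons, List.length_cons, List.take_succ_cons]
        rw [ih (Nat.le_of_succ_le_succ hS)]
  rw [greedyRounds_of_lt h, Layout.balloons, Layout.balloons]
  conv_lhs => rw [← List.take_append_drop (usedSpokes S).length rs]
  rw [List.zipWith_append, List.take_append_drop, h_now]
  rw [List.take_append_drop, List.length_map, length_roundBalloons hS, List.length_take,
    min_eq_left hS]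

end Round

section RoundBalloons

variable {d : ℕ} {S : List ℕ} {safe : ℝ} {rs : List ℝ} {g₁ g₂ G t : ℕ} {q : Balloon}

theorem Layout.mem_of_mem_balloons {lay : Layout} (hq : q ∈ lay.balloons rs) :
    (q.spoke, q.dist) ∈ lay.placed ∧ q.radius ∈ rs := by
  rw [Layout.balloons_eq_map_zip] at hq
  obtain ⟨p, hp, rfl⟩ := List.mem_map.1 hq
  exact List.of_mem_zip hp

theorem of_mem_roundBalloons (hq : q ∈ roundBalloons d S safe rs) :
    q.spoke ∈ usedSpokes S ∧ q.radius ∈ rs ∧ q.dist = centerDist d S safe q.spoke q.radius := by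
  rw [roundBalloons_eq_map_zip] at hq
  obtain ⟨p, hp, rfl⟩ := List.mem_map.1 hq
  exact ⟨(List.of_mem_zip hp).1, (List.of_mem_zip hp).2, rfl⟩

theorem safe_le_roundSafe (d : ℕ) (S : List ℕ) (safe : ℝ) (rs : List ℝ) :
    safe ≤ roundSafe d S safe rs :=
  (foldr_max_le_iff.1 le_rfl).1

theorem dist_add_radius_le_roundSafe (hq : q ∈ roundBalloons d S safe rs) :
    q.dist + q.radius ≤ roundSafe d S safe rs :=
  (foldr_max_le_iff.1 le_rfl).2 _ (List.mem_map.2 ⟨q, hq, rfl⟩)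

theorem safe_add_radius_le_dist (hq : q ∈ roundBalloons d S safe rs) :
    safe + q.radius ≤ q.dist := by
  rw [(of_mem_roundBalloons hq).2.2]
  exact add_le_centerDist _ _ _ _ _

theorem dist_mul_sin_wedgeAngle (hq : q ∈ roundBalloons d S safe rs)
    (h_lt : safe + q.radius < q.dist) (h_angle : 0 < wedgeAngle d S q.spoke) :
    q.dist * sin (wedgeAngle d S q.spoke) = q.radius := by
  have h_dist := (of_mem_roundBalloons hq).2.2
  rw [centerDist_eq h_angle] at h_dist
  rw [← eq_div_iff (sin_wedgeAngle_pos h_angle).ne', h_dist]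
  refine max_eq_left_iff.2 (le_of_not_gt fun h_gt => h_lt.ne' ?_)
  rw [h_dist, max_eq_right h_gt.le]

namespace IsSpread

variable (h : IsSpread d S g₁ g₂ G) (hS : 3 ≤ S.length) (h_safe : 0 ≤ safe) (hr : ∀ r ∈ rs, 0 ≤ r)
include h

theorem spokeCos_le_cos_wedgeAngle_of_mem_keptSpokes {s : ℕ} (hs : s ∈ usedSpokes S)
    (ht : t ∈ keptSpokes S) : spokeCos d s t ≤ cos (wedgeAngle d S s) := by
  have h_perm := usedSpokes_append_keptSpokes_perm S
  have h_disjoint := (List.nodup_append.1 (h_perm.nodup_iff.2 h.nodup)).2.2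
  have htS : t ∈ S := h_perm.subset (List.mem_append_right _ ht)
  exact BalloonTree.spokeCos_le_cos_wedgeAngle
    (h.lt s (h_perm.subset (List.mem_append_left _ hs))) (h.lt t htS) htS
    (h_disjoint s hs t ht).symm

include hS h_safe hr

theorem inWedge_of_mem_roundBalloons (hq : q ∈ roundBalloons d S safe rs) :
    q.InWedge (wedgeAngle d S q.spoke) := by
  obtain ⟨h_spoke, h_radius, h_dist⟩ := of_mem_roundBalloons hq
  have h_wedge := inWedge_centerDist (h.wedgeAngle_pos_of_mem_usedSpokes hS h_spoke) h_safe
    (hr _ h_radius)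
  rwa [← h_dist] at h_wedge

theorem rayAvoids_of_mem_roundBalloons (hq : q ∈ roundBalloons d S safe rs)
    (ht : t ∈ keptSpokes S) : q.RayAvoids d t :=
  (h.inWedge_of_mem_roundBalloons hS h_safe hr hq).rayAvoids <|
    h.spokeCos_le_cos_wedgeAngle_of_mem_keptSpokes (of_mem_roundBalloons hq).1 ht

theorem pairwise_separated_roundBalloons (h_used : (usedSpokes S).length ≤ rs.length) :
    (roundBalloons d S safe rs).Pairwise (Balloon.Separated d) := by
  have h_cos := h.pairwise_spokeCos_le
  rw [← map_spoke_roundBalloons (d := d) (safe := safe) h_used, List.pairwise_map] at h_cos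
  exact h_cos.imp_of_mem fun hq hq' => (h.inWedge_of_mem_roundBalloons hS h_safe hr hq).separated
    (h.inWedge_of_mem_roundBalloons hS h_safe hr hq')

theorem mul_cos_wedgeAngle_add_le_pushed (hq : q ∈ roundBalloons d S safe rs) :
    q.dist * cos (wedgeAngle d S q.spoke) + q.radius ≤
      pushed (roundSafe d S safe rs) (roundWedge d S safe rs) := by
  have h_wedge := h.inWedge_of_mem_roundBalloons hS h_safe hr hq
  have h_le := dist_add_radius_le_roundSafe hq
  rw [roundWedge]
  split_ifs
  · exact h_wedge.mul_cos_add_le_pushed (one_le_two.trans h.two_le_length)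
      (h.le_wedgeAngle_of_mem_usedSpokes hS (of_mem_roundBalloons hq).1) h_le
  · exact (add_le_add_left (mul_le_of_le_one_right h_wedge.dist_nonneg (cos_le_one _)) _).trans h_le

theorem mul_spokeCos_add_le_pushed (hq : q ∈ roundBalloons d S safe rs) (ht : t ∈ keptSpokes S) :
    q.dist * spokeCos d q.spoke t + q.radius ≤
      pushed (roundSafe d S safe rs) (roundWedge d S safe rs) := by
  refine le_trans ?_ (h.mul_cos_wedgeAngle_add_le_pushed hS h_safe hr hq)
  gcongr
  · exact (h.inWedge_of_mem_roundBalloons hS h_safe hr hq).dist_nonneg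
  · exact h.spokeCos_le_cos_wedgeAngle_of_mem_keptSpokes (of_mem_roundBalloons hq).1 ht

theorem safe_le_pushed_roundSafe :
    safe ≤ pushed (roundSafe d S safe rs) (roundWedge d S safe rs) := by
  by_cases h_round : ∃ q ∈ roundBalloons d S safe rs, safe + q.radius < q.dist
  · obtain ⟨q, hq, h_lt⟩ := h_round
    obtain ⟨h_spoke, -, -⟩ := of_mem_roundBalloons hq
    have h_wedge := h.inWedge_of_mem_roundBalloons hS h_safe hr hq
    have h_touch := dist_mul_sin_wedgeAngle hq h_lt (h.wedgeAngle_pos_of_mem_usedSpokes hS h_spoke)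
    have h_one := one_le_sin_add_cos h_wedge.angle_nonneg h_wedge.angle_le
    refine le_trans ?_ (h.mul_cos_wedgeAngle_add_le_pushed hS h_safe hr hq)
    nlinarith [mul_le_mul_of_nonneg_left h_one h_wedge.dist_nonneg, h_wedge.radius_nonneg]
  · rw [roundWedge, if_neg h_round]
    exact safe_le_roundSafe d S safe rs

end IsSpread

end RoundBalloons

section IsSeparated

/-- The layout `lay` of balloons with radii `rs` occupies all but `f` of the spokes `S`, its
balloons are pairwise separated, have distance at least `P` from the origin, and avoid the rays
along the free spokes. Two free spokes enclose an angle of at least `2π / 3`. -/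
structure IsSeparated (d f : ℕ) (S : List ℕ) (P : ℝ) (rs : List ℝ) (lay : Layout) : Prop where
  length_placed : lay.placed.length = rs.length
  perm : (lay.placed.map Prod.fst ++ lay.free).Perm S
  length_free : lay.free.length = f
  inner : ∀ q ∈ lay.balloons rs, P ≤ q.dist - q.radius
  pairwise : (lay.balloons rs).Pairwise (Balloon.Separated d)
  rayAvoids : ∀ q ∈ lay.balloons rs, ∀ s ∈ lay.free, q.RayAvoids d s
  angle : ∀ a b, lay.free = [a, b] → spokeCos d a b ≤ -(1 / 2)

variable {d f : ℕ} {S : List ℕ} {safe P : ℝ} {wedge : Option ℕ} {rs : List ℝ} {g₁ g₂ G : ℕ}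

theorem isSeparated_round (h : IsSpread d S g₁ g₂ G) (hf : f ≤ 2) (hS : f + 2 < S.length)
    (h_safe : 0 ≤ safe) (h_rs : rs.length + f = S.length) (hr : ∀ r ∈ rs, 0 ≤ r)
    (h_rest : IsSeparated d f (keptSpokes S)
      (pushed (roundSafe d S safe rs) (roundWedge d S safe rs))
      (rs.drop (usedSpokes S).length) (roundRest d f S safe rs)) :
    IsSeparated d f S (pushed safe wedge) rs (greedyRounds d f S safe wedge rs) := by
  have hS₃ : 3 ≤ S.length := by omega
  have h_used : (usedSpokes S).length ≤ rs.length := by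
    rw [length_usedSpokes]
    omega
  have h_pushed := h.safe_le_pushed_roundSafe hS₃ h_safe hr
  have h_balloons := balloons_greedyRounds (d := d) hS h_used safe wedge
  have h_kept : ∀ q ∈ (roundRest d f S safe rs).balloons (rs.drop (usedSpokes S).length),
      q.spoke ∈ keptSpokes S := fun q hq => h_rest.perm.subset <| List.mem_append_left _ <|
    List.mem_map.2 ⟨_, (Layout.mem_of_mem_balloons hq).1, rfl⟩
  have h_free : (greedyRounds d f S safe wedge rs).free = (roundRest d f S safe rs).free := by
    rw [greedyRounds_of_lt hS]
  refine ⟨?_, ?_, h_free ▸ h_rest.length_free, ?_, ?_, ?_, h_free ▸ h_rest.angle⟩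
  · rw [greedyRounds_of_lt hS, List.length_append, List.length_map, length_roundBalloons h_used,
      h_rest.length_placed, List.length_drop]
    omega
  · rw [greedyRounds_of_lt hS, List.map_append, List.map_map, List.append_assoc]
    refine (List.Perm.append_left _ h_rest.perm).trans ?_
    exact map_spoke_roundBalloons (d := d) (safe := safe) h_used ▸
      usedSpokes_append_keptSpokes_perm S
  · rw [h_balloons]
    refine List.forall_mem_append.2 ⟨fun q hq => ?_, fun q hq => ?_⟩
    · linarith [safe_add_radius_le_dist hq, pushed_le h_safe wedge]
    · linarith [h_rest.inner q hq, pushed_le h_safe wedge]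
  · rw [h_balloons, List.pairwise_append]
    refine ⟨h.pairwise_separated_roundBalloons hS₃ h_safe hr h_used, h_rest.pairwise,
      fun q hq q' hq' => ?_⟩
    have hq'r := hr _ (List.mem_of_mem_drop (Layout.mem_of_mem_balloons hq').2)
    exact (h.rayAvoids_of_mem_roundBalloons hS₃ h_safe hr hq (h_kept q' hq')).separated
      (hr _ (of_mem_roundBalloons hq).2.1) hq'r (h_safe.trans h_pushed)
      (h.mul_spokeCos_add_le_pushed hS₃ h_safe hr hq (h_kept q' hq')) (h_rest.inner q' hq')
  · rw [h_balloons, h_free]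
    exact List.forall_mem_append.2 ⟨fun q hq s hs => h.rayAvoids_of_mem_roundBalloons hS₃ h_safe hr
      hq (h_rest.perm.subset (List.mem_append_right _ hs)), h_rest.rayAvoids⟩

end IsSeparated

section Terminal

variable {d i j : ℕ} {S F : List ℕ} {safe P r r' μ μ' x x' : ℝ} {wedge : Option ℕ}
  {a b c e a' g₁ g₂ G : ℕ}

theorem cos_two_pi_div_three : cos (2 * π / 3) = -(1 / 2) := by
  rw [show 2 * π / 3 = π - π / 3 by ring, cos_pi_sub, cos_pi_div_three]

theorem inWedge_pi_div_two (s : ℕ) (h_safe : 0 ≤ safe) (hr : 0 ≤ r) :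
    Balloon.InWedge ⟨s, safe + r, r⟩ (π / 2) where
  angle_nonneg := pi_div_two_pos.le
  angle_le := le_rfl
  radius_nonneg := hr
  dist_nonneg := add_nonneg h_safe hr
  radius_le := by
    rw [sin_pi_div_two, mul_one]
    exact le_add_of_nonneg_left h_safe

theorem inWedge_max_alpha (s : ℕ) {φ : ℝ} (hφ : 0 < φ) (hφ' : φ ≤ π) (h_safe : 0 ≤ safe)
    (hr : 0 ≤ r) : Balloon.InWedge ⟨s, max (alpha φ * r - r) (safe + r), r⟩ (φ / 2) := by
  have h_sin : 0 < sin (φ / 2) :=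
    sin_pos_of_pos_of_lt_pi (half_pos hφ) (by linarith)
  refine ⟨by linarith, by linarith, hr, le_max_of_le_right (add_nonneg h_safe hr), ?_⟩
  rw [← div_le_iff₀ h_sin, ← alpha_mul_sub h_sin.ne']
  exact le_max_left _ _

theorem IsSpread.spokeCos_getElem_le (h : IsSpread d S g₁ g₂ G) (i j : ℕ) {m k : ℕ}
    (hij : i < j) (hj : j < S.length) (hk : 0 < k) (hμ : μ = m * π / k)
    (h_gap : m * d ≤ 2 * k * (offset g₁ g₂ G j - offset g₁ g₂ G i))
    (h_gap' : m * d ≤ 2 * k * (d - (offset g₁ g₂ G j - offset g₁ g₂ G i))) :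
    spokeCos d S[i] S[j] ≤ cos μ := by
  rw [hμ]
  apply spokeCos_le_cos_mul_pi_div hk (h.lt _ (List.getElem_mem _)) (h.lt _ (List.getElem_mem _))
  · rwa [h.gap_getElem i j hij hj]
  · rwa [h.gap_getElem_of_gt i j hij hj]

theorem isSeparated_singleton (h : Balloon.InWedge ⟨a, x, r⟩ μ) (h_inner : P ≤ x - r)
    (h_perm : (a :: F).Perm S) (h_cos : ∀ s ∈ F, spokeCos d a s ≤ cos μ)
    (h_angle : ∀ s t, F = [s, t] → spokeCos d s t ≤ -(1 / 2)) :
    IsSeparated d F.length S P [r] ⟨[(a, x)], F⟩ where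
  length_placed := rfl
  perm := h_perm
  length_free := rfl
  inner := List.forall_mem_singleton.2 h_inner
  pairwise := List.pairwise_singleton _ _
  rayAvoids := List.forall_mem_singleton.2 fun s hs => h.rayAvoids (h_cos s hs)
  angle := h_angle

theorem isSeparated_pair (h : Balloon.InWedge ⟨a, x, r⟩ μ) (h' : Balloon.InWedge ⟨a', x', r'⟩ μ')
    (h_inner : P ≤ x - r) (h_inner' : P ≤ x' - r') (h_perm : (a :: a' :: F).Perm S)
    (h_pair : spokeCos d a a' ≤ cos (μ + μ')) (h_cos : ∀ s ∈ F, spokeCos d a s ≤ cos μ)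
    (h_cos' : ∀ s ∈ F, spokeCos d a' s ≤ cos μ')
    (h_angle : ∀ s t, F = [s, t] → spokeCos d s t ≤ -(1 / 2)) :
    IsSeparated d F.length S P [r, r'] ⟨[(a, x), (a', x')], F⟩ where
  length_placed := rfl
  perm := h_perm
  length_free := rfl
  inner := List.forall_mem_cons.2 ⟨h_inner, List.forall_mem_singleton.2 h_inner'⟩
  pairwise := List.pairwise_pair.2 (h.separated h' h_pair)
  rayAvoids := List.forall_mem_cons.2 ⟨fun s hs => h.rayAvoids (h_cos s hs),
    List.forall_mem_singleton.2 fun s hs => h'.rayAvoids (h_cos' s hs)⟩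
  angle := h_angle

theorem pushed_le_max_sub (h_safe : 0 ≤ safe) (wedge : Option ℕ) (x r : ℝ) :
    pushed safe wedge ≤ max x (safe + r) - r := by
  linarith [pushed_le h_safe wedge, le_max_right x (safe + r)]

theorem pushed_le_add_sub (h_safe : 0 ≤ safe) (wedge : Option ℕ) (r : ℝ) :
    pushed safe wedge ≤ safe + r - r := by
  linarith [pushed_le h_safe wedge]

theorem isSeparated_two_spokes (h : IsSpread d [a, b] g₁ g₂ G) (h_safe : 0 ≤ safe) (hr : 0 ≤ r) :
    IsSeparated d 1 [a, b] (pushed safe wedge) [r] (terminalLayout d 1 [a, b] safe wedge [r]) := by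
  have h_d : g₁ + g₂ + 0 * G = d := h.offset_length
  obtain ⟨-, -, h₁, h₂, h₃, h₄, -, -, -⟩ := id h
  have h_ab : spokeCos d a b ≤ cos (π / 2) :=
    h.spokeCos_getElem_le 0 1 (m := 1) (k := 2) one_pos one_lt_two two_pos (by norm_num)
      (by simp only [offset]; omega) (by simp only [offset]; omega)
  exact isSeparated_singleton (inWedge_pi_div_two a h_safe hr) (pushed_le_add_sub h_safe wedge r)
    (List.Perm.refl _) (List.forall_mem_singleton.2 h_ab) (by simp)

theorem isSeparated_three_spokes_of_one_free (h : IsSpread d [a, b, c] g₁ g₂ G) (h_safe : 0 ≤ safe)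
    (hr' : 0 ≤ r') (hr : 0 ≤ r) :
    IsSeparated d 1 [a, b, c] (pushed safe wedge) [r', r]
      (terminalLayout d 1 [a, b, c] safe wedge [r', r]) := by
  have h_d : g₁ + g₂ + 1 * G = d := h.offset_length
  obtain ⟨-, -, h₁, h₂, h₃, h₄, -, -, -⟩ := id h
  have hφ : π / 3 ≤ π := by linarith [pi_pos]
  have h_ac : spokeCos d a c ≤ cos (π / 3 / 2 + π / 2) :=
    h.spokeCos_getElem_le 0 2 (m := 2) (k := 3) two_pos (by simp) three_pos (by push_cast; ring)
      (by simp only [offset]; omega) (by simp only [offset]; omega)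
  have h_gap : gap d a b = g₁ := h.gap_getElem 0 1 one_pos (by simp)
  have h_gap' : gap d b c = g₁ + g₂ + 0 * G - g₁ := h.gap_getElem 1 2 one_lt_two (by simp)
  simp only [terminalLayout, h_gap, h_gap']
  split_ifs with h_le
  · have h_ab : spokeCos d a b ≤ cos (π / 3 / 2) :=
      h.spokeCos_getElem_le 0 1 (m := 1) (k := 6) one_pos (by simp) (by simp) (by push_cast; ring)
        (by simp only [offset]; omega) (by simp only [offset]; omega)
    have h_bc : spokeCos d b c ≤ cos (π / 2) :=
      h.spokeCos_getElem_le 1 2 (m := 1) (k := 2) one_lt_two (by simp) two_pos (by norm_num)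
        (by simp only [offset]; omega) (by simp only [offset]; omega)
    rw [spokeCos_comm] at h_bc
    exact isSeparated_pair (inWedge_max_alpha a (by positivity) hφ h_safe hr')
      (inWedge_pi_div_two c h_safe hr) (pushed_le_max_sub h_safe wedge _ r')
      (pushed_le_add_sub h_safe wedge r) ((List.Perm.swap _ _ _).cons _) h_ac
      (List.forall_mem_singleton.2 h_ab) (List.forall_mem_singleton.2 h_bc) (by simp)
  · have h_ab : spokeCos d a b ≤ cos (π / 2) :=
      h.spokeCos_getElem_le 0 1 (m := 1) (k := 2) one_pos (by simp) two_pos (by norm_num)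
        (by simp only [offset]; omega) (by simp only [offset]; omega)
    have h_bc : spokeCos d b c ≤ cos (π / 3 / 2) :=
      h.spokeCos_getElem_le 1 2 (m := 1) (k := 6) one_lt_two (by simp) (by simp)
        (by push_cast; ring) (by simp only [offset]; omega) (by simp only [offset]; omega)
    rw [spokeCos_comm] at h_bc h_ac
    exact isSeparated_pair (inWedge_max_alpha c (by positivity) hφ h_safe hr')
      (inWedge_pi_div_two a h_safe hr) (pushed_le_max_sub h_safe wedge _ r')
      (pushed_le_add_sub h_safe wedge r)
      ((List.Perm.swap _ _ _).trans ((List.Perm.swap _ _ _).cons _)) h_ac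
      (List.forall_mem_singleton.2 h_bc) (List.forall_mem_singleton.2 h_ab) (by simp)

theorem isSeparated_three_spokes_of_two_free (h : IsSpread d [a, b, c] g₁ g₂ G)
    (h_pushed : 0 ≤ pushed safe wedge) (hr : 0 ≤ r) :
    IsSeparated d 2 [a, b, c] (pushed safe wedge) [r]
      (terminalLayout d 2 [a, b, c] safe wedge [r]) := by
  have h_d : g₁ + g₂ + 1 * G = d := h.offset_length
  obtain ⟨-, -, h₁, h₂, h₃, h₄, -, -, -⟩ := id h
  have h_ac : spokeCos d a c ≤ cos (2 * π / 3) :=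
    h.spokeCos_getElem_le 0 2 (m := 2) (k := 3) two_pos (by simp) three_pos (by norm_num)
      (by simp only [offset]; omega) (by simp only [offset]; omega)
  have h_ab : spokeCos d a b ≤ cos (4 * π / 5 / 2) :=
    h.spokeCos_getElem_le 0 1 (m := 2) (k := 5) one_pos (by simp) (by simp) (by push_cast; ring)
      (by simp only [offset]; omega) (by simp only [offset]; omega)
  have h_bc : spokeCos d b c ≤ cos (4 * π / 5 / 2) :=
    h.spokeCos_getElem_le 1 2 (m := 2) (k := 5) one_lt_two (by simp) (by simp)
      (by push_cast; ring) (by simp only [offset]; omega) (by simp only [offset]; omega)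
  rw [spokeCos_comm] at h_ab
  rw [cos_two_pi_div_three] at h_ac
  have h_wedge := inWedge_max_alpha (φ := 4 * π / 5) b (by positivity) (by linarith [pi_pos])
    h_pushed hr
  refine isSeparated_singleton (F := [a, c]) h_wedge ?_ (List.Perm.swap _ _ _) ?_ ?_
  · linarith [le_max_right (alpha (4 * π / 5) * r - r) (pushed safe wedge + r)]
  · exact List.forall_mem_cons.2 ⟨h_ab, List.forall_mem_singleton.2 h_bc⟩
  · rintro _ _ ⟨⟩
    exact h_ac

theorem isSeparated_four_spokes (h : IsSpread d [a, b, c, e] g₁ g₂ G) (h_safe : 0 ≤ safe)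
    (hr' : 0 ≤ r') (hr : 0 ≤ r) :
    IsSeparated d 2 [a, b, c, e] (pushed safe wedge) [r', r]
      (terminalLayout d 2 [a, b, c, e] safe wedge [r', r]) := by
  have h_d : g₁ + g₂ + 2 * G = d := h.offset_length
  obtain ⟨-, -, h₁, h₂, h₃, h₄, -, -, -⟩ := id h
  have h_ac : spokeCos d a c ≤ cos (2 * π / 3) :=
    h.spokeCos_getElem_le 0 2 (m := 2) (k := 3) two_pos (by simp) three_pos (by norm_num)
      (by simp only [offset]; omega) (by simp only [offset]; omega)
  have h_ab : spokeCos d a b ≤ cos (4 * π / 7 / 2) :=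
    h.spokeCos_getElem_le 0 1 (m := 2) (k := 7) one_pos (by simp) (by simp) (by push_cast; ring)
      (by simp only [offset]; omega) (by simp only [offset]; omega)
  have h_bc : spokeCos d b c ≤ cos (4 * π / 7 / 2) :=
    h.spokeCos_getElem_le 1 2 (m := 2) (k := 7) one_lt_two (by simp) (by simp)
      (by push_cast; ring) (by simp only [offset]; omega) (by simp only [offset]; omega)
  have h_ae : spokeCos d a e ≤ cos (π / 2) :=
    h.spokeCos_getElem_le 0 3 (m := 1) (k := 2) three_pos (by simp) two_pos (by norm_num)
      (by simp only [offset]; omega) (by simp only [offset]; omega)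
  have h_ce : spokeCos d c e ≤ cos (π / 2) :=
    h.spokeCos_getElem_le 2 3 (m := 1) (k := 2) (by simp) (by simp) two_pos (by norm_num)
      (by simp only [offset]; omega) (by simp only [offset]; omega)
  have h_be : spokeCos d b e ≤ cos (4 * π / 7 / 2 + π / 2) :=
    h.spokeCos_getElem_le 1 3 (m := 11) (k := 14) (by simp) (by simp) (by simp)
      (by push_cast; ring) (by simp only [offset]; omega) (by simp only [offset]; omega)
  rw [spokeCos_comm] at h_ab h_ae h_ce
  rw [cos_two_pi_div_three] at h_ac
  have h_wedge := inWedge_max_alpha (φ := 4 * π / 7) b (by positivity) (by linarith [pi_pos])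
    h_safe hr'
  refine isSeparated_pair (F := [a, c]) h_wedge (inWedge_pi_div_two e h_safe hr)
    (pushed_le_max_sub h_safe wedge _ r') (pushed_le_add_sub h_safe wedge r) ?_ h_be ?_ ?_ ?_
  · exact (((List.Perm.swap _ _ _).trans ((List.Perm.swap _ _ _).cons _)).cons _).trans
      (List.Perm.swap _ _ _)
  · exact List.forall_mem_cons.2 ⟨h_ab, List.forall_mem_singleton.2 h_bc⟩
  · exact List.forall_mem_cons.2 ⟨h_ae, List.forall_mem_singleton.2 h_ce⟩
  · rintro _ _ ⟨⟩
    exact h_ac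

theorem isSeparated_terminalLayout {f : ℕ} {rs : List ℝ} (h : IsSpread d S g₁ g₂ G)
    (hf : f = 1 ∨ f = 2) (hfS : f < S.length) (hS : S.length ≤ f + 2)
    (h_rs : rs.length + f = S.length) (hr : ∀ r ∈ rs, 0 ≤ r) (h_safe : 0 ≤ safe)
    (h_pushed : 0 ≤ pushed safe wedge) :
    IsSeparated d f S (pushed safe wedge) rs (terminalLayout d f S safe wedge rs) := by
  match f, S, rs with
  | 1, [a, b], [r] => exact isSeparated_two_spokes h h_safe (hr r (by simp))
  | 1, [a, b, c], [r', r] =>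
    exact isSeparated_three_spokes_of_one_free h h_safe (hr r' (by simp)) (hr r (by simp))
  | 2, [a, b, c], [r] => exact isSeparated_three_spokes_of_two_free h h_pushed (hr r (by simp))
  | 2, [a, b, c, e], [r', r] =>
    exact isSeparated_four_spokes h h_safe (hr r' (by simp)) (hr r (by simp))

end Terminal

section GreedyLayout

variable {d f : ℕ} {rs : List ℝ}

theorem isSeparated_greedyRounds {S : List ℕ} {safe : ℝ} {wedge : Option ℕ} {g₁ g₂ G : ℕ}
    (h : IsSpread d S g₁ g₂ G) (hf : f = 1 ∨ f = 2) (hfS : f < S.length)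
    (h_rs : rs.length + f = S.length) (hr : ∀ r ∈ rs, 0 ≤ r) (h_safe : 0 ≤ safe)
    (h_pushed : 0 ≤ pushed safe wedge) :
    IsSeparated d f S (pushed safe wedge) rs (greedyRounds d f S safe wedge rs) := by
  induction h_len : S.length using Nat.strong_induction_on generalizing S safe wedge rs g₁ g₂ G with
  | _ l ih =>
    by_cases hS : f + 2 < S.length
    · have hS₃ : 3 ≤ S.length := by omega
      obtain ⟨g, h_kept⟩ := h.exists_isSpread_keptSpokes hS₃
      have h_length := length_keptSpokes S
      refine isSeparated_round h (by omega) hS h_safe h_rs hr <|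
        ih (keptSpokes S).length (by omega) h_kept (by omega) ?_
          (fun r hr' => hr r (List.mem_of_mem_drop hr'))
          (h_safe.trans (safe_le_roundSafe d S safe rs))
          (h_safe.trans (h.safe_le_pushed_roundSafe hS₃ h_safe hr)) rfl
      rw [List.length_drop, length_usedSpokes]
      omega
    · rw [greedyRounds_of_not_lt hS]
      exact isSeparated_terminalLayout h hf hfS (not_lt.1 hS) h_rs hr h_safe h_pushed

theorem isSeparated_greedyLayout (hd : rs.length + f = d) (hf : f = 1 ∨ f = 2)
    (hr : ∀ r ∈ rs, 0 ≤ r) : IsSeparated d f (List.range d) 0 rs (greedyLayout d f rs) := by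
  rw [greedyLayout]
  rcases eq_or_ne rs [] with rfl | h_ne
  · obtain rfl : f = d := by rwa [List.length_nil, zero_add] at hd
    rw [greedyRounds_of_not_lt (by rw [List.length_range]; omega)]
    have h_angle : spokeCos 2 0 1 ≤ -(1 / 2) := by
      rw [spokeCos, show 2 * π * (((0 : ℕ) : ℝ) - (1 : ℕ)) / (2 : ℕ) = -π by push_cast; ring,
        cos_neg, cos_pi]
      norm_num
    rcases hf with rfl | rfl
    · exact ⟨rfl, List.Perm.refl _, rfl, by simp [Layout.balloons], List.Pairwise.nil,
        by simp [Layout.balloons], by rintro _ _ ⟨⟩⟩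
    · exact ⟨rfl, List.Perm.refl _, rfl, by simp [Layout.balloons], List.Pairwise.nil,
        by simp [Layout.balloons], by rintro _ _ ⟨⟩; exact h_angle⟩
  · have h_pos := List.length_pos_of_ne_nil h_ne
    refine isSeparated_greedyRounds (safe := 0) (wedge := none) (isSpread_range (by omega)) hf
      ?_ ?_ hr le_rfl le_rfl <;> rw [List.length_range] <;> omega

end GreedyLayout

section SizeNumerics

variable {a b r ρ μ k : ℝ} {l : List ℝ}

theorem add_length_sub_one_mul_le_sum (hb : b ∈ l) (h : ∀ c ∈ l, a ≤ c) :
    b + ((l.length : ℝ) - 1) * a ≤ l.sum := by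
  have h_rest := List.card_nsmul_le_sum (l.erase b) a fun c hc => h c (List.mem_of_mem_erase hc)
  rw [nsmul_eq_mul] at h_rest
  rw [← List.sum_erase hb, ← List.length_erase_add_one hb]
  push_cast
  linarith

theorem one_div_sin_le (hk : 4 ≤ k) (hμ : 2 * π / k ≤ μ) (hμ' : μ ≤ π / 2) :
    1 / sin μ ≤ k / 4 := by
  have : 0 < k := by linarith
  have h_mul : 4 / k ≤ sin μ := calc
    4 / k = 2 / π * (2 * π / k) := by field_simp; norm_num
    _ ≤ 2 / π * μ := by gcongr
    _ ≤ sin μ := mul_le_sin ((by positivity : 0 ≤ 2 * π / k).trans hμ) hμ'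
  simpa only [one_div_div] using one_div_le_one_div_of_le (by positivity) h_mul

theorem one_add_one_div_sin_le_kappa (hμ : 2 * π / 5 ≤ μ) (hμ' : μ ≤ π / 2) :
    1 + 1 / sin μ ≤ kappa := by
  have h_pos : 0 < sin (2 * π / 5) :=
    sin_pos_of_pos_of_lt_pi (by positivity) (by linarith [pi_pos])
  have h_inv : 1 / sin (2 * π / 5) = kappa - 1 := by
    rw [div_eq_iff h_pos.ne', mul_comm, sin_two_pi_div_five_mul_kappa_sub_one]
  have h_mono : sin (2 * π / 5) ≤ sin μ :=
    sin_le_sin_of_le_of_le_pi_div_two (by linarith [pi_pos]) hμ' hμ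
  linarith [one_div_le_one_div_of_le h_pos h_mono]

theorem alpha_mul_sub_le_two_mul {φ : ℝ} (hφ : π / 3 ≤ φ) (hφ' : φ ≤ π) (hr : 0 ≤ r) :
    alpha φ * r - r ≤ 2 * r := by
  have h_sin : 1 / 2 ≤ sin (φ / 2) := by
    rw [← sin_pi_div_six]
    exact sin_le_sin_of_le_of_le_pi_div_two (by linarith [pi_pos]) (by linarith) (by linarith)
  rw [alpha_mul_sub (by linarith), div_le_iff₀ (by linarith)]
  nlinarith

theorem one_add_one_div_sin_le_of_pi_div_three_le (hμ : π / 3 ≤ μ) (hμ' : μ ≤ π / 2) :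
    1 + 1 / sin μ ≤ 2.1548 := by
  have h_sin : 1.732 / 2 ≤ sin μ := calc
    1.732 / 2 ≤ √3 / 2 := by
      gcongr
      exact le_sqrt_of_sq_le (by norm_num)
    _ = sin (π / 3) := sin_pi_div_three.symm
    _ ≤ sin μ := sin_le_sin_of_le_of_le_pi_div_two (by linarith [pi_pos]) hμ' hμ
  have h_inv := one_div_le_one_div_of_le (by norm_num) h_sin
  norm_num at h_inv ⊢
  linarith

theorem sin_add_cos_two_pi_div_eleven_le :
    2.1548 * (sin (2 * π / 11) + cos (2 * π / 11)) ≤ 2 * (sin (2 * π / 11) + 1) := by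
  have h_pi := pi_pos
  have h_cos : cos (2 * π / 11) ≤ 1.7321 / 2 := calc
    cos (2 * π / 11) ≤ cos (π / 6) :=
      cos_le_cos_of_nonneg_of_le_pi (by linarith) (by linarith) (by linarith)
    _ = √3 / 2 := cos_pi_div_six
    _ ≤ 1.7321 / 2 := by
      gcongr
      exact sqrt_le_iff.2 (by norm_num)
  have h_sin : sin (2 * π / 11) ≤ 1.5 / 2 := calc
    sin (2 * π / 11) ≤ sin (π / 4) :=
      sin_le_sin_of_le_of_le_pi_div_two (by linarith) (by linarith) (by linarith)
    _ = √2 / 2 := sin_pi_div_four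
    _ ≤ 1.5 / 2 := by
      gcongr
      exact sqrt_le_iff.2 (by norm_num)
  linarith

theorem pushed_some_six_le (hρ : 0 ≤ ρ) (hμ : π / 3 ≤ μ) (hμ' : μ ≤ π / 2) :
    pushed ((1 + 1 / sin μ) * ρ) (some 6) ≤ 2 * ρ := by
  have h_sin : 0 ≤ sin (2 * π / 11) :=
    sin_nonneg_of_nonneg_of_le_pi (by positivity) (by linarith [pi_pos])
  have h_cos : 0 ≤ cos (2 * π / 11) :=
    cos_nonneg_of_neg_pi_div_two_le_of_le (by linarith [pi_pos]) (by linarith [pi_pos])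
  simp only [pushed]
  rw [show 2 * π / (2 * ((6 : ℕ) : ℝ) - 1) = 2 * π / 11 by norm_num, div_le_iff₀ (by linarith)]
  calc (1 + 1 / sin μ) * ρ * (sin (2 * π / 11) + cos (2 * π / 11))
      ≤ 2.1548 * ρ * (sin (2 * π / 11) + cos (2 * π / 11)) := by
        gcongr
        exact one_add_one_div_sin_le_of_pi_div_three_le hμ hμ'
    _ = 2.1548 * (sin (2 * π / 11) + cos (2 * π / 11)) * ρ := by ring
    _ ≤ 2 * (sin (2 * π / 11) + 1) * ρ :=
      mul_le_mul_of_nonneg_right sin_add_cos_two_pi_div_eleven_le hρ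
    _ = 2 * ρ * (sin (2 * π / 11) + 1) := by ring

end SizeNumerics

section CoverRadius

variable {d f : ℕ} {S : List ℕ} {a safe R : ℝ} {wedge : Option ℕ} {rs : List ℝ}

theorem Layout.coverRadius_eq (lay : Layout) (rs : List ℝ) :
    lay.coverRadius rs = ((lay.balloons rs).map fun q => q.dist + q.radius).foldr max 0 := by
  rw [Layout.coverRadius, Layout.balloons, List.map_zipWith]

theorem Layout.coverRadius_le_iff {lay : Layout} :
    lay.coverRadius rs ≤ R ↔ 0 ≤ R ∧ ∀ q ∈ lay.balloons rs, q.dist + q.radius ≤ R := by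
  rw [Layout.coverRadius_eq, foldr_max_le_iff, List.forall_mem_map]

theorem Layout.le_coverRadius {lay : Layout} {q : Balloon} (hq : q ∈ lay.balloons rs) :
    q.dist + q.radius ≤ lay.coverRadius rs :=
  (Layout.coverRadius_le_iff.1 le_rfl).2 q hq

theorem Layout.coverRadius_nonneg (lay : Layout) (rs : List ℝ) : 0 ≤ lay.coverRadius rs :=
  (Layout.coverRadius_le_iff.1 le_rfl).1

theorem coverRadius_greedyRounds_le (hS : f + 2 < S.length)
    (h_used : (usedSpokes S).length ≤ rs.length) (h_now : roundSafe d S safe rs ≤ R)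
    (h_rest : (roundRest d f S safe rs).coverRadius (rs.drop (usedSpokes S).length) ≤ R) :
    (greedyRounds d f S safe wedge rs).coverRadius rs ≤ R := by
  refine Layout.coverRadius_le_iff.2 ⟨(Layout.coverRadius_nonneg _ _).trans h_rest, ?_⟩
  rw [balloons_greedyRounds hS h_used]
  exact List.forall_mem_append.2
    ⟨fun q hq => (dist_add_radius_le_roundSafe hq).trans h_now,
      fun q hq => (Layout.le_coverRadius hq).trans h_rest⟩

/-- A bound for the radius that covers the layout of balloons with radii `rs ≥ a` around a safe disk
of radius `safe`. It grows with `safe` only up to a term that accounts for the small balloons which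
share a round with larger ones, and is `kappa` times the sum of the radii if `safe = 0`. -/
noncomputable def sizeBound (a safe : ℝ) (rs : List ℝ) : ℝ :=
  max (safe + kappa * (rs.sum - ((rs.length : ℝ) - 1) / 2 * a)) (kappa * rs.sum)

theorem safe_add_two_mul_le_sizeBound {r : ℝ} (ha : 0 ≤ a) (har : ∀ r ∈ rs, a ≤ r) (hr : r ∈ rs) :
    safe + 2 * r ≤ sizeBound a safe rs := by
  have h_sum := add_length_sub_one_mul_le_sum hr har
  have h_length : (1 : ℝ) ≤ rs.length := by exact_mod_cast List.length_pos_of_mem hr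
  refine le_max_of_le_left ?_
  have h_le : r ≤ rs.sum - ((rs.length : ℝ) - 1) / 2 * a := by
    nlinarith [mul_nonneg (sub_nonneg.2 h_length) ha]
  nlinarith [two_lt_kappa, ha.trans (har r hr)]

theorem sizeBound_nonneg (h : ∀ r ∈ rs, 0 ≤ r) : 0 ≤ sizeBound a safe rs :=
  le_max_of_le_right (mul_nonneg kappa_pos.le (List.sum_nonneg h))

theorem add_le_sizeBound_pair {r r' x : ℝ} (ha : 0 ≤ a) (har' : a ≤ r') (hr : r' ≤ r)
    (hx : x ≤ 2 * r') : max x (safe + r') + r' ≤ sizeBound a safe [r', r] := by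
  rw [← max_add_add_right]
  refine max_le (le_max_of_le_right ?_) ?_
  · rw [List.sum_pair]
    nlinarith [two_lt_kappa]
  · refine le_trans (le_of_eq (by ring)) (safe_add_two_mul_le_sizeBound (r := r') ha ?_ (by simp))
    exact List.forall_mem_cons.2 ⟨har', List.forall_mem_singleton.2 (har'.trans hr)⟩

theorem coverRadius_terminalLayout_le (ha : 0 ≤ a) (har : ∀ r ∈ rs, a ≤ r)
    (h_sorted : rs.Pairwise (· ≤ ·)) (h_safe : 0 ≤ safe) :
    (terminalLayout d f S safe wedge rs).coverRadius rs ≤ sizeBound a safe rs := by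
  have h_pi := pi_pos
  refine Layout.coverRadius_le_iff.2 ⟨sizeBound_nonneg fun r hr => ha.trans (har r hr), ?_⟩
  have h_touch : ∀ r ∈ rs, safe + r + r ≤ sizeBound a safe rs := fun r hr =>
    le_trans (le_of_eq (by ring)) (safe_add_two_mul_le_sizeBound ha har hr)
  unfold terminalLayout
  split
  · simpa [Layout.balloons] using h_touch
  · have h_wedge := add_le_sizeBound_pair (safe := safe) ha (har _ List.mem_cons_self)
      (List.pairwise_pair.1 h_sorted) (alpha_mul_sub_le_two_mul le_rfl (by linarith)
        (ha.trans (har _ List.mem_cons_self)))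
    split_ifs <;> simpa [Layout.balloons, h_wedge] using h_touch _ (by simp)
  · rename_i r
    have h_pushed := pushed_le h_safe wedge
    simp only [Layout.balloons, List.zipWith_cons_cons, List.zipWith_nil_right,
      List.forall_mem_singleton, alpha_four_pi_div_five]
    rw [← max_add_add_right]
    refine max_le (le_max_of_le_right ?_) (le_trans ?_ (h_touch r (by simp)))
    · simp
    · linarith
  · have h_wedge := add_le_sizeBound_pair (safe := safe) (x := alpha (4 * π / 7) * _ - _) ha
      (har _ List.mem_cons_self) (List.pairwise_pair.1 h_sorted) (alpha_mul_sub_le_two_mul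
        (by linarith) (by linarith) (ha.trans (har _ List.mem_cons_self)))
    simpa [Layout.balloons, h_wedge] using h_touch _ (by simp)
  · simp [Layout.balloons]

end CoverRadius

section SizeRound

variable {d f : ℕ} {S : List ℕ} {a safe safe' w ρ : ℝ} {wedge : Option ℕ} {t rs : List ℝ}
  {g₁ g₂ G : ℕ} {q : Balloon}

theorem sizeBound_le_sizeBound_append (hρ : ρ ∈ t) (ha : 0 ≤ a) (hat : ∀ c ∈ t, a ≤ c)
    (ht : 2 ≤ t.length) (h_safe' : safe' ≤ safe + 2 * ρ) :
    sizeBound a safe' rs ≤ sizeBound a safe (t ++ rs) := by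
  have h_nonneg : 0 ≤ t.sum := List.sum_nonneg fun c hc => ha.trans (hat c hc)
  have h_le_sum := add_length_sub_one_mul_le_sum hρ hat
  have ht' : (2 : ℝ) ≤ t.length := by exact_mod_cast ht
  rw [sizeBound, sizeBound, List.sum_append, List.length_append]
  push_cast
  refine max_le_max ?_ (by nlinarith [kappa_pos])
  have h_le : ρ + (rs.sum - ((rs.length : ℝ) - 1) / 2 * a) ≤
      t.sum + rs.sum - ((t.length : ℝ) + rs.length - 1) / 2 * a := by
    nlinarith [mul_nonneg (sub_nonneg.2 ht') ha]
  nlinarith [two_lt_kappa, ha.trans (hat ρ hρ)]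

theorem sizeBound_le_kappa_mul_sum_append (ht : ∀ c ∈ t, 0 ≤ c)
    (h_le : (1 + w) * ρ ≤ kappa * (t.sum + ((rs.length : ℝ) - 1) / 2 * ρ)) :
    sizeBound ρ ((1 + w) * ρ) rs ≤ kappa * (t ++ rs).sum := by
  rw [List.sum_append, sizeBound]
  have h_nonneg := mul_nonneg kappa_pos.le (List.sum_nonneg ht)
  exact max_le (by linarith) (by linarith)

theorem exists_getElem_of_mem_roundBalloons (hq : q ∈ roundBalloons d S safe rs) :
    ∃ (i : ℕ) (hi : i < (usedSpokes S).length) (hi' : i < rs.length),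
      q.spoke = (usedSpokes S)[i] ∧ q.radius = rs[i] := by
  obtain ⟨i, hi, rfl⟩ := List.getElem_of_mem hq
  rw [roundBalloons, List.length_zipWith, lt_min_iff] at hi
  exact ⟨i, hi.1, hi.2, by simp only [roundBalloons, List.getElem_zipWith],
    by simp only [roundBalloons, List.getElem_zipWith]⟩

theorem radius_mem_take_of_mem_roundBalloons (hq : q ∈ roundBalloons d S safe rs) :
    q.radius ∈ rs.take (usedSpokes S).length := by
  obtain ⟨i, hi, hi', -, h_radius⟩ := exists_getElem_of_mem_roundBalloons hq
  exact h_radius ▸ List.mem_take_iff_getElem.2 ⟨i, lt_min hi hi', rfl⟩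

theorem radius_le_and_radius_add_le_sum {r : ℝ} (hr : ∀ r ∈ rs, 0 ≤ r)
    (h_sorted : rs.Pairwise (· ≤ ·)) (hq : q ∈ roundBalloons d S safe rs)
    (h_drop : rs.drop (usedSpokes S).length = [r]) : q.radius ≤ r ∧ q.radius + r ≤ rs.sum := by
  have hq_take := radius_mem_take_of_mem_roundBalloons hq
  have h_split := List.take_append_drop (usedSpokes S).length rs
  rw [h_drop] at h_split
  constructor
  · rw [← h_split, List.pairwise_append] at h_sorted
    exact h_sorted.2.2 _ hq_take r List.mem_cons_self
  · rw [← h_split, List.sum_append, List.sum_singleton]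
    gcongr
    exact List.single_le_sum (fun r hr' => hr r (List.mem_of_mem_take hr')) _ hq_take

theorem IsSpread.forall_radius_le_or_le_wedgeAngle (h : IsSpread d S g₁ g₂ G) (hS : 4 ≤ S.length)
    (h_sorted : rs.Pairwise (· ≤ ·)) (hq : q ∈ roundBalloons d S safe rs) :
    (∀ r ∈ rs, q.radius ≤ r) ∨ 2 * π / S.length ≤ wedgeAngle d S q.spoke := by
  obtain ⟨i, hi, hi', h_spoke, h_radius⟩ := exists_getElem_of_mem_roundBalloons hq
  rcases eq_or_ne i 0 with rfl | hi₀
  · left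
    obtain ⟨r, rs, rfl⟩ := List.exists_cons_of_length_pos hi'
    exact h_radius ▸ List.forall_mem_cons.2 ⟨le_rfl, (List.pairwise_cons.1 h_sorted).1⟩
  · exact .inr (h_spoke ▸ le_wedgeAngle h.spokeCount_pos hS
      (h.le_mul_minGap_getElem_usedSpokes hi₀ hi))

theorem roundSafe_le_or_exists (h_used : usedSpokes S ≠ []) (h_rs : rs ≠ [])
    (hr : ∀ r ∈ rs, 0 ≤ r) :
    (∃ q ∈ roundBalloons d S safe rs, roundSafe d S safe rs ≤ safe + 2 * q.radius) ∨
      ∃ q ∈ roundBalloons d S safe rs, safe + q.radius < q.dist ∧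
        roundSafe d S safe rs = q.dist + q.radius := by
  rcases foldr_max_eq_or_mem (l := (roundBalloons d S safe rs).map fun q => q.dist + q.radius)
    (b := safe) with h_eq | h_mem
  · have h_ne : roundBalloons d S safe rs ≠ [] := by
      simp [roundBalloons, h_used, h_rs]
    obtain ⟨q, hq⟩ := List.exists_mem_of_ne_nil _ h_ne
    refine .inl ⟨q, hq, ?_⟩
    rw [roundSafe, h_eq]
    linarith [hr _ (of_mem_roundBalloons hq).2.1]
  · obtain ⟨q, hq, h_eq⟩ := List.mem_map.1 h_mem
    rcases lt_or_ge (safe + q.radius) q.dist with h_lt | h_ge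
    · exact .inr ⟨q, hq, h_lt, h_eq.symm⟩
    · refine .inl ⟨q, hq, ?_⟩
      rw [roundSafe, ← h_eq]
      linarith

theorem coverRadius_greedyRounds_le_of_sizeBound_le {a' R : ℝ} (hS : f + 2 < S.length)
    (h_used : (usedSpokes S).length < rs.length) (ha' : 0 ≤ a')
    (har' : ∀ r ∈ rs.drop (usedSpokes S).length, a' ≤ r)
    (h_rest : (roundRest d f S safe rs).coverRadius (rs.drop (usedSpokes S).length) ≤
      sizeBound a' (roundSafe d S safe rs) (rs.drop (usedSpokes S).length))
    (h_le : sizeBound a' (roundSafe d S safe rs) (rs.drop (usedSpokes S).length) ≤ R) :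
    (greedyRounds d f S safe wedge rs).coverRadius rs ≤ R := by
  obtain ⟨r, hr⟩ := List.exists_mem_of_ne_nil _ (mt List.drop_eq_nil_iff.1 h_used.not_ge)
  have h_safe := safe_add_two_mul_le_sizeBound (safe := roundSafe d S safe rs) ha' har' hr
  exact coverRadius_greedyRounds_le hS h_used.le
    (le_trans (by linarith [ha'.trans (har' r hr)]) h_le) (h_rest.trans h_le)

theorem mul_le_kappa_mul_add {c x y T : ℝ} (hρ : 0 ≤ ρ) (hT : c * ρ ≤ T) (hc : 0 ≤ c + x)
    (hy : y ≤ 2 * (c + x)) : y * ρ ≤ kappa * (T + x * ρ) := calc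
  y * ρ ≤ 2 * (c + x) * ρ := by gcongr
  _ ≤ kappa * (c + x) * ρ := by gcongr; exact two_lt_kappa.le
  _ = kappa * (c * ρ + x * ρ) := by ring
  _ ≤ kappa * (T + x * ρ) := by gcongr; exact kappa_pos.le

namespace IsSpread

variable (h : IsSpread d S g₁ g₂ G) (hf : f = 1 ∨ f = 2) (hS : f + 2 < S.length)
  (h_rs : rs.length + f = S.length) (hr : ∀ r ∈ rs, 0 ≤ r) (h_sorted : rs.Pairwise (· ≤ ·))
  (hq : q ∈ roundBalloons d S safe rs)
include h

theorem roundSafe_eq_mul (hS : 3 ≤ S.length) (hq : q ∈ roundBalloons d S safe rs)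
    (h_lt : safe + q.radius < q.dist) (h_eq : roundSafe d S safe rs = q.dist + q.radius) :
    roundSafe d S safe rs = (1 + 1 / sin (wedgeAngle d S q.spoke)) * q.radius := by
  have h_angle := h.wedgeAngle_pos_of_mem_usedSpokes hS (of_mem_roundBalloons hq).1
  have h_sin := (sin_wedgeAngle_pos h_angle).ne'
  rw [h_eq, ← dist_mul_sin_wedgeAngle hq h_lt h_angle]
  field_simp
  ring

include hf hS h_rs hr hq

theorem one_add_one_div_sin_mul_radius_le_of_forall_le (h_min : ∀ r ∈ rs, q.radius ≤ r) :
    (1 + 1 / sin (wedgeAngle d S q.spoke)) * q.radius ≤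
      kappa * ((rs.take (usedSpokes S).length).sum +
        (((rs.drop (usedSpokes S).length).length : ℝ) - 1) / 2 * q.radius) := by
  obtain ⟨h_spoke, h_mem, -⟩ := of_mem_roundBalloons hq
  have h_used := length_usedSpokes S
  have h_sum := List.card_nsmul_le_sum (rs.take (usedSpokes S).length) q.radius
    fun r hr' => h_min r (List.mem_of_mem_take hr')
  rw [nsmul_eq_mul, List.length_take, min_eq_left (by omega)] at h_sum
  rw [List.length_drop, Nat.cast_sub (by omega)]
  have h_S : (rs.length : ℝ) + f = S.length := by norm_cast
  have hf₂ : (f : ℝ) ≤ 2 := by norm_cast; omega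
  have h_used₂ : (2 : ℝ) ≤ (usedSpokes S).length := by norm_cast; omega
  have h_half : 2 * ((usedSpokes S).length : ℝ) ≤ S.length := by norm_cast; omega
  have : (S.length : ℝ) ≤ 2 * (usedSpokes S).length + 1 := by norm_cast; omega
  have h_sin := one_div_sin_le (k := 2 * S.length - 1) (by linarith)
    (h.le_wedgeAngle_of_mem_usedSpokes (by omega) h_spoke) (wedgeAngle_le_pi_div_two d S q.spoke)
  exact mul_le_kappa_mul_add (hr _ h_mem) h_sum (by linarith) (by linarith)

include h_sorted

theorem one_add_one_div_sin_mul_radius_le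
    (h_six : f = 2 → S.length = 6 → ∀ r ∈ rs, q.radius ≤ r) :
    (1 + 1 / sin (wedgeAngle d S q.spoke)) * q.radius ≤
      kappa * ((rs.take (usedSpokes S).length).sum +
        (((rs.drop (usedSpokes S).length).length : ℝ) - 1) / 2 * q.radius) := by
  by_cases h_min : ∀ r ∈ rs, q.radius ≤ r
  · exact h.one_add_one_div_sin_mul_radius_le_of_forall_le hf hS h_rs hr hq h_min
  have hq₀ := hr _ (of_mem_roundBalloons hq).2.1
  have h_wedge := (h.forall_radius_le_or_le_wedgeAngle (by omega) h_sorted hq).resolve_left h_min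
  have h_le := wedgeAngle_le_pi_div_two d S q.spoke
  have h_sin := one_div_sin_le (by norm_cast; omega) h_wedge h_le
  have h_sum : 1 * q.radius ≤ (rs.take (usedSpokes S).length).sum := by
    rw [one_mul]
    exact List.single_le_sum (fun r hr' => hr r (List.mem_of_mem_take hr')) _
      (radius_mem_take_of_mem_roundBalloons hq)
  have h_rest : (rs.drop (usedSpokes S).length).length + f = (S.length + 1) / 2 := by
    rw [List.length_drop, length_usedSpokes]
    omega
  set n := (rs.drop (usedSpokes S).length).length
  by_cases hf_rest : f ≤ n
  · have hn : (1 : ℝ) ≤ n := by norm_cast; omega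
    have h_half : (S.length : ℝ) ≤ 4 * n := by norm_cast; omega
    exact mul_le_kappa_mul_add hq₀ h_sum (by linarith) (by linarith)
  · have h_ne_six : S.length ≠ 6 := fun h_eq => h_min (h_six (by omega) h_eq)
    obtain ⟨h_five, h_one⟩ : S.length = 5 ∧ n = 1 := by omega
    rw [h_one, Nat.cast_one, sub_self, zero_div, zero_mul, add_zero]
    refine mul_le_mul (one_add_one_div_sin_le_kappa ?_ h_le) (by linarith) hq₀ kappa_pos.le
    simpa [h_five] using h_wedge

omit hf hS h_rs in
theorem coverRadius_greedyRounds_le_of_six (hS : S.length = 6) (h_rs : rs.length = 4)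
    (h_lt : safe + q.radius < q.dist) (h_eq : roundSafe d S safe rs = q.dist + q.radius)
    (h_min : ¬ ∀ r ∈ rs, q.radius ≤ r) :
    (greedyRounds d 2 S safe wedge rs).coverRadius rs ≤ kappa * rs.sum := by
  have hq₀ := hr _ (of_mem_roundBalloons hq).2.1
  have h_used : (usedSpokes S).length = 3 := by rw [length_usedSpokes, hS]
  have h_wedge := (h.forall_radius_le_or_le_wedgeAngle (by omega) h_sorted hq).resolve_left h_min
  have h_le := wedgeAngle_le_pi_div_two d S q.spoke
  have h_safe := h.roundSafe_eq_mul (by omega) hq h_lt h_eq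
  rw [hS, show 2 * π / ((6 : ℕ) : ℝ) = π / 3 by push_cast; ring] at h_wedge
  obtain ⟨a, b, c, h_kept⟩ := List.length_eq_three.1
    (show (keptSpokes S).length = 3 by rw [length_keptSpokes, hS])
  obtain ⟨r, h_drop⟩ := List.length_eq_one_iff.1
    (show (rs.drop (usedSpokes S).length).length = 1 by rw [List.length_drop]; omega)
  obtain ⟨hqr, h_sum⟩ := radius_le_and_radius_add_le_sum hr h_sorted hq h_drop
  have h_pushed := pushed_some_six_le hq₀ h_wedge h_le
  have h_round : roundWedge d S safe rs = some 6 := by rw [roundWedge, if_pos ⟨q, hq, h_lt⟩, hS]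
  refine (coverRadius_greedyRounds_le (R := kappa * (q.radius + r)) (by omega) (by omega) ?_
    ?_).trans (mul_le_mul_of_nonneg_left h_sum kappa_pos.le)
  · have h_sin := one_add_one_div_sin_le_of_pi_div_three_le h_wedge h_le
    rw [h_safe]
    nlinarith [two_lt_kappa]
  · rw [roundRest, h_drop, h_kept, greedyRounds_of_not_lt (by simp), h_round, h_safe]
    refine Layout.coverRadius_le_iff.2 ⟨mul_nonneg kappa_pos.le (by linarith), ?_⟩
    simp only [terminalLayout, Layout.balloons, List.zipWith_cons_cons, List.zipWith_nil_right,
      List.forall_mem_singleton, alpha_four_pi_div_five]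
    rw [← max_add_add_right]
    exact max_le (by nlinarith [kappa_pos]) (by nlinarith [two_lt_kappa])

omit hr hq in
theorem coverRadius_greedyRounds_le_sizeBound_of_rest (ha : 0 ≤ a) (har : ∀ r ∈ rs, a ≤ r)
    (h_rest : ∀ a', 0 ≤ a' → (∀ r ∈ rs.drop (usedSpokes S).length, a' ≤ r) →
      (roundRest d f S safe rs).coverRadius (rs.drop (usedSpokes S).length) ≤
        sizeBound a' (roundSafe d S safe rs) (rs.drop (usedSpokes S).length)) :
    (greedyRounds d f S safe wedge rs).coverRadius rs ≤ sizeBound a safe rs := by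
  have hr : ∀ r ∈ rs, 0 ≤ r := fun r hr => ha.trans (har r hr)
  have h_used := length_usedSpokes S
  have h_split := List.take_append_drop (usedSpokes S).length rs
  rcases roundSafe_le_or_exists (d := d) (S := S) (safe := safe)
    (List.ne_nil_of_length_pos (by omega)) (List.ne_nil_of_length_pos (by omega)) hr with
    ⟨q, hq, h_le⟩ | ⟨q, hq, h_lt, h_eq⟩
  · have h_drop : ∀ r ∈ rs.drop (usedSpokes S).length, a ≤ r :=
      fun r hr' => har r (List.mem_of_mem_drop hr')
    refine coverRadius_greedyRounds_le_of_sizeBound_le hS (by omega) ha h_drop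
      (h_rest a ha h_drop) ?_
    have h_append := sizeBound_le_sizeBound_append (rs := rs.drop (usedSpokes S).length)
      (radius_mem_take_of_mem_roundBalloons hq) ha (fun r hr' => har r (List.mem_of_mem_take hr'))
      (by rw [List.length_take]; omega) h_le
    rwa [h_split] at h_append
  · refine le_max_of_le_right ?_
    by_cases h_six : f = 2 → S.length = 6 → ∀ r ∈ rs, q.radius ≤ r
    · have hq₀ := hr _ (of_mem_roundBalloons hq).2.1
      have h_drop : ∀ r ∈ rs.drop (usedSpokes S).length, q.radius ≤ r := by
        rw [← h_split, List.pairwise_append] at h_sorted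
        exact h_sorted.2.2 _ (radius_mem_take_of_mem_roundBalloons hq)
      refine coverRadius_greedyRounds_le_of_sizeBound_le hS (by omega) hq₀ h_drop
        (h_rest _ hq₀ h_drop) ?_
      have h_append := sizeBound_le_kappa_mul_sum_append
        (fun r hr' => hr r (List.mem_of_mem_take hr'))
        (h.one_add_one_div_sin_mul_radius_le hf hS h_rs hr h_sorted hq h_six)
      rwa [h_split, ← h.roundSafe_eq_mul (by omega) hq h_lt h_eq] at h_append
    · push Not at h_six
      obtain ⟨rfl, hS₆, h_min⟩ := h_six
      exact h.coverRadius_greedyRounds_le_of_six hr h_sorted hq hS₆ (by omega) h_lt h_eq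
        fun h_all => h_min.elim fun r hr' => hr'.2.not_ge (h_all r hr'.1)

end IsSpread

end SizeRound

section SizeGreedyLayout

variable {d f : ℕ} {a safe : ℝ} {S : List ℕ} {wedge : Option ℕ} {rs : List ℝ} {g₁ g₂ G : ℕ}

theorem IsSpread.coverRadius_greedyRounds_le_sizeBound (h : IsSpread d S g₁ g₂ G)
    (hf : f = 1 ∨ f = 2) (h_rs : rs.length + f = S.length) (ha : 0 ≤ a) (har : ∀ r ∈ rs, a ≤ r)
    (h_sorted : rs.Pairwise (· ≤ ·)) (h_safe : 0 ≤ safe) :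
    (greedyRounds d f S safe wedge rs).coverRadius rs ≤ sizeBound a safe rs := by
  induction h_len : S.length using Nat.strong_induction_on
    generalizing S a safe wedge rs g₁ g₂ G with
  | _ l ih =>
    by_cases hS : f + 2 < S.length
    · obtain ⟨g, h_kept⟩ := h.exists_isSpread_keptSpokes (by omega)
      have h_length := length_keptSpokes S
      refine h.coverRadius_greedyRounds_le_sizeBound_of_rest hf hS h_rs h_sorted ha har
        fun a' ha' har' => ih (keptSpokes S).length (by omega) h_kept ?_ ha' har'
          (h_sorted.sublist (List.drop_sublist _ _))
          (h_safe.trans (safe_le_roundSafe d S safe rs)) rfl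
      rw [List.length_drop, length_usedSpokes]
      omega
    · rw [greedyRounds_of_not_lt hS]
      exact coverRadius_terminalLayout_le ha har h_sorted h_safe

theorem coverRadius_greedyLayout_le (hd : rs.length + f = d) (hf : f = 1 ∨ f = 2)
    (hr : ∀ r ∈ rs, 0 ≤ r) (h_sorted : rs.Pairwise (· ≤ ·)) :
    (greedyLayout d f rs).coverRadius rs ≤ kappa * rs.sum := by
  rcases eq_or_ne rs [] with rfl | h_ne
  · simp [Layout.coverRadius]
  · have h_pos := List.length_pos_of_ne_nil h_ne
    have h_size := (isSpread_range (by omega : 2 ≤ d)).coverRadius_greedyRounds_le_sizeBound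
      (wedge := none) hf (by rw [List.length_range, hd]) le_rfl hr h_sorted le_rfl
    simpa [sizeBound, greedyLayout] using h_size

end SizeGreedyLayout

section RootedTree

variable {V : Type*} {G : SimpleGraph V} {r : V}

theorem isChild_or_isChild (hG : G.IsTree) (r : V) {u v : V} (huv : G.Adj u v) :
    IsChild G r u v ∨ IsChild G r v u := by
  rcases hG.dist_eq_dist_add_one_of_adj r huv with h_dist | h_dist
  · exact Or.inr ⟨huv.symm, h_dist⟩
  · exact Or.inl ⟨huv, h_dist⟩

theorem IsChild.not_isChild {u v : V} (huv : IsChild G r u v) : ¬ IsChild G r v u := by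
  intro hvu
  have := huv.2
  have := hvu.2
  omega

theorem IsChild.ne_root {u v : V} (huv : IsChild G r u v) : v ≠ r := by
  rintro rfl
  have := huv.2
  rw [SimpleGraph.dist_self] at this
  omega

theorem IsChild.unique (hG : G.IsTree) {u u' v : V} (hu : IsChild G r u v)
    (hu' : IsChild G r u' v) : u = u' := by
  obtain ⟨q, hq, hq_length⟩ := hG.connected.exists_path_of_dist r v
  have eq_penultimate : ∀ w, IsChild G r w v → w = q.penultimate := by
    intro w hw
    obtain ⟨p, hp, hp_length⟩ := hG.connected.exists_path_of_dist r w
    have hv : v ∉ p.support := by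
      intro hv
      have h_length :=
        congrArg SimpleGraph.Walk.length (hG.isAcyclic.path_concat hq hp hw.1.symm hv)
      rw [SimpleGraph.Walk.length_concat, hq_length, hp_length] at h_length
      have := hw.2
      omega
    exact hG.isAcyclic.eq_penultimate_of_adj_end hq hw.1.symm
      (hG.isAcyclic.mem_support_of_ne_mem_support_of_adj_of_isPath hq hp hw.1.symm hv)
  rw [eq_penultimate u hu, eq_penultimate u' hu']

theorem exists_adj_dist_eq_add_one (hG : G.Connected) {a b : V} (hab : a ≠ b) :
    ∃ c, G.Adj c b ∧ G.dist a b = G.dist a c + 1 := by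
  obtain ⟨p, hp⟩ := hG.exists_walk_length_eq_dist a b
  have p_not_nil : ¬ p.Nil := SimpleGraph.Walk.not_nil_of_ne hab
  have hadj := p.adj_penultimate p_not_nil
  refine ⟨p.penultimate, hadj, ?_⟩
  have h_dist_le := SimpleGraph.dist_le p.dropLast
  have h_length := SimpleGraph.Walk.length_dropLast_add_one p_not_nil
  have h_triangle := hG.dist_triangle (u := a) (v := p.penultimate) (w := b)
  rw [SimpleGraph.dist_eq_one_iff_adj.2 hadj] at h_triangle
  omega

theorem exists_isChild (hG : G.Connected) {v : V} (hv : v ≠ r) : ∃ u, IsChild G r u v :=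
  exists_adj_dist_eq_add_one hG hv.symm

/-- `Desc G r u w` states that `w` is `u` or a descendant of `u` in the tree `G` with root `r`. -/
def Desc (G : SimpleGraph V) (r : V) : V → V → Prop := Relation.ReflTransGen (IsChild G r)

theorem Desc.dist_le {u w : V} (huw : Desc G r u w) : G.dist r u ≤ G.dist r w := by
  induction huw with
  | refl => exact le_rfl
  | tail _ hc ih =>
    have := hc.2
    omega

theorem Desc.eq_of_dist_le {u w : V} (huw : Desc G r u w) (h_dist : G.dist r w ≤ G.dist r u) :
    u = w := by
  cases huw with
  | refl => rfl
  | tail hub hc =>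
    have := Desc.dist_le hub
    have := hc.2
    omega

theorem desc_of_mem_subtree (hG : G.Connected) {u w : V} (hw : w ∈ subtree G r u) :
    Desc G r u w := by
  induction hn : G.dist u w generalizing w with
  | zero =>
    obtain rfl := (hG.dist_eq_zero_iff).1 hn
    exact Relation.ReflTransGen.refl
  | succ n ih =>
    have hne : u ≠ w := by
      rintro rfl
      simp at hn
    obtain ⟨c, hc, h_dist⟩ := exists_adj_dist_eq_add_one hG hne
    have hw : G.dist r w = G.dist r u + G.dist u w := hw
    have h_triangle_u := hG.dist_triangle (u := r) (v := u) (w := c)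
    have h_triangle_c := hG.dist_triangle (u := r) (v := c) (w := w)
    rw [SimpleGraph.dist_eq_one_iff_adj.2 hc] at h_triangle_c
    have hc_mem : G.dist r c = G.dist r u + G.dist u c := by omega
    exact Relation.ReflTransGen.tail (ih hc_mem (by omega)) ⟨hc, by omega⟩

theorem Desc.mem_subtree (hG : G.Connected) {u w : V} (huw : Desc G r u w) :
    w ∈ subtree G r u := by
  induction huw with
  | refl => simp [subtree]
  | @tail b c _ hc ih =>
    have hb : G.dist r b = G.dist r u + G.dist u b := ih
    have h_triangle_u := hG.dist_triangle (u := r) (v := u) (w := c)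
    have h_triangle_b := hG.dist_triangle (u := u) (v := b) (w := c)
    rw [SimpleGraph.dist_eq_one_iff_adj.2 hc.1] at h_triangle_b
    have := hc.2
    change G.dist r c = G.dist r u + G.dist u c
    omega

theorem mem_subtree_iff (hG : G.Connected) {u w : V} : w ∈ subtree G r u ↔ Desc G r u w :=
  ⟨desc_of_mem_subtree hG, Desc.mem_subtree hG⟩

theorem subtree_root (G : SimpleGraph V) (r : V) : subtree G r r = Set.univ := by
  simp [subtree]

theorem desc_root (hG : G.Connected) (w : V) : Desc G r r w :=
  (mem_subtree_iff hG).1 (by simp only [subtree_root, Set.mem_univ])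

theorem Desc.total (hG : G.IsTree) {a b w : V} (ha : Desc G r a w) (hb : Desc G r b w) :
    Desc G r a b ∨ Desc G r b a := by
  have parent_unique : Relator.RightUnique (Function.swap (IsChild G r)) :=
    fun _ _ _ h h' => h.unique hG h'
  rcases Relation.ReflTransGen.total_of_right_unique parent_unique
    (Relation.reflTransGen_swap.2 ha) (Relation.reflTransGen_swap.2 hb) with hba | hab
  · exact Or.inr (Relation.reflTransGen_swap.1 hba)
  · exact Or.inl (Relation.reflTransGen_swap.1 hab)

theorem desc_trichotomy (hG : G.Connected) {v w : V} (hvw : v ≠ w) :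
    (∃ c, IsChild G r v c ∧ Desc G r c w) ∨ (∃ c, IsChild G r w c ∧ Desc G r c v) ∨
      ∃ z c c', IsChild G r z c ∧ IsChild G r z c' ∧ c ≠ c' ∧ Desc G r c v ∧ Desc G r c' w := by
  induction desc_root (r := r) hG w with
  | refl =>
    rcases Relation.ReflTransGen.cases_head (desc_root (r := r) hG v) with hv | below
    · exact absurd hv.symm hvw
    · exact Or.inr (Or.inl below)
  | @tail z w _ hzw ih =>
    by_cases hvz : v = z
    · subst hvz
      exact Or.inl ⟨w, hzw, Relation.ReflTransGen.refl⟩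
    rcases ih hvz with ⟨c, hc, hcz⟩ | ⟨c, hc, hcv⟩ | ⟨a, c, c', hc, hc', hne, hcv, hcz⟩
    · exact Or.inl ⟨c, hc, hcz.tail hzw⟩
    · by_cases hcw : c = w
      · subst hcw
        rcases Relation.ReflTransGen.cases_head hcv with hcv | below
        · exact absurd hcv.symm hvw
        · exact Or.inr (Or.inl below)
      · exact Or.inr (Or.inr ⟨z, c, w, hc, hzw, hcw, hcv, Relation.ReflTransGen.refl⟩)
    · exact Or.inr (Or.inr ⟨a, c, c', hc, hc', hne, hcv, hcz.tail hzw⟩)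

theorem IsChild.disjoint_subtree (hG : G.IsTree) {u c c' : V} (hc : IsChild G r u c)
    (hc' : IsChild G r u c') (hne : c ≠ c') : Disjoint (subtree G r c) (subtree G r c') := by
  rw [Set.disjoint_left]
  intro w hw hw'
  rw [mem_subtree_iff hG.connected] at hw hw'
  have h_dist := hc.2.trans hc'.2.symm
  rcases hw.total hG hw' with h | h
  · exact hne (h.eq_of_dist_le h_dist.ge)
  · exact hne (h.eq_of_dist_le h_dist.le).symm

theorem IsChild.notMem_subtree (hG : G.Connected) {u c : V} (hc : IsChild G r u c) :
    u ∉ subtree G r c := by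
  intro hu
  have := ((mem_subtree_iff hG).1 hu).dist_le
  have := hc.2
  omega

theorem IsChild.subtree_subset (hG : G.Connected) {u c : V} (hc : IsChild G r u c) :
    subtree G r c ⊆ subtree G r u := by
  intro w hw
  rw [mem_subtree_iff hG] at hw ⊢
  exact Relation.ReflTransGen.head hc hw

theorem sum_ncard_subtree_eq [Finite V] (hG : G.IsTree) {u : V} {l : List V} (hl : l.Nodup)
    (hlu : ∀ c ∈ l, IsChild G r u c) :
    (l.map fun c => (subtree G r c).ncard).sum = (⋃ c ∈ l, subtree G r c).ncard := by
  induction l with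
  | nil => simp
  | cons a l ih =>
    have h_union : (⋃ c ∈ a :: l, subtree G r c) = subtree G r a ∪ ⋃ c ∈ l, subtree G r c := by
      ext w
      simp
    have h_disjoint : Disjoint (subtree G r a) (⋃ c ∈ l, subtree G r c) := by
      rw [Set.disjoint_iUnion₂_right]
      intro c hc
      refine (hlu a List.mem_cons_self).disjoint_subtree hG (hlu c (List.mem_cons_of_mem a hc)) ?_
      rintro rfl
      exact (List.nodup_cons.1 hl).1 hc
    rw [List.map_cons, List.sum_cons, h_union, Set.ncard_union_eq h_disjoint,
      ih hl.of_cons fun c hc => hlu c (List.mem_cons_of_mem a hc)]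

theorem one_add_sum_ncard_subtree_le [Finite V] (hG : G.IsTree) {u : V} {l : List V}
    (hl : l.Nodup) (hlu : ∀ c ∈ l, IsChild G r u c) :
    1 + (l.map fun c => (subtree G r c).ncard).sum ≤ (subtree G r u).ncard := by
  have hu : u ∉ ⋃ c ∈ l, subtree G r c := by
    simp only [Set.mem_iUnion, not_exists]
    exact fun c hc => (hlu c hc).notMem_subtree hG.connected
  rw [sum_ncard_subtree_eq hG hl hlu, add_comm, ← Set.ncard_insert_of_notMem hu]
  refine Set.ncard_le_ncard (Set.insert_subset ?_ ?_)
  · simp [subtree]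
  · exact Set.iUnion₂_subset fun c hc => (hlu c hc).subtree_subset hG.connected

theorem wellFounded_isChild [Finite V] (G : SimpleGraph V) (r : V) :
    WellFounded fun v u => IsChild G r u v := by
  obtain ⟨N, hN⟩ := (Set.finite_range fun v => G.dist r v).bddAbove
  refine Subrelation.wf (r := InvImage (· < ·) fun v => N - G.dist r v) ?_
    (InvImage.wf _ wellFounded_lt)
  intro v u huv
  have hv : G.dist r v ≤ N := hN ⟨v, rfl⟩
  have := huv.2
  change N - G.dist r v < N - G.dist r u
  omega

theorem exists_state_of_children [Finite V] {σ : Type*} [Nonempty σ]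
    (Rel : V → σ → (V → σ) → Prop)
    (hRel : ∀ u s n n', (∀ v, IsChild G r u v → n v = n' v) → Rel u s n → Rel u s n')
    (h_step : ∀ u n, ∃ s, Rel u s n) : ∃ st : V → σ, ∀ u, Rel u (st u) st := by
  classical
  choose next next_spec using h_step
  let wf := wellFounded_isChild G r
  let step : ∀ u, (∀ v, IsChild G r u v → σ) → σ := fun u rec =>
    next u fun v => if huv : IsChild G r u v then rec v huv else Classical.arbitrary σ
  refine ⟨wf.fix step, fun u => ?_⟩
  rw [wf.fix_eq step u]
  exact hRel u _ _ _ (fun v huv => dif_pos huv) (next_spec u _)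

theorem exists_eq_of_parent (hG : G.IsTree) {σ : Type*} (s₀ : σ) (next : V → σ → V → σ) :
    ∃ st : V → σ, st r = s₀ ∧ ∀ z v, IsChild G r z v → st v = next z (st z) v := by
  classical
  have parent_exists : ∀ v : V, ∃ u, v ≠ r → IsChild G r u v := fun v => by
    by_cases hv : v = r
    · exact ⟨v, fun hv' => absurd hv hv'⟩
    · obtain ⟨u, hu⟩ := exists_isChild hG.connected hv
      exact ⟨u, fun _ => hu⟩
  choose parent parent_spec using parent_exists
  have parent_lt : ∀ v, v ≠ r → G.dist r (parent v) < G.dist r v := fun v hv => by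
    have := (parent_spec v hv).2
    omega
  let wf : WellFounded fun u v : V => G.dist r u < G.dist r v :=
    InvImage.wf (fun v => G.dist r v) wellFounded_lt
  let step : ∀ v, (∀ u, G.dist r u < G.dist r v → σ) → σ := fun v rec =>
    if hv : v = r then s₀ else next (parent v) (rec (parent v) (parent_lt v hv)) v
  refine ⟨wf.fix step, ?_, fun z v hzv => ?_⟩
  · rw [wf.fix_eq step r]
    exact dif_pos rfl
  · rw [wf.fix_eq step v]
    obtain rfl := (parent_spec v hzv.ne_root).unique hG hzv
    exact dif_neg hzv.ne_root

theorem exists_state_of_parent (hG : G.IsTree) {σ : Type*} (Valid : V → σ → Prop)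
    (Rel : V → σ → (V → σ) → Prop)
    (hRel : ∀ z s n n', (∀ v, IsChild G r z v → n v = n' v) → Rel z s n → Rel z s n') (s₀ : σ)
    (h_root : Valid r s₀)
    (h_step : ∀ z s, Valid z s → ∃ n, Rel z s n ∧ ∀ v, IsChild G r z v → Valid v (n v)) :
    ∃ st : V → σ, st r = s₀ ∧ ∀ z, Valid z (st z) ∧ Rel z (st z) st := by
  have : Nonempty σ := ⟨s₀⟩
  choose! next next_spec using h_step
  obtain ⟨st, st_root, st_child⟩ := exists_eq_of_parent hG s₀ next
  have st_valid : ∀ z, Valid z (st z) := by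
    intro z
    induction desc_root (r := r) hG.connected z with
    | refl => rwa [st_root]
    | @tail z v _ hzv ih =>
      rw [st_child z v hzv]
      exact (next_spec z _ ih).2 v hzv
  exact ⟨st, st_root, fun z => ⟨st_valid z, hRel z _ _ _ (fun v hzv => (st_child z v hzv).symm)
    (next_spec z _ (st_valid z)).1⟩⟩

end RootedTree

section StarPlan

variable {V : Type*}

theorem exists_eq_map_of_nodup {α : Type*} [Nonempty α] {l : List V} (hl : l.Nodup) {m : List α}
    (h_length : m.length = l.length) : ∃ f : V → α, m = l.map f := by
  classical
  refine ⟨fun v => m.getD (l.idxOf v) (Classical.arbitrary α), ?_⟩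
  refine List.ext_getElem (by rw [List.length_map, h_length]) fun i hi hi' => ?_
  rw [List.getElem_map, hl.idxOf_getElem, List.getD_eq_getElem _ _ hi]

/-- The spokes `spoke` and the distances `dist` describe the layout `lay` of the balloons with
labels `L` and radii `X` and of the free spokes with labels `F`. -/
structure IsStarPlan (d : ℕ) (L F : List V) (X : V → ℝ) (lay : Layout) (spoke : V → ℕ)
    (dist : V → ℝ) : Prop where
  placed : lay.placed = L.map fun v => (spoke v, dist v)
  free : lay.free = F.map spoke
  spoke_lt : ∀ v, v ∈ L ∨ v ∈ F → spoke v < d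
  spoke_inj : ∀ v w, v ∈ L ∨ v ∈ F → w ∈ L ∨ w ∈ F → spoke v = spoke w → v = w
  radius_le : ∀ v ∈ L, X v ≤ dist v
  separated : ∀ v ∈ L, ∀ w ∈ L, v ≠ w →
    Balloon.Separated d ⟨spoke v, dist v, X v⟩ ⟨spoke w, dist w, X w⟩
  rayAvoids : ∀ v ∈ L, ∀ w ∈ F, Balloon.RayAvoids d ⟨spoke v, dist v, X v⟩ (spoke w)
  angle : ∀ v w, F = [v, w] → spokeCos d (spoke v) (spoke w) ≤ -(1 / 2)
  cover : ∀ v ∈ L, dist v + X v ≤ lay.coverRadius (L.map X)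

variable {d : ℕ} {L F : List V} {X : V → ℝ} {lay : Layout} {spoke : V → ℕ} {dist : V → ℝ}

theorem balloons_eq_map (h_placed : lay.placed = L.map fun v => (spoke v, dist v)) :
    lay.balloons (L.map X) = L.map fun v => ⟨spoke v, dist v, X v⟩ := by
  rw [Layout.balloons_eq_map_zip, h_placed, List.zip_map', List.map_map]
  rfl

theorem IsSeparated.isStarPlan (h : IsSeparated d F.length (List.range d) 0 (L.map X) lay)
    (h_placed : lay.placed = L.map fun v => (spoke v, dist v)) (h_free : lay.free = F.map spoke) :
    IsStarPlan d L F X lay spoke dist := by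
  have h_balloons := balloons_eq_map (X := X) h_placed
  have h_perm : ((L ++ F).map spoke).Perm (List.range d) := by
    rw [List.map_append, ← h_free]
    simpa only [h_placed, List.map_map, Function.comp_def] using h.perm
  have h_mem : ∀ v ∈ L, ⟨spoke v, dist v, X v⟩ ∈ lay.balloons (L.map X) := fun v hv =>
    h_balloons ▸ List.mem_map_of_mem hv
  refine ⟨h_placed, h_free, fun v hv => ?_, fun v w hv hw => ?_, fun v hv => ?_,
    fun v hv w hw => ?_, fun v hv w hw => ?_, fun v w hF => ?_, fun v hv => ?_⟩
  · rw [← List.mem_append] at hv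
    exact List.mem_range.1 (h_perm.subset (List.mem_map_of_mem hv))
  · rw [← List.mem_append] at hv hw
    exact List.inj_on_of_nodup_map (h_perm.symm.nodup List.nodup_range) hv hw
  · exact sub_nonneg.1 (h.inner _ (h_mem v hv))
  · have h_pairwise := h.pairwise
    rw [h_balloons, List.pairwise_map] at h_pairwise
    have : Std.Symm fun v w =>
        Balloon.Separated d ⟨spoke v, dist v, X v⟩ ⟨spoke w, dist w, X w⟩ := ⟨fun _ _ => .symm⟩
    exact h_pairwise.forall hv hw
  · exact h.rayAvoids _ (h_mem v hv) _ (h_free ▸ List.mem_map_of_mem hw)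
  · exact h.angle _ _ (by rw [h_free, hF]; rfl)
  · exact Layout.le_coverRadius (h_mem v hv)

theorem IsSeparated.exists_isStarPlan (hLF : (L ++ F).Nodup)
    (h : IsSeparated d F.length (List.range d) 0 (L.map X) lay) :
    ∃ spoke dist, IsStarPlan d L F X lay spoke dist := by
  have h_length : lay.placed.length = L.length := by rw [h.length_placed, List.length_map]
  obtain ⟨spoke, h_spoke⟩ := exists_eq_map_of_nodup hLF (m := lay.placed.map Prod.fst ++ lay.free)
    (by rw [List.length_append, List.length_append, List.length_map, h_length, h.length_free])
  obtain ⟨dist, h_dist⟩ := exists_eq_map_of_nodup hLF.of_append_left (m := lay.placed.map Prod.snd)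
    (by rw [List.length_map, h_length])
  rw [List.map_append] at h_spoke
  obtain ⟨h_fst, h_free⟩ := List.append_inj h_spoke (by simp only [List.length_map, h_length])
  refine ⟨spoke, dist, h.isStarPlan ?_ h_free⟩
  rw [← List.zip_map', ← h_fst, ← h_dist, List.zip_map', List.map_id']

end StarPlan

section Plan

variable {V : Type*} {G : SimpleGraph V} {r : V} {h : V → Option V}

theorem adj_and_not_isLightChild_iff (hG : G.IsTree) (hh : IsHeavyChoice G r h) {u v : V} :
    G.Adj u v ∧ ¬ IsLightChild G r h u v ↔ IsChild G r v u ∨ h u = some v := by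
  constructor
  · rintro ⟨huv, h_not_light⟩
    rcases isChild_or_isChild hG r huv with h_child | h_parent
    · exact Or.inr (not_not.1 fun h_light => h_not_light ⟨h_child, h_light⟩)
    · exact Or.inl h_parent
  · rintro (h_parent | h_heavy)
    · exact ⟨h_parent.1.symm, fun h_light => h_parent.not_isChild h_light.1⟩
    · exact ⟨(hh.isChild u v h_heavy).1, fun h_light => h_light.2 h_heavy⟩

theorem exists_list_not_light (hG : G.IsTree) (hh : IsHeavyChoice G r h) (u : V) :
    ∃ F : List V, F.Nodup ∧ (∀ v, v ∈ F ↔ G.Adj u v ∧ ¬ IsLightChild G r h u v) ∧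
      (∀ z v, IsChild G r z u → h u = some v → F = [z, v]) ∧
      (F = [] → h u = none) ∧ F.length ≤ 2 := by
  simp only [adj_and_not_isLightChild_iff hG hh]
  by_cases hu : u = r
  · have no_parent : ∀ z, ¬ IsChild G r z u := fun z hz => hz.ne_root hu
    cases hv : h u with
    | none => exact ⟨[], by simp [no_parent]⟩
    | some w => exact ⟨[w], by simp [no_parent, eq_comm]⟩
  · obtain ⟨z, hz⟩ := exists_isChild hG.connected hu
    have parent_iff : ∀ v, IsChild G r v u ↔ v = z :=
      fun v => ⟨fun hv => hv.unique hG hz, fun hv => hv ▸ hz⟩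
    simp only [parent_iff]
    cases hv : h u with
    | none => exact ⟨[z], by simp⟩
    | some w =>
      have hzw : z ≠ w := by
        rintro rfl
        exact hz.not_isChild (hh.isChild u z hv)
      refine ⟨[z, w], by simpa using hzw, by simp [eq_comm], ?_, by simp, by simp⟩
      rintro z' v rfl ⟨⟩
      rfl

theorem nodup_append_of_light {L F : List V} {u : V} (hL : L.Nodup) (hF : F.Nodup)
    (mem_L : ∀ v, v ∈ L ↔ IsLightChild G r h u v)
    (mem_F : ∀ v, v ∈ F ↔ G.Adj u v ∧ ¬ IsLightChild G r h u v) : (L ++ F).Nodup :=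
  hL.append hF fun v hvL hvF => ((mem_F v).1 hvF).2 ((mem_L v).1 hvL)

theorem deg_eq_length_add_length {L F : List V} {u : V} (hLF : (L ++ F).Nodup)
    (mem_L : ∀ v, v ∈ L ↔ IsLightChild G r h u v)
    (mem_F : ∀ v, v ∈ F ↔ G.Adj u v ∧ ¬ IsLightChild G r h u v) :
    deg G u = L.length + F.length := by
  classical
  have h_neighbors : G.neighborSet u = ((L ++ F).toFinset : Set V) := by
    ext v
    have : IsLightChild G r h u v → G.Adj u v := fun h_light => h_light.1.1
    simp only [SimpleGraph.mem_neighborSet, List.coe_toFinset, Set.mem_ofPred_eq, List.mem_append,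
      mem_L, mem_F]
    tauto
  rw [deg, h_neighbors, Set.ncard_coe_finset, List.toFinset_card_of_nodup hLF, List.length_append]

/-- `L` lists the light children of `u` in the order of the radii `X`, and `R` is the radius that
the construction reserves for the subtree of `u`, drawn with `f` free spokes at `u`. On a heavy
path, a vertex `u` that is not a leaf takes up three times the radius of its star, the radius
being at least `1 / 2`; the leaf at the end of the path takes up no space. -/
structure IsStarSize (G : SimpleGraph V) (r : V) (h : V → Option V) (f : ℕ) (u : V) (R : ℝ)
    (L : List V) (X : V → ℝ) : Prop where
  nodup : L.Nodup
  mem_iff : ∀ v, v ∈ L ↔ IsLightChild G r h u v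
  sorted : (L.map X).Pairwise (· ≤ ·)
  leaf : h u = none → R = 1
  heavy : ∀ v, h u = some v →
    R = 3 * max ((greedyLayout (deg G u) f (L.map X)).coverRadius (L.map X)) (1 / 2) +
      if h v = none then 0 else X v

theorem IsStarSize.congr (hh : IsHeavyChoice G r h) {f : ℕ} {u : V} {R : ℝ} {L : List V}
    {X X' : V → ℝ} (hX : ∀ v, IsChild G r u v → X v = X' v) (hL : IsStarSize G r h f u R L X) :
    IsStarSize G r h f u R L X' := by
  have h_map : L.map X = L.map X' :=
    List.map_congr_left fun v hv => hX v ((hL.mem_iff v).1 hv).1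
  refine ⟨hL.nodup, hL.mem_iff, h_map ▸ hL.sorted, hL.leaf, fun v hv => ?_⟩
  rw [hL.heavy v hv, h_map, hX v (hh.isChild u v hv)]

theorem exists_sorted_list_isLightChild [Finite V] (G : SimpleGraph V) (r : V) (h : V → Option V)
    (u : V) (X : V → ℝ) : ∃ L : List V, L.Nodup ∧ (∀ v, v ∈ L ↔ IsLightChild G r h u v) ∧
      (L.map X).Pairwise (· ≤ ·) := by
  classical
  cases nonempty_fintype V
  let light := (Finset.univ.filter fun v => IsLightChild G r h u v).toList
  have h_perm := List.perm_insertionSort (fun v w => X v ≤ X w) light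
  have : Std.Total fun v w => X v ≤ X w := ⟨fun v w => le_total (X v) (X w)⟩
  have : IsTrans V fun v w => X v ≤ X w := ⟨fun _ _ _ => le_trans⟩
  refine ⟨light.insertionSort fun v w => X v ≤ X w, h_perm.nodup_iff.2 (Finset.nodup_toList _),
    fun v => by simp [h_perm.mem_iff, light], ?_⟩
  rw [List.pairwise_map]
  exact List.pairwise_insertionSort _ _

theorem exists_isStarSize [Finite V] (hh : IsHeavyChoice G r h) (f : V → ℕ) :
    ∃ (X : V → ℝ) (L : V → List V), ∀ u, IsStarSize G r h (f u) u (X u) (L u) X := by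
  obtain ⟨st, h_st⟩ := exists_state_of_children (G := G) (r := r) (σ := ℝ × List V)
    (fun u s n => IsStarSize G r h (f u) u s.1 s.2 fun v => (n v).1)
    (fun u s n n' hn hs => hs.congr hh fun v hv => congrArg Prod.fst (hn v hv)) fun u n => by
      obtain ⟨L, hL, mem_L, sorted_L⟩ := exists_sorted_list_isLightChild G r h u fun v => (n v).1
      cases hu : h u with
      | none => exact ⟨(1, L), hL, mem_L, sorted_L, fun _ => rfl, by simp [hu]⟩
      | some v =>
        let R := 3 * max ((greedyLayout (deg G u) (f u) (L.map fun v => (n v).1)).coverRadius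
          (L.map fun v => (n v).1)) (1 / 2) + if h v = none then 0 else (n v).1
        refine ⟨(R, L), hL, mem_L, sorted_L, by simp [hu], fun w hw => ?_⟩
        obtain rfl : v = w := Option.some.inj (hu.symm.trans hw)
        rfl
  exact ⟨fun u => (st u).1, fun u => (st u).2, h_st⟩

theorem nonneg_of_isStarSize [Finite V] (hh : IsHeavyChoice G r h) {f : V → ℕ} {X : V → ℝ}
    {L : V → List V} (hX : ∀ u, IsStarSize G r h (f u) u (X u) (L u) X) (u : V) : 0 ≤ X u := by
  induction u using (wellFounded_isChild G r).induction with
  | _ u ih =>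
    cases hu : h u with
    | none =>
      rw [(hX u).leaf hu]
      exact zero_le_one
    | some v =>
      rw [(hX u).heavy v hu]
      have h_rest : 0 ≤ if h v = none then 0 else X v := by
        split_ifs
        · exact le_rfl
        · exact ih v (hh.isChild u v hu)
      positivity

/-- The radii `X` of the subtrees and the layouts of all stars, up to rotation and reflection: `L u`
lists the light children of `u`, `F u` the other neighbours, the parent coming first, and `spoke u`
and `dist u` describe the layout of the star at `u`. -/
structure Plan (G : SimpleGraph V) (r : V) (h : V → Option V) where
  X : V → ℝ
  L : V → List V
  F : V → List V
  spoke : V → V → ℕ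
  dist : V → V → ℝ
  size : ∀ u, IsStarSize G r h (F u).length u (X u) (L u) X
  nodup_F : ∀ u, (F u).Nodup
  mem_F : ∀ u v, v ∈ F u ↔ G.Adj u v ∧ ¬ IsLightChild G r h u v
  F_eq : ∀ z u v, IsChild G r z u → h u = some v → F u = [z, v]
  star : ∀ u, IsStarPlan (deg G u) (L u) (F u) X
    (greedyLayout (deg G u) (F u).length ((L u).map X)) (spoke u) (dist u)
  coverRadius_le : ∀ u, (greedyLayout (deg G u) (F u).length ((L u).map X)).coverRadius
    ((L u).map X) ≤ kappa * ((L u).map X).sum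

theorem isSeparated_greedyLayout_nil :
    IsSeparated 0 0 (List.range 0) 0 [] (greedyLayout 0 0 []) := by
  have h_nil : greedyLayout 0 0 [] = ⟨[], []⟩ := by
    rw [greedyLayout, greedyRounds_of_not_lt (by simp)]
    rfl
  rw [h_nil]
  exact ⟨rfl, List.Perm.nil, rfl, by simp [Layout.balloons], List.Pairwise.nil,
    by simp [Layout.balloons], by simp⟩

theorem exists_plan [Finite V] (hG : G.IsTree) (hh : IsHeavyChoice G r h) :
    Nonempty (Plan G r h) := by
  choose F nodup_F mem_F F_eq F_nil F_length using exists_list_not_light hG hh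
  obtain ⟨X, L, size⟩ := exists_isStarSize (G := G) hh fun u => (F u).length
  have radius_nonneg : ∀ u, ∀ ρ ∈ (L u).map X, 0 ≤ ρ := fun u =>
    List.forall_mem_map.2 fun v _ => nonneg_of_isStarSize hh size v
  have nodup_append : ∀ u, (L u ++ F u).Nodup := fun u =>
    nodup_append_of_light (size u).nodup (nodup_F u) (size u).mem_iff (mem_F u)
  have h_deg : ∀ u, ((L u).map X).length + (F u).length = deg G u := fun u => by
    rw [List.length_map, deg_eq_length_add_length (nodup_append u) (size u).mem_iff (mem_F u)]
  have cases_F : ∀ u, (F u).length = 1 ∨ (F u).length = 2 ∨ F u = [] ∧ L u = [] := by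
    intro u
    rcases eq_or_ne (F u) [] with hF | hF
    · refine Or.inr (Or.inr ⟨hF, List.eq_nil_iff_forall_not_mem.2 fun v hv => ?_⟩)
      exact hh.exists_of_child u v (((size u).mem_iff v).1 hv).1 (F_nil u hF)
    · have := List.length_pos_of_ne_nil hF
      have := F_length u
      omega
  have star : ∀ u, ∃ spoke dist, IsStarPlan (deg G u) (L u) (F u) X
      (greedyLayout (deg G u) (F u).length ((L u).map X)) spoke dist := fun u => by
    refine IsSeparated.exists_isStarPlan (nodup_append u) ?_
    rcases cases_F u with hF | hF | ⟨hF, hL⟩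
    · exact isSeparated_greedyLayout (h_deg u) (Or.inl hF) (radius_nonneg u)
    · exact isSeparated_greedyLayout (h_deg u) (Or.inr hF) (radius_nonneg u)
    · simpa [← h_deg, hF, hL] using isSeparated_greedyLayout_nil
  choose spoke dist star using star
  refine ⟨⟨X, L, F, spoke, dist, size, nodup_F, mem_F, fun z u v => F_eq u z v, star, fun u => ?_⟩⟩
  rcases cases_F u with hF | hF | ⟨-, hL⟩
  · exact coverRadius_greedyLayout_le (h_deg u) (Or.inl hF) (radius_nonneg u) (size u).sorted
  · exact coverRadius_greedyLayout_le (h_deg u) (Or.inr hF) (radius_nonneg u) (size u).sorted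
  · simp [hL, Layout.coverRadius]

end Plan

namespace Plan

variable {V : Type*} {G : SimpleGraph V} {r : V} {h : V → Option V} (P : Plan G r h) {u v : V}

/-- The radius of the smallest disk about `u` that covers the balloons of the star at `u`. -/
noncomputable def x (u : V) : ℝ :=
  (greedyLayout (deg G u) (P.F u).length ((P.L u).map P.X)).coverRadius ((P.L u).map P.X)

open Classical in
/-- The radius of the disk about `u` reserved on its heavy path. It is at least `1 / 2` if `u` is
not a leaf, so that the edges of the heavy path do not get too short. -/
noncomputable def y (u : V) : ℝ := if h u = none then 0 else max (P.x u) (1 / 2)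

open Classical in
/-- The space that the part of the heavy path from `u` on needs. -/
noncomputable def Z (u : V) : ℝ := if h u = none then 0 else P.X u

theorem isChild_of_mem_L (hv : v ∈ P.L u) : IsChild G r u v := (((P.size u).mem_iff v).1 hv).1

theorem x_nonneg (u : V) : 0 ≤ P.x u := Layout.coverRadius_nonneg _ _

theorem x_leaf (hh : IsHeavyChoice G r h) (hu : h u = none) : P.x u = 0 := by
  have hL : P.L u = [] := List.eq_nil_iff_forall_not_mem.2 fun v hv =>
    hh.exists_of_child u v (P.isChild_of_mem_L hv) hu
  simp [x, hL, Layout.coverRadius]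

theorem y_leaf (hu : h u = none) : P.y u = 0 := if_pos hu

theorem y_of_heavy (hu : h u = some v) : P.y u = max (P.x u) (1 / 2) := by simp [y, hu]

theorem Z_leaf (hu : h u = none) : P.Z u = 0 := if_pos hu

theorem Z_of_heavy (hu : h u = some v) : P.Z u = P.X u := by simp [Z, hu]

theorem Z_eq_add (hu : h u = some v) : P.Z u = 3 * P.y u + P.Z v := by
  rw [P.Z_of_heavy hu, (P.size u).heavy v hu, P.y_of_heavy hu, x, Z]

theorem x_le_y (hh : IsHeavyChoice G r h) (u : V) : P.x u ≤ P.y u := by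
  cases hu : h u with
  | none => rw [P.x_leaf hh hu, P.y_leaf hu]
  | some v =>
    rw [P.y_of_heavy hu]
    exact le_max_left _ _

theorem y_nonneg (u : V) : 0 ≤ P.y u := by
  cases hu : h u with
  | none => rw [P.y_leaf hu]
  | some v =>
    rw [P.y_of_heavy hu]
    exact le_max_of_le_left (P.x_nonneg u)

theorem half_le_y (hu : h u = some v) : 1 / 2 ≤ P.y u := by
  rw [P.y_of_heavy hu]
  exact le_max_right _ _

theorem X_nonneg [Finite V] (hh : IsHeavyChoice G r h) (u : V) : 0 ≤ P.X u :=
  nonneg_of_isStarSize hh P.size u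

theorem Z_nonneg [Finite V] (hh : IsHeavyChoice G r h) (u : V) : 0 ≤ P.Z u := by
  cases hu : h u with
  | none => rw [P.Z_leaf hu]
  | some v =>
    rw [P.Z_of_heavy hu]
    exact P.X_nonneg hh u

theorem one_le_X [Finite V] (hh : IsHeavyChoice G r h) (u : V) : 1 ≤ P.X u := by
  cases hu : h u with
  | none => rw [(P.size u).leaf hu]
  | some v =>
    rw [← P.Z_of_heavy hu, P.Z_eq_add hu]
    linarith [P.half_le_y hu, P.Z_nonneg hh v]

theorem Z_le_X [Finite V] (hh : IsHeavyChoice G r h) (u : V) : P.Z u ≤ P.X u := by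
  cases hu : h u with
  | none =>
    rw [P.Z_leaf hu]
    exact P.X_nonneg hh u
  | some v => rw [P.Z_of_heavy hu]

theorem y_le [Finite V] (hh : IsHeavyChoice G r h) (hu : h u = some v) :
    P.y u ≤ kappa * ((P.L u).map P.X).sum + 1 / 2 := by
  have h_sum : 0 ≤ ((P.L u).map P.X).sum := List.sum_nonneg <|
    List.forall_mem_map.2 fun v _ => P.X_nonneg hh v
  rw [P.y_of_heavy hu]
  refine max_le ((P.coverRadius_le u).trans ?_) ?_
  · linarith
  · linarith [mul_nonneg kappa_pos.le h_sum]

theorem X_le_add [Finite V] (hh : IsHeavyChoice G r h) (hu : h u = some v) :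
    P.X u ≤ P.X v + (4 * kappa - 1) * (1 + ((P.L u).map P.X).sum) := by
  have h_sum : 0 ≤ ((P.L u).map P.X).sum := List.sum_nonneg <|
    List.forall_mem_map.2 fun v _ => P.X_nonneg hh v
  rw [← P.Z_of_heavy hu, P.Z_eq_add hu]
  nlinarith [P.y_le hh hu, P.Z_le_X hh v, two_lt_kappa]

theorem ncard_subtree_add_sum_le [Finite V] (hG : G.IsTree) (hh : IsHeavyChoice G r h)
    (hu : h u = some v) :
    ((subtree G r v).ncard : ℝ) + (1 + ((P.L u).map fun c => ((subtree G r c).ncard : ℝ)).sum) ≤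
      (subtree G r u).ncard := by
  have h_nodup : (v :: P.L u).Nodup := List.nodup_cons.2
    ⟨fun hv => (((P.size u).mem_iff v).1 hv).2 hu, (P.size u).nodup⟩
  have h_card : ((1 + ((v :: P.L u).map fun c => (subtree G r c).ncard).sum : ℕ) : ℝ) ≤
      (subtree G r u).ncard := by
    refine Nat.cast_le.2 (one_add_sum_ncard_subtree_le hG h_nodup ?_)
    exact List.forall_mem_cons.2 ⟨hh.isChild u v hu, fun c => P.isChild_of_mem_L⟩
  simp only [List.map_cons, List.sum_cons, Nat.cast_add, Nat.cast_one, Nat.cast_list_sum,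
    List.map_map, Function.comp_def] at h_card
  linarith

theorem one_le_ncard_subtree [Finite V] (G : SimpleGraph V) (r u : V) :
    (1 : ℝ) ≤ (subtree G r u).ncard := by
  have h_nonempty : (subtree G r u).Nonempty := ⟨u, by simp [subtree]⟩
  exact_mod_cast (Set.ncard_pos (Set.toFinite _)).2 h_nonempty

theorem X_le [Finite V] (hG : G.IsTree) (hh : IsHeavyChoice G r h) (u : V) :
    P.X u ≤ ((subtree G r u).ncard : ℝ) ^ (2 + logb 2 kappa) := by
  have he : 1 ≤ 2 + logb 2 kappa := by linarith [one_le_logb_kappa]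
  induction u using (wellFounded_isChild G r).induction with
  | _ u ih =>
    cases hu : h u with
    | none =>
      rw [(P.size u).leaf hu]
      exact one_le_rpow (one_le_ncard_subtree G r u) (by linarith)
    | some v =>
      have hv := hh.isChild u v hu
      have h_power_sum := rpow_add_two_rpow_sub_one_mul_sum_rpow_le (e := 2 + logb 2 kappa)
        (a := (subtree G r v).ncard) he
        (l := 1 :: (P.L u).map fun c => ((subtree G r c).ncard : ℝ))
        (List.forall_mem_cons.2 ⟨⟨zero_le_one, one_le_ncard_subtree G r v⟩,
          List.forall_mem_map.2 fun c hc => ⟨Nat.cast_nonneg _,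
            Nat.cast_le.2 (hh.largest u v hu c (P.isChild_of_mem_L hc))⟩⟩)
      simp only [List.map_cons, List.sum_cons, List.map_map, Function.comp_def, one_rpow,
        two_rpow_two_add_logb_kappa] at h_power_sum
      have h_light := List.sum_le_sum fun c (hc : c ∈ P.L u) => ih c (P.isChild_of_mem_L hc)
      have h_coeff : 0 ≤ 4 * kappa - 1 := by linarith [two_lt_kappa]
      calc P.X u ≤ P.X v + (4 * kappa - 1) * (1 + ((P.L u).map P.X).sum) := P.X_le_add hh hu
        _ ≤ _ := by gcongr; exact ih v hv
        _ ≤ _ := h_power_sum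
        _ ≤ _ := rpow_le_rpow (add_nonneg (Nat.cast_nonneg _) (add_nonneg zero_le_one
          (List.sum_nonneg (List.forall_mem_map.2 fun c _ => Nat.cast_nonneg _))))
          (P.ncard_subtree_add_sum_le hG hh hu) (by linarith)

theorem X_root_le [Finite V] (hG : G.IsTree) (hh : IsHeavyChoice G r h) :
    P.X r ≤ (Nat.card V : ℝ) ^ 2 * (Nat.card V : ℝ) ^ logb 2 kappa := by
  have : Nonempty V := ⟨r⟩
  have h_card : (0 : ℝ) < Nat.card V := Nat.cast_pos.2 Nat.card_pos
  rw [← rpow_two, ← rpow_add h_card, ← Set.ncard_univ, ← subtree_root G r]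
  exact P.X_le hG hh r

end Plan

section Directions

theorem inner_mul_exp_mul_I (a q : ℂ) (φ : ℝ) : inner ℝ a (q * Complex.exp (φ * Complex.I)) =
    cos φ * inner ℝ a q + sin φ * inner ℝ a (Complex.I * q) := by
  simp only [Complex.inner, Complex.exp_mul_I, ← Complex.ofReal_cos, ← Complex.ofReal_sin,
    Complex.mul_re, Complex.mul_im, Complex.add_re, Complex.add_im, Complex.ofReal_re,
    Complex.ofReal_im, Complex.I_re, Complex.I_im]
  ring

theorem inner_I_mul_self (a : ℂ) : inner ℝ a (Complex.I * a) = (0 : ℝ) := by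
  simp only [Complex.inner, Complex.mul_re, Complex.mul_im, Complex.conj_re, Complex.conj_im,
    Complex.I_re, Complex.I_im]
  ring

theorem inner_sq_add_inner_I_mul_sq (a q : ℂ) :
    inner ℝ a q ^ 2 + inner ℝ a (Complex.I * q) ^ 2 = ‖a‖ ^ 2 * ‖q‖ ^ 2 := by
  simp only [← Complex.normSq_eq_norm_sq, Complex.normSq_apply, Complex.inner, Complex.mul_re,
    Complex.mul_im, Complex.conj_re, Complex.conj_im, Complex.I_re, Complex.I_im]
  ring

theorem norm_spokeDir (d : ℕ) (θ ε : ℝ) (s : ℕ) : ‖spokeDir d θ ε s‖ = 1 :=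
  Complex.norm_exp_ofReal_mul_I _

theorem exists_spokeDir_eq (d : ℕ) (ε : ℝ) (s : ℕ) {u : ℂ} (hu : ‖u‖ = 1) :
    ∃ θ, spokeDir d θ ε s = u := by
  refine ⟨u.arg - ε * (2 * π * s / d), ?_⟩
  have h_polar := Complex.norm_mul_exp_arg_mul_I u
  rwa [hu, Complex.ofReal_one, one_mul, ← sub_add_cancel u.arg (ε * (2 * π * s / d))] at h_polar

theorem spokeDir_eq_mul (d : ℕ) (θ ε : ℝ) (s t : ℕ) :
    spokeDir d θ ε t = spokeDir d θ ε s *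
      Complex.exp ((ε * (2 * π * ((t : ℝ) - s) / d) : ℝ) * Complex.I) := by
  unfold spokeDir
  rw [← Complex.exp_add]
  congr 1
  push_cast
  ring

theorem inner_spokeDir (d : ℕ) (θ : ℝ) {ε : ℝ} (hε : ε = 1 ∨ ε = -1) (s t : ℕ) :
    inner ℝ (spokeDir d θ ε s) (spokeDir d θ ε t) = spokeCos d s t := by
  rw [spokeDir_eq_mul d θ ε s t, inner_mul_exp_mul_I, inner_I_mul_self,
    real_inner_self_eq_norm_sq, norm_spokeDir, spokeCos_comm, spokeCos]
  rcases hε with rfl | rfl <;> simp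

theorem half_le_mul_add_abs_mul {a b c s : ℝ} (hab : a ^ 2 + b ^ 2 = 1) (hcs : c ^ 2 + s ^ 2 = 1)
    (ha : 1 / 2 ≤ a) (hc : 1 / 2 ≤ c) : 1 / 2 ≤ a * c + |b * s| := by
  have abs_eq : ∀ x y : ℝ, x ^ 2 + y ^ 2 = 1 → |y| = sin (arccos x) := fun x y hxy => by
    rw [sin_arccos, ← hxy, add_sub_cancel_left, sqrt_sq_eq_abs]
  have cos_eq : ∀ x y : ℝ, x ^ 2 + y ^ 2 = 1 → x = cos (arccos x) := fun x y hxy =>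
    (cos_arccos (by nlinarith [sq_nonneg y]) (by nlinarith [sq_nonneg y])).symm
  have arccos_le : ∀ x : ℝ, 1 / 2 ≤ x → arccos x ≤ π / 3 := fun x hx => by
    rw [← arccos_cos (x := π / 3) (by positivity) (by linarith [pi_pos]), cos_pi_div_three]
    exact arccos_le_arccos hx
  rw [abs_mul, abs_eq a b hab, abs_eq c s hcs]
  nth_rw 1 [cos_eq a b hab, cos_eq c s hcs]
  rw [← cos_sub, ← cos_pi_div_three, ← cos_abs (arccos a - arccos c)]
  refine cos_le_cos_of_nonneg_of_le_pi (abs_nonneg _) (by linarith [pi_pos]) (abs_le.2 ⟨?_, ?_⟩)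
  · linarith [arccos_nonneg a, arccos_le c hc]
  · linarith [arccos_nonneg c, arccos_le a ha]

theorem exists_turn {d s t : ℕ} (h_turn : spokeCos d s t ≤ -(1 / 2)) {dir axis : ℂ}
    (h_dir : ‖dir‖ = 1) (h_axis : ‖axis‖ = 1) (h_inner : 1 / 2 ≤ inner ℝ axis dir) :
    ∃ θ ε : ℝ, (ε = 1 ∨ ε = -1) ∧ spokeDir d θ ε s = -dir ∧
      1 / 2 ≤ inner ℝ axis (spokeDir d θ ε t) := by
  set φ : ℝ := 2 * π * ((t : ℝ) - s) / d with hφ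
  rw [spokeCos_comm] at h_turn
  have inner_eq : ∀ θ ε, spokeDir d θ ε s = -dir → inner ℝ axis (spokeDir d θ ε t) =
      inner ℝ axis dir * -cos (ε * φ) - inner ℝ axis (Complex.I * dir) * sin (ε * φ) := by
    intro θ ε hθ
    rw [spokeDir_eq_mul d θ ε s t, hθ, inner_mul_exp_mul_I, mul_neg, inner_neg_right,
      inner_neg_right]
    ring
  have h_bound : 1 / 2 ≤ inner ℝ axis dir * -cos φ + |inner ℝ axis (Complex.I * dir) * sin φ| := by
    refine half_le_mul_add_abs_mul ?_ ?_ h_inner (le_neg_of_le_neg h_turn)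
    · rw [inner_sq_add_inner_I_mul_sq, h_axis, h_dir, one_pow, one_mul]
    · rw [neg_sq, cos_sq_add_sin_sq]
  have h_norm : ‖-dir‖ = 1 := by rw [norm_neg, h_dir]
  rcases le_total 0 (inner ℝ axis (Complex.I * dir) * sin φ) with h_sign | h_sign
  · obtain ⟨θ, hθ⟩ := exists_spokeDir_eq d (-1) s h_norm
    refine ⟨θ, -1, Or.inr rfl, hθ, ?_⟩
    rw [abs_of_nonneg h_sign] at h_bound
    rwa [inner_eq θ (-1) hθ, neg_one_mul, cos_neg, sin_neg, mul_neg _ (sin φ), sub_neg_eq_add]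
  · obtain ⟨θ, hθ⟩ := exists_spokeDir_eq d 1 s h_norm
    refine ⟨θ, 1, Or.inl rfl, hθ, ?_⟩
    rwa [inner_eq θ 1 hθ, one_mul, sub_eq_add_neg, ← abs_of_nonpos h_sign]

theorem exists_norm_add_smul_eq {E : Type*} [NormedAddCommGroup E] [NormedSpace ℝ E] {q u : E}
    {ρ : ℝ} (hq : ‖q‖ < ρ) (hu : ‖u‖ = 1) : ∃ t : ℝ, 0 < t ∧ ‖q + t • u‖ = ρ := by
  have h_nonneg : 0 ≤ ρ + ‖q‖ := by linarith [norm_nonneg q]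
  have h_far : ρ ≤ ‖q + (ρ + ‖q‖) • u‖ := by
    have h_triangle := norm_sub_le (q + (ρ + ‖q‖) • u) q
    rw [add_sub_cancel_left, norm_smul, hu, mul_one, norm_of_nonneg h_nonneg] at h_triangle
    linarith
  have h_cont : ContinuousOn (fun t : ℝ => ‖q + t • u‖) (Set.Icc 0 (ρ + ‖q‖)) := by fun_prop
  obtain ⟨t, ht, h_eq⟩ := intermediate_value_Icc h_nonneg h_cont ⟨by simpa using hq.le, h_far⟩
  refine ⟨t, ht.1.lt_of_ne ?_, h_eq⟩
  rintro rfl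
  simp only [zero_smul, add_zero] at h_eq
  exact hq.ne h_eq

end Directions

section Construction

variable {V : Type*} {G : SimpleGraph V} {r : V} {h : V → Option V} {P : Plan G r h}

/-- The state of a vertex in a drawing: its position, the direction and length of the edge from the
parent, the position of the top node of its heavy path, and the axis of the wedge in which the
heavy path is drawn. The root, which has no parent, gets an arbitrary direction and length. -/
structure VertexState where
  pos : ℂ
  dir : ℂ
  len : ℝ
  top : ℂ
  axis : ℂ

namespace VertexState

/-- The distance of a vertex from the top node of its heavy path. -/
noncomputable def pathDist (s : VertexState) : ℝ := ‖s.pos - s.top‖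

/-- The vertex reached from a vertex with state `s` by a heavy edge of direction `u` and
length `t`. -/
noncomputable def heavyChild (s : VertexState) (u : ℂ) (t : ℝ) : VertexState :=
  ⟨s.pos + t • u, u, t, s.top, s.axis⟩

/-- The vertex reached from a vertex with state `s` by a light edge of direction `u` and
length `t`. -/
noncomputable def lightChild (s : VertexState) (u : ℂ) (t : ℝ) : VertexState :=
  ⟨s.pos + t • u, u, t, s.pos + t • u, u⟩

/-- The state has unit vectors as directions, and the heavy path arrives within the wedge of
half-angle `π / 3` about its axis. -/
structure IsValid (s : VertexState) : Prop where
  norm_dir : ‖s.dir‖ = 1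
  norm_axis : ‖s.axis‖ = 1
  half_le_inner : 1 / 2 ≤ inner ℝ s.axis s.dir

theorem isValid_of_axis_eq_dir {s : VertexState} (h_dir : ‖s.dir‖ = 1) (h_axis : s.axis = s.dir) :
    s.IsValid := by
  refine ⟨h_dir, h_axis ▸ h_dir, ?_⟩
  rw [h_axis, real_inner_self_eq_norm_sq, h_dir]
  norm_num

end VertexState

/-- The vertex `z` with state `s` and its children with states `n` are placed according to the
plan `P`. On a heavy path, the disks of radius `P.y` and the gaps of width `P.y z` between them
are measured in the distance from the top node. -/
structure IsStarDrawing (P : Plan G r h) (z : V) (s : VertexState) (n : V → VertexState) :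
    Prop where
  spokes : ∃ θ ε : ℝ, (ε = 1 ∨ ε = -1) ∧
    (∀ w, IsChild G r w z → spokeDir (deg G z) θ ε (P.spoke z w) = -s.dir) ∧
    ∀ v, IsChild G r z v → spokeDir (deg G z) θ ε (P.spoke z v) = (n v).dir
  pos_eq : ∀ v, IsChild G r z v → (n v).pos = s.pos + (n v).len • (n v).dir
  len_pos : ∀ v, IsChild G r z v → 0 < (n v).len
  light_len : ∀ v, IsLightChild G r h z v → (n v).len = P.dist z v
  light_top : ∀ v, IsLightChild G r h z v → (n v).top = (n v).pos
  light_axis : ∀ v, IsLightChild G r h z v → (n v).axis = (n v).dir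
  heavy_top : ∀ v, h z = some v → (n v).top = s.top
  heavy_axis : ∀ v, h z = some v → (n v).axis = s.axis
  heavy_pathDist : ∀ v, h z = some v → (n v).pathDist = s.pathDist + 2 * P.y z + P.y v

theorem IsStarDrawing.congr (hh : IsHeavyChoice G r h) {z : V} {s : VertexState}
    {n n' : V → VertexState} (hn : ∀ v, IsChild G r z v → n v = n' v)
    (hs : IsStarDrawing P z s n) : IsStarDrawing P z s n' := by
  obtain ⟨θ, ε, hε, h_parent, h_child⟩ := hs.spokes
  refine ⟨⟨θ, ε, hε, h_parent, fun v hv => hn v hv ▸ h_child v hv⟩,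
    fun v hv => hn v hv ▸ hs.pos_eq v hv, fun v hv => hn v hv ▸ hs.len_pos v hv,
    fun v hv => hn v hv.1 ▸ hs.light_len v hv, fun v hv => hn v hv.1 ▸ hs.light_top v hv,
    fun v hv => hn v hv.1 ▸ hs.light_axis v hv, fun v hv => ?_, fun v hv => ?_, fun v hv => ?_⟩ <;>
  rw [← hn v (hh.isChild z v hv)]
  exacts [hs.heavy_top v hv, hs.heavy_axis v hv, hs.heavy_pathDist v hv]

/-- The states `st` describe a drawing that follows the plan `P`. -/
structure IsPlanDrawing (P : Plan G r h) (st : V → VertexState) : Prop where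
  valid : ∀ v, (st v).IsValid
  root_top : (st r).top = (st r).pos
  root_axis : (st r).axis = (st r).dir
  star : ∀ z, IsStarDrawing P z (st z) st

theorem exists_rotation (P : Plan G r h) (hG : G.IsTree) (z : V) {s : VertexState}
    (hs : s.IsValid) : ∃ θ ε : ℝ, (ε = 1 ∨ ε = -1) ∧
      (∀ w, IsChild G r w z → spokeDir (deg G z) θ ε (P.spoke z w) = -s.dir) ∧
      ∀ v, h z = some v → 1 / 2 ≤ inner ℝ s.axis (spokeDir (deg G z) θ ε (P.spoke z v)) := by
  by_cases h_parent : ∃ w, IsChild G r w z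
  · obtain ⟨w, hw⟩ := h_parent
    have parent_eq : ∀ w', IsChild G r w' z → w' = w := fun w' hw' => hw'.unique hG hw
    cases hz : h z with
    | none =>
      obtain ⟨θ, hθ⟩ := exists_spokeDir_eq (deg G z) 1 (P.spoke z w)
        ((norm_neg s.dir).trans hs.norm_dir)
      exact ⟨θ, 1, Or.inl rfl, fun w' hw' => by rw [parent_eq w' hw', hθ], nofun⟩
    | some v =>
      obtain ⟨θ, ε, hε, h_dir, h_inner⟩ := exists_turn ((P.star z).angle w v (P.F_eq w z v hw hz))
        hs.norm_dir hs.norm_axis hs.half_le_inner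
      refine ⟨θ, ε, hε, fun w' hw' => by rw [parent_eq w' hw', h_dir], ?_⟩
      rintro v' ⟨⟩
      exact h_inner
  · push Not at h_parent
    cases hz : h z with
    | none => exact ⟨0, 1, Or.inl rfl, fun w hw => (h_parent w hw).elim, nofun⟩
    | some v =>
      obtain ⟨θ, hθ⟩ := exists_spokeDir_eq (deg G z) 1 (P.spoke z v) hs.norm_axis
      refine ⟨θ, 1, Or.inl rfl, fun w hw => (h_parent w hw).elim, ?_⟩
      rintro v' ⟨⟩
      rw [hθ, real_inner_self_eq_norm_sq, hs.norm_axis]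
      norm_num

theorem exists_len_heavy (P : Plan G r h) (z : V) (s : VertexState) {u : V → ℂ}
    (hu : ∀ v, ‖u v‖ = 1) : ∃ t : V → ℝ, ∀ v, h z = some v → 0 < t v ∧
      (s.heavyChild (u v) (t v)).pathDist = s.pathDist + 2 * P.y z + P.y v := by
  have exists_len : ∀ v, ∃ t : ℝ, h z = some v → 0 < t ∧
      (s.heavyChild (u v) t).pathDist = s.pathDist + 2 * P.y z + P.y v := by
    intro v
    by_cases hv : h z = some v
    · have h_lt : ‖s.pos - s.top‖ < s.pathDist + 2 * P.y z + P.y v := by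
        rw [VertexState.pathDist]
        linarith [P.half_le_y hv, P.y_nonneg v]
      obtain ⟨t, t_pos, ht⟩ := exists_norm_add_smul_eq h_lt (hu v)
      refine ⟨t, fun _ => ⟨t_pos, ?_⟩⟩
      rw [← ht, VertexState.pathDist, VertexState.heavyChild, add_sub_right_comm]
    · exact ⟨0, fun hv' => (hv hv').elim⟩
  exact Classical.skolem.1 exists_len

theorem exists_isStarDrawing [Finite V] (P : Plan G r h) (hG : G.IsTree)
    (hh : IsHeavyChoice G r h) (z : V) {s : VertexState} (hs : s.IsValid) :
    ∃ n, IsStarDrawing P z s n ∧ ∀ v, (n v).IsValid := by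
  classical
  obtain ⟨θ, ε, hε, h_parent, h_inner⟩ := exists_rotation P hG z hs
  let u : V → ℂ := fun v => spokeDir (deg G z) θ ε (P.spoke z v)
  have hu : ∀ v, ‖u v‖ = 1 := fun v => norm_spokeDir _ _ _ _
  obtain ⟨t, ht⟩ := exists_len_heavy P z s hu
  have dist_pos : ∀ v, IsLightChild G r h z v → 0 < P.dist z v := fun v hv =>
    zero_lt_one.trans_le ((P.one_le_X hh v).trans
      ((P.star z).radius_le v (((P.size z).mem_iff v).2 hv)))
  let n : V → VertexState := fun v =>
    if h z = some v then s.heavyChild (u v) (t v) else s.lightChild (u v) (P.dist z v)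
  have n_heavy : ∀ v, h z = some v → n v = s.heavyChild (u v) (t v) := fun v hv => if_pos hv
  have n_light : ∀ v, h z ≠ some v → n v = s.lightChild (u v) (P.dist z v) := fun v hv => if_neg hv
  refine ⟨n, ⟨⟨θ, ε, hε, h_parent, fun v _ => ?_⟩, fun v _ => ?_, fun v hv => ?_,
    fun v hv => by rw [n_light v hv.2]; rfl, fun v hv => by rw [n_light v hv.2]; rfl,
    fun v hv => by rw [n_light v hv.2]; rfl, fun v hv => by rw [n_heavy v hv]; rfl,
    fun v hv => by rw [n_heavy v hv]; rfl, fun v hv => by rw [n_heavy v hv, (ht v hv).2]⟩,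
    fun v => ?_⟩ <;>
  by_cases hzv : h z = some v <;> first | rw [n_heavy v hzv] | rw [n_light v hzv]
  any_goals rfl
  · exact (ht v hzv).1
  · exact dist_pos v ⟨hv, hzv⟩
  · exact ⟨hu v, hs.norm_axis, h_inner v hzv⟩
  · exact VertexState.isValid_of_axis_eq_dir (hu v) rfl

theorem exists_isPlanDrawing [Finite V] (P : Plan G r h) (hG : G.IsTree)
    (hh : IsHeavyChoice G r h) : ∃ st, IsPlanDrawing P st := by
  let s₀ : VertexState := ⟨0, 1, 1, 0, 1⟩
  obtain ⟨st, h_root, h_st⟩ := exists_state_of_parent hG (fun _ s => s.IsValid) (IsStarDrawing P)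
    (fun _ _ _ _ hn hs => hs.congr hh hn) s₀
    (VertexState.isValid_of_axis_eq_dir (by simp [s₀]) rfl) fun z s hs =>
      (exists_isStarDrawing P hG hh z hs).imp fun n hn => ⟨hn.1, fun v _ => hn.2 v⟩
  exact ⟨st, fun v => (h_st v).1, by rw [h_root], by rw [h_root], fun z => (h_st z).2⟩

end Construction

section Spokes

variable {V : Type*} {G : SimpleGraph V} {r : V} {h : V → Option V} {P : Plan G r h}
  {st : V → VertexState} {z : V} {U : V → ℂ}

theorem IsChild.heavy_or_light {v : V} (hv : IsChild G r z v) (h : V → Option V) :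
    h z = some v ∨ IsLightChild G r h z v :=
  or_iff_not_imp_left.2 fun h_not_heavy => ⟨hv, h_not_heavy⟩

/-- `U` assigns to the neighbours of `z` the directions of their spokes at `z` in the drawing
described by `st`. -/
structure IsSpokeDirs (P : Plan G r h) (st : V → VertexState) (z : V) (U : V → ℂ) : Prop where
  norm : ∀ w, ‖U w‖ = 1
  inner : ∀ v w, inner ℝ (U v) (U w) = spokeCos (deg G z) (P.spoke z v) (P.spoke z w)
  parent : ∀ w, IsChild G r w z → U w = -(st z).dir
  child : ∀ v, IsChild G r z v → U v = (st v).dir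

theorem IsPlanDrawing.exists_isSpokeDirs_spokeDir (D : IsPlanDrawing P st) (z : V) :
    ∃ θ ε : ℝ, (ε = 1 ∨ ε = -1) ∧
      IsSpokeDirs P st z fun w => spokeDir (deg G z) θ ε (P.spoke z w) := by
  obtain ⟨θ, ε, hε, h_parent, h_child⟩ := (D.star z).spokes
  exact ⟨θ, ε, hε, fun w => norm_spokeDir _ _ _ _, fun v w => inner_spokeDir _ _ hε _ _,
    h_parent, h_child⟩

theorem IsPlanDrawing.exists_isSpokeDirs (D : IsPlanDrawing P st) (z : V) :
    ∃ U, IsSpokeDirs P st z U :=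
  let ⟨_, _, _, hU⟩ := D.exists_isSpokeDirs_spokeDir z
  ⟨_, hU⟩

theorem Plan.mem_L_or_mem_F (P : Plan G r h) {v : V} (hv : G.Adj z v) : v ∈ P.L z ∨ v ∈ P.F z := by
  by_cases h_light : IsLightChild G r h z v
  · exact Or.inl (((P.size z).mem_iff v).2 h_light)
  · exact Or.inr ((P.mem_F z v).2 ⟨hv, h_light⟩)

theorem Plan.spoke_lt (P : Plan G r h) {v : V} (hv : G.Adj z v) : P.spoke z v < deg G z :=
  (P.star z).spoke_lt v (P.mem_L_or_mem_F hv)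

theorem Plan.spoke_ne (P : Plan G r h) {v w : V} (hv : G.Adj z v) (hw : G.Adj z w) (hvw : v ≠ w) :
    P.spoke z v ≠ P.spoke z w := fun h_eq =>
  hvw ((P.star z).spoke_inj v w (P.mem_L_or_mem_F hv) (P.mem_L_or_mem_F hw) h_eq)

namespace IsSpokeDirs

theorem norm_sub_sq (hU : IsSpokeDirs P st z U) (v w : V) (a b : ℝ) :
    ‖a • U v - b • U w‖ ^ 2 = sqDist (deg G z) (P.spoke z v) (P.spoke z w) a b := by
  rw [norm_sub_sq_real, norm_smul, norm_smul, hU.norm, hU.norm, real_inner_smul_left,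
    real_inner_smul_right, hU.inner, mul_one, mul_one, norm_eq_abs, norm_eq_abs, sq_abs, sq_abs,
    sqDist]
  ring

theorem le_norm_sub (hU : IsSpokeDirs P st z U) {v w : V} {a b ρ : ℝ}
    (hρ : ρ ^ 2 ≤ sqDist (deg G z) (P.spoke z v) (P.spoke z w) a b) :
    ρ ≤ ‖a • U v - b • U w‖ := by
  rw [← hU.norm_sub_sq] at hρ
  exact (le_abs_self ρ).trans (abs_le_of_sq_le_sq hρ (norm_nonneg _))

theorem smul_ne_smul (hU : IsSpokeDirs P st z U) {v w : V} (hv : G.Adj z v) (hw : G.Adj z w)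
    (hvw : v ≠ w) {a b : ℝ} (ha : 0 < a) (hb : 0 ≤ b) : a • U v ≠ b • U w := by
  intro h_eq
  have hab : a = b := by
    simpa [norm_smul, hU.norm, abs_of_pos ha, abs_of_nonneg hb] using
      congrArg (fun q : ℂ => ‖q‖) h_eq
  have h_sq := hU.norm_sub_sq v w a b
  rw [h_eq, sub_self, norm_zero, ← hab, sqDist] at h_sq
  nlinarith [spokeCos_lt_one (P.spoke_lt hv) (P.spoke_lt hw) (P.spoke_ne hv hw hvw),
    mul_pos ha ha]

end IsSpokeDirs

end Spokes

section Arms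

variable {V : Type*} {G : SimpleGraph V} {r : V} {h : V → Option V} {P : Plan G r h}
  {st : V → VertexState} {z v c w : V} {U : V → ℂ}

/-- The part of the drawing added with `v`: its position, and the edge from the parent without
the position of the parent. These sets partition the drawing. -/
def arm (r : V) (st : V → VertexState) (v : V) : Set ℂ :=
  {q | ∃ a : ℝ, 0 ≤ a ∧ (a = 0 ∨ v ≠ r ∧ a < (st v).len) ∧ q = (st v).pos - a • (st v).dir}

/-- The region that the drawing of the subtree of a light child `c` keeps to: the interior of the
exclusive disk of `c`, and the edge from the parent. -/
def lightRegion (P : Plan G r h) (st : V → VertexState) (c : V) : Set ℂ :=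
  arm r st c ∪ Metric.ball (st c).pos (P.X c)

theorem pos_mem_arm (r : V) (st : V → VertexState) (v : V) : (st v).pos ∈ arm r st v :=
  ⟨0, le_rfl, Or.inl rfl, by rw [zero_smul, sub_zero]⟩

theorem eq_pos_or_exists_of_mem_arm (hG : G.Connected) {q : ℂ} (hq : q ∈ arm r st z) :
    q = (st z).pos ∨ ∃ w, IsChild G r w z ∧ ∃ a : ℝ, 0 ≤ a ∧ q = (st z).pos + a • -(st z).dir := by
  obtain ⟨a, ha, h_cases, rfl⟩ := hq
  rcases h_cases with rfl | ⟨hz, -⟩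
  · exact Or.inl (by rw [zero_smul, sub_zero])
  · obtain ⟨w, hw⟩ := exists_isChild hG hz
    exact Or.inr ⟨w, hw, a, ha, by rw [smul_neg, sub_eq_add_neg]⟩

namespace IsPlanDrawing

theorem norm_smul_dir (D : IsPlanDrawing P st) (v : V) {a : ℝ} (ha : 0 ≤ a) :
    ‖a • (st v).dir‖ = a := by
  rw [norm_smul, (D.valid v).norm_dir, mul_one, norm_of_nonneg ha]

theorem dist_child (D : IsPlanDrawing P st) (hv : IsChild G r z v) :
    dist (st z).pos (st v).pos = (st v).len := by
  rw [(D.star z).pos_eq v hv, dist_self_add_right,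
    D.norm_smul_dir v ((D.star z).len_pos v hv).le]

theorem exists_of_mem_arm (D : IsPlanDrawing P st) (hv : IsChild G r z v) {q : ℂ}
    (hq : q ∈ arm r st v) :
    ∃ a : ℝ, 0 < a ∧ a ≤ (st v).len ∧ q = (st z).pos + a • (st v).dir := by
  obtain ⟨a, ha, h_cases, rfl⟩ := hq
  have h_lt : a < (st v).len := by
    rcases h_cases with rfl | ⟨-, h_lt⟩
    exacts [(D.star z).len_pos v hv, h_lt]
  refine ⟨(st v).len - a, sub_pos.2 h_lt, sub_le_self _ ha, ?_⟩
  rw [(D.star z).pos_eq v hv, sub_smul, add_sub_assoc]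

theorem arm_subset_segment (D : IsPlanDrawing P st) (hv : IsChild G r z v) :
    arm r st v ⊆ segment ℝ (st z).pos (st v).pos := by
  intro q hq
  obtain ⟨a, ha, h_le, rfl⟩ := D.exists_of_mem_arm hv hq
  have h_len := (D.star z).len_pos v hv
  rw [segment_eq_image']
  refine ⟨a / (st v).len, ⟨by positivity, (div_le_one h_len).2 h_le⟩, ?_⟩
  beta_reduce
  rw [(D.star z).pos_eq v hv, add_sub_cancel_left, smul_smul, div_mul_cancel₀ _ h_len.ne']

theorem segment_subset_insert_arm (D : IsPlanDrawing P st) (hv : IsChild G r z v) :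
    segment ℝ (st z).pos (st v).pos ⊆ insert (st z).pos (arm r st v) := by
  rw [segment_eq_image']
  rintro _ ⟨t, ⟨ht₀, ht₁⟩, rfl⟩
  have h_len := (D.star z).len_pos v hv
  rcases ht₀.eq_or_lt with rfl | ht₀
  · exact Or.inl (by simp only [zero_smul, add_zero])
  · refine Or.inr ⟨(1 - t) * (st v).len, by nlinarith, Or.inr ⟨hv.ne_root, by nlinarith⟩, ?_⟩
    beta_reduce
    rw [(D.star z).pos_eq v hv, add_sub_cancel_left, smul_smul, sub_mul, one_mul, sub_smul]
    abel

theorem pos_light (D : IsPlanDrawing P st) (hc : IsLightChild G r h z c) :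
    (st c).pos = (st z).pos + P.dist z c • (st c).dir := by
  rw [(D.star z).pos_eq c hc.1, (D.star z).light_len c hc]

theorem X_le_len (D : IsPlanDrawing P st) (hc : IsLightChild G r h z c) : P.X c ≤ (st c).len := by
  rw [(D.star z).light_len c hc]
  exact (P.star z).radius_le c (((P.size z).mem_iff c).2 hc)

theorem len_add_X_le_x (D : IsPlanDrawing P st) (hc : IsLightChild G r h z c) :
    (st c).len + P.X c ≤ P.x z := by
  rw [(D.star z).light_len c hc]
  exact (P.star z).cover c (((P.size z).mem_iff c).2 hc)

theorem add_smul_notMem_lightRegion (D : IsPlanDrawing P st) (hU : IsSpokeDirs P st z U)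
    (hc : IsLightChild G r h z c) (hw : G.Adj z w) (h_not_light : ¬ IsLightChild G r h z w) {a : ℝ}
    (ha : 0 ≤ a) : (st z).pos + a • U w ∉ lightRegion P st c := by
  rintro (h_mem | h_mem)
  · obtain ⟨b, hb, -, h_eq⟩ := D.exists_of_mem_arm hc.1 h_mem
    rw [← hU.child c hc.1, add_right_inj] at h_eq
    exact hU.smul_ne_smul hc.1.1 hw (fun hcw => h_not_light (hcw ▸ hc)) hb ha h_eq.symm
  · have h_avoids := hU.le_norm_sub ((P.star z).rayAvoids c (((P.size z).mem_iff c).2 hc) w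
      ((P.mem_F z w).2 ⟨hw, h_not_light⟩) a ha)
    rw [Metric.mem_ball', dist_eq_norm, D.pos_light hc, add_sub_add_left_eq_sub,
      ← hU.child c hc.1] at h_mem
    exact h_avoids.not_gt h_mem

theorem pos_notMem_arm (D : IsPlanDrawing P st) (hv : IsChild G r z v) :
    (st z).pos ∉ arm r st v := by
  intro h_mem
  obtain ⟨a, ha, -, h_eq⟩ := D.exists_of_mem_arm hv h_mem
  have h_norm := D.norm_smul_dir v ha.le
  rw [left_eq_add.1 h_eq, norm_zero] at h_norm
  exact ha.ne h_norm

theorem disjoint_arm_child (D : IsPlanDrawing P st) (hG : G.Connected) (hv : IsChild G r z v) :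
    Disjoint (arm r st z) (arm r st v) := by
  obtain ⟨U, hU⟩ := D.exists_isSpokeDirs z
  rw [Set.disjoint_left]
  intro q hqz hqv
  rcases eq_pos_or_exists_of_mem_arm hG hqz with rfl | ⟨w, hw, a, ha, rfl⟩
  · exact D.pos_notMem_arm hv hqv
  · obtain ⟨b, hb, -, h_eq⟩ := D.exists_of_mem_arm hv hqv
    rw [← hU.child v hv, ← hU.parent w hw, add_right_inj] at h_eq
    have hvw : v ≠ w := fun hvw => hw.not_isChild (hvw ▸ hv)
    exact hU.smul_ne_smul hv.1 hw.1.symm hvw hb ha h_eq.symm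

theorem disjoint_arm_of_isChild (D : IsPlanDrawing P st) (hv : IsChild G r z v)
    (hw : IsChild G r z w) (hvw : v ≠ w) : Disjoint (arm r st v) (arm r st w) := by
  obtain ⟨U, hU⟩ := D.exists_isSpokeDirs z
  rw [Set.disjoint_left]
  intro q hqv hqw
  obtain ⟨a, ha, -, rfl⟩ := D.exists_of_mem_arm hv hqv
  obtain ⟨b, hb, -, h_eq⟩ := D.exists_of_mem_arm hw hqw
  rw [← hU.child v hv, ← hU.child w hw, add_right_inj] at h_eq
  exact hU.smul_ne_smul hv.1 hw.1 hvw ha hb.le h_eq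

theorem disjoint_arm_ball (D : IsPlanDrawing P st) (hv : IsLightChild G r h z v)
    (hc : IsLightChild G r h z c) (hvc : v ≠ c) :
    Disjoint (arm r st v) (Metric.ball (st c).pos (P.X c)) := by
  obtain ⟨U, hU⟩ := D.exists_isSpokeDirs z
  rw [Set.disjoint_left]
  intro q hqv hqc
  obtain ⟨a, ha, h_le, rfl⟩ := D.exists_of_mem_arm hv.1 hqv
  rw [(D.star z).light_len v hv] at h_le
  have h_avoids := hU.le_norm_sub (((P.star z).separated v (((P.size z).mem_iff v).2 hv) c
    (((P.size z).mem_iff c).2 hc) hvc).right a ha.le h_le)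
  rw [Metric.mem_ball', dist_eq_norm, D.pos_light hc, add_sub_add_left_eq_sub, ← hU.child v hv.1,
    ← hU.child c hc.1] at hqc
  exact h_avoids.not_gt hqc

theorem disjoint_ball_ball (D : IsPlanDrawing P st) (hv : IsLightChild G r h z v)
    (hc : IsLightChild G r h z c) (hvc : v ≠ c) :
    Disjoint (Metric.ball (st v).pos (P.X v)) (Metric.ball (st c).pos (P.X c)) := by
  obtain ⟨U, hU⟩ := D.exists_isSpokeDirs z
  apply Metric.ball_disjoint_ball
  rw [dist_eq_norm, D.pos_light hv, D.pos_light hc, add_sub_add_left_eq_sub, ← hU.child v hv.1,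
    ← hU.child c hc.1]
  exact hU.le_norm_sub ((P.star z).separated v (((P.size z).mem_iff v).2 hv) c
    (((P.size z).mem_iff c).2 hc) hvc).disks

theorem disjoint_lightRegion (D : IsPlanDrawing P st) (hv : IsLightChild G r h z v)
    (hc : IsLightChild G r h z c) (hvc : v ≠ c) :
    Disjoint (lightRegion P st v) (lightRegion P st c) :=
  Set.disjoint_union_left.2
    ⟨Set.disjoint_union_right.2 ⟨D.disjoint_arm_of_isChild hv.1 hc.1 hvc,
      D.disjoint_arm_ball hv hc hvc⟩,
    Set.disjoint_union_right.2 ⟨(D.disjoint_arm_ball hc hv hvc.symm).symm,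
      D.disjoint_ball_ball hv hc hvc⟩⟩

theorem pos_notMem_lightRegion (D : IsPlanDrawing P st) (hc : IsLightChild G r h z c) :
    (st z).pos ∉ lightRegion P st c := by
  rintro (h_mem | h_mem)
  · exact D.pos_notMem_arm hc.1 h_mem
  · rw [Metric.mem_ball, D.dist_child hc.1] at h_mem
    exact (D.X_le_len hc).not_gt h_mem

theorem lightRegion_subset_ball [Finite V] (D : IsPlanDrawing P st) (hh : IsHeavyChoice G r h)
    (hc : IsLightChild G r h z c) : lightRegion P st c ⊆ Metric.ball (st z).pos (P.y z) := by
  have h_le := (D.len_add_X_le_x hc).trans (P.x_le_y hh z)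
  refine Set.union_subset (fun q hq => ?_) (Metric.ball_subset_ball' ?_)
  · obtain ⟨a, ha, ha_le, rfl⟩ := D.exists_of_mem_arm hc.1 hq
    rw [mem_ball_iff_norm, add_sub_cancel_left, D.norm_smul_dir c ha.le]
    linarith [P.one_le_X hh c]
  · rw [dist_comm, D.dist_child hc.1]
    linarith

theorem disjoint_arm_lightRegion (D : IsPlanDrawing P st) (hG : G.Connected)
    (hc : IsLightChild G r h z c) : Disjoint (arm r st z) (lightRegion P st c) := by
  rw [Set.disjoint_left]
  intro q hq
  rcases eq_pos_or_exists_of_mem_arm hG hq with rfl | ⟨w, hw, a, ha, rfl⟩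
  · exact D.pos_notMem_lightRegion hc
  · obtain ⟨U, hU⟩ := D.exists_isSpokeDirs z
    rw [← hU.parent w hw]
    exact D.add_smul_notMem_lightRegion hU hc hw.1.symm (fun hl => hw.not_isChild hl.1) ha

end IsPlanDrawing

end Arms

section Wedge

variable {V : Type*} {G : SimpleGraph V} {r : V} {h : V → Option V} {P : Plan G r h}
  {st : V → VertexState} {z v c w : V}

theorem norm_le_norm_add_of_inner_nonneg {E : Type*} [NormedAddCommGroup E]
    [InnerProductSpace ℝ E] {x y : E} (hxy : 0 ≤ inner ℝ x y) : ‖x‖ ≤ ‖x + y‖ := by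
  refine (sq_le_sq₀ (norm_nonneg _) (norm_nonneg _)).1 ?_
  rw [norm_add_sq_real]
  linarith [sq_nonneg ‖y‖]

namespace VertexState

/-- The height of the point `q` over the top node of the heavy path of a vertex, in the direction
of the axis of the heavy path. -/
noncomputable def height (s : VertexState) (q : ℂ) : ℝ := inner ℝ s.axis (q - s.top)

theorem height_add_smul (s : VertexState) (q u : ℂ) (a : ℝ) :
    s.height (q + a • u) = s.height q + a * inner ℝ s.axis u := by
  rw [height, height, add_sub_right_comm, inner_add_right, real_inner_smul_right]

theorem IsValid.height_sub_le_dist {s : VertexState} (hs : s.IsValid) (q q' : ℂ) :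
    s.height q - s.height q' ≤ dist q q' := by
  rw [height, height, ← inner_sub_right, sub_sub_sub_cancel_right, dist_eq_norm]
  exact (real_inner_le_norm _ _).trans_eq (by rw [hs.norm_axis, one_mul])

/-- The point `q` has height at least `ξ` over the top node of the heavy path, or lies in a disk
outside the disk of radius `R` about the top node whose centre has nonnegative height. The drawing
keeps to such points beyond a vertex of the heavy path. -/
def IsFar (s : VertexState) (R ξ : ℝ) (q : ℂ) : Prop :=
  ξ ≤ s.height q ∨ ∃ m ρ, dist q m < ρ ∧ R + ρ ≤ dist m s.top ∧ 0 ≤ s.height m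

theorem IsFar.lt_dist {s : VertexState} {R ξ : ℝ} {q : ℂ} (hq : s.IsFar R ξ q)
    (h_height : s.height q < ξ) : R < dist q s.top := by
  rcases hq with hq | ⟨m, ρ, h_mem, h_outside, -⟩
  · exact absurd hq h_height.not_ge
  · linarith [dist_triangle_left m s.top q]

theorem IsValid.not_isFar_sub_smul_axis {s : VertexState} (hs : s.IsValid) {R ξ t : ℝ}
    (hR : 0 ≤ R) (hξ : 0 < ξ) (ht : 0 ≤ t) : ¬ s.IsFar R ξ (s.top - t • s.axis) := by
  rintro (h_high | ⟨m, ρ, h_mem, h_outside, h_height⟩)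
  · rw [height, sub_sub_cancel_left, inner_neg_right, real_inner_smul_right,
      real_inner_self_eq_norm_sq, hs.norm_axis] at h_high
    linarith
  · have h_norm : ‖m - s.top‖ ≤ ‖m - s.top + t • s.axis‖ := by
      apply norm_le_norm_add_of_inner_nonneg
      rw [real_inner_smul_right, real_inner_comm]
      exact mul_nonneg ht h_height
    rw [dist_comm, dist_eq_norm, sub_sub_eq_add_sub, add_sub_right_comm] at h_mem
    rw [dist_eq_norm] at h_outside
    linarith

end VertexState

/-- The distance of the end of the heavy path through `z` from its top node, as far as the space
reserved for the path is concerned. All vertices of a heavy path have the same outer radius. -/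
noncomputable def outerRadius (P : Plan G r h) (st : V → VertexState) (z : V) : ℝ :=
  (st z).pathDist - P.y z + P.Z z

theorem pathDist_add_y_le_outerRadius [Finite V] (hh : IsHeavyChoice G r h)
    (st : V → VertexState) (z : V) : (st z).pathDist + P.y z ≤ outerRadius P st z := by
  rw [outerRadius]
  cases hz : h z with
  | none => rw [P.Z_leaf hz, P.y_leaf hz, sub_zero]
  | some v => linarith [P.Z_eq_add hz, P.y_nonneg z, P.Z_nonneg hh v]

theorem isTop_of_isLightChild (hG : G.IsTree) (hh : IsHeavyChoice G r h)
    (hc : IsLightChild G r h z c) : IsTop h c := fun u hu =>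
  hc.2 ((hh.isChild u c hu).unique hG hc.1 ▸ hu)

namespace IsPlanDrawing

theorem height_heavy (D : IsPlanDrawing P st) (hv : h z = some v) :
    (st v).height = (st z).height := by
  funext q
  rw [VertexState.height, VertexState.height, (D.star z).heavy_top v hv,
    (D.star z).heavy_axis v hv]

theorem isFar_heavy (D : IsPlanDrawing P st) (hv : h z = some v) :
    (st v).IsFar = (st z).IsFar := by
  funext R ξ q
  rw [VertexState.IsFar, VertexState.IsFar, D.height_heavy hv, (D.star z).heavy_top v hv]

theorem outerRadius_heavy (D : IsPlanDrawing P st) (hv : h z = some v) :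
    outerRadius P st v = outerRadius P st z := by
  rw [outerRadius, outerRadius, (D.star z).heavy_pathDist v hv, P.Z_eq_add hv]
  ring

theorem le_len_heavy (D : IsPlanDrawing P st) (hh : IsHeavyChoice G r h) (hv : h z = some v) :
    2 * P.y z + P.y v ≤ (st v).len := by
  have h_dist := (D.star z).heavy_pathDist v hv
  have h_triangle := dist_triangle_left (st v).pos (st z).top (st z).pos
  rw [D.dist_child (hh.isChild z v hv), dist_eq_norm, dist_eq_norm] at h_triangle
  rw [VertexState.pathDist, VertexState.pathDist, (D.star z).heavy_top v hv] at h_dist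
  linarith

theorem height_add_half_le (D : IsPlanDrawing P st) (hv : h z = some v) {a : ℝ} (ha : 0 ≤ a) :
    (st z).height (st z).pos + a / 2 ≤ (st z).height ((st z).pos + a • (st v).dir) := by
  have h_inner := (D.valid v).half_le_inner
  rw [(D.star z).heavy_axis v hv] at h_inner
  rw [VertexState.height_add_smul]
  linarith [mul_le_mul_of_nonneg_left h_inner ha]

theorem height_add_y_le (D : IsPlanDrawing P st) (hh : IsHeavyChoice G r h) (hv : h z = some v) :
    (st z).height (st z).pos + P.y z ≤ (st z).height (st v).pos := by
  have hzv := hh.isChild z v hv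
  have h_height := D.height_add_half_le hv ((D.star z).len_pos v hzv).le
  rw [← (D.star z).pos_eq v hzv] at h_height
  linarith [D.le_len_heavy hh hv, P.y_nonneg v]

theorem top_eq_pos (D : IsPlanDrawing P st) (hG : G.Connected) (hz : IsTop h z) :
    (st z).top = (st z).pos := by
  by_cases hzr : z = r
  · rw [hzr, D.root_top]
  · obtain ⟨u, hu⟩ := exists_isChild hG hzr
    exact (D.star u).light_top z ⟨hu, hz u⟩

theorem axis_eq_dir (D : IsPlanDrawing P st) (hG : G.Connected) (hz : IsTop h z) :
    (st z).axis = (st z).dir := by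
  by_cases hzr : z = r
  · rw [hzr, D.root_axis]
  · obtain ⟨u, hu⟩ := exists_isChild hG hzr
    exact (D.star u).light_axis z ⟨hu, hz u⟩

theorem height_pos_of_isTop (D : IsPlanDrawing P st) (hG : G.Connected) (hz : IsTop h z) :
    (st z).height (st z).pos = 0 := by
  rw [VertexState.height, D.top_eq_pos hG hz, sub_self, inner_zero_right]

theorem pathDist_of_isTop (D : IsPlanDrawing P st) (hG : G.Connected) (hz : IsTop h z) :
    (st z).pathDist = 0 := by
  rw [VertexState.pathDist, D.top_eq_pos hG hz, sub_self, norm_zero]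

theorem height_pos_nonneg (D : IsPlanDrawing P st) (hG : G.Connected) (hh : IsHeavyChoice G r h)
    (v : V) : 0 ≤ (st v).height (st v).pos := by
  induction desc_root (r := r) hG v with
  | refl => rw [VertexState.height, D.root_top, sub_self, inner_zero_right]
  | @tail z v _ hv ih =>
    rcases hv.heavy_or_light h with h_heavy | h_light
    · rw [D.height_heavy h_heavy]
      linarith [D.height_add_y_le hh h_heavy, P.y_nonneg z]
    · rw [VertexState.height, (D.star z).light_top v h_light, sub_self, inner_zero_right]

theorem arm_heavy_subset_closedBall (D : IsPlanDrawing P st) (hh : IsHeavyChoice G r h)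
    (hv : h z = some v) : arm r st v ⊆ Metric.closedBall (st v).top (st v).pathDist := by
  refine (D.arm_subset_segment (hh.isChild z v hv)).trans
    ((convex_closedBall _ _).segment_subset ?_ ?_)
  · have h_dist := (D.star z).heavy_pathDist v hv
    rw [mem_closedBall_iff_norm, (D.star z).heavy_top v hv, h_dist, ← VertexState.pathDist]
    linarith [P.y_nonneg z, P.y_nonneg v]
  · exact mem_closedBall_iff_norm.2 le_rfl

theorem outerRadius_lt_X (D : IsPlanDrawing P st) (hG : G.Connected) (hz : IsTop h z)
    (hv : h z = some v) : outerRadius P st z < P.X z := by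
  rw [outerRadius, D.pathDist_of_isTop hG hz, P.Z_of_heavy hv]
  linarith [P.half_le_y hv]

theorem arm_subset_lightRegion_of_subset_closedBall (D : IsPlanDrawing P st) (hG : G.IsTree)
    (hh : IsHeavyChoice G r h) (hc : IsLightChild G r h z c) (hw : Desc G r c w)
    (h_subset : w ≠ c → arm r st w ⊆ Metric.closedBall (st c).top (outerRadius P st c)) :
    arm r st w ⊆ lightRegion P st c := by
  rcases hw.cases_head with rfl | ⟨u, hu, -⟩
  · exact Set.subset_union_left
  by_cases hwc : w = c
  · exact hwc ▸ Set.subset_union_left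
  have c_top := isTop_of_isLightChild hG hh hc
  obtain ⟨v, hv⟩ := Option.ne_none_iff_exists'.1 (hh.exists_of_child c u hu)
  refine (h_subset hwc).trans (Set.subset_union_of_subset_right ?_ _)
  rw [D.top_eq_pos hG.connected c_top]
  exact Metric.closedBall_subset_ball (D.outerRadius_lt_X hG.connected c_top hv)

theorem arm_subset_closedBall [Finite V] (D : IsPlanDrawing P st) (hG : G.IsTree)
    (hh : IsHeavyChoice G r h) (hw : Desc G r z w) (hwz : w ≠ z) :
    arm r st w ⊆ Metric.closedBall (st z).top (outerRadius P st z) := by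
  induction z using (wellFounded_isChild G r).induction with
  | _ z ih =>
    rcases hw.cases_head with rfl | ⟨c, hc, hcw⟩
    · exact absurd rfl hwz
    rcases hc.heavy_or_light h with h_heavy | h_light
    · rw [← D.outerRadius_heavy h_heavy, ← (D.star z).heavy_top c h_heavy]
      by_cases hwc : w = c
      · subst hwc
        refine (D.arm_heavy_subset_closedBall hh h_heavy).trans
          (Metric.closedBall_subset_closedBall ?_)
        linarith [pathDist_add_y_le_outerRadius (P := P) hh st w, P.y_nonneg w]
      · exact ih c hc hcw hwc
    · have h_region := D.arm_subset_lightRegion_of_subset_closedBall hG hh h_light hcw (ih c hc hcw)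
      refine h_region.trans ((D.lightRegion_subset_ball hh h_light).trans
        (Metric.ball_subset_closedBall.trans (Metric.closedBall_subset_closedBall' ?_)))
      rw [dist_eq_norm, ← VertexState.pathDist, add_comm]
      exact pathDist_add_y_le_outerRadius hh st z

theorem arm_subset_lightRegion [Finite V] (D : IsPlanDrawing P st) (hG : G.IsTree)
    (hh : IsHeavyChoice G r h) (hc : IsLightChild G r h z c) (hw : Desc G r c w) :
    arm r st w ⊆ lightRegion P st c :=
  D.arm_subset_lightRegion_of_subset_closedBall hG hh hc hw (D.arm_subset_closedBall hG hh hw)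

theorem isFar_of_mem_arm [Finite V] (D : IsPlanDrawing P st) (hG : G.IsTree)
    (hh : IsHeavyChoice G r h) (hw : Desc G r v w) (hwv : w ≠ v) {R ξ : ℝ}
    (hR : R + P.y v ≤ (st v).pathDist) (hξ : ξ ≤ (st v).height (st v).pos) {q : ℂ}
    (hq : q ∈ arm r st w) : (st v).IsFar R ξ q := by
  induction v using (wellFounded_isChild G r).induction with
  | _ v ih =>
    rcases hw.cases_head with rfl | ⟨c, hc, hcw⟩
    · exact absurd rfl hwv
    rcases hc.heavy_or_light h with h_heavy | h_light
    · by_cases hwc : w = c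
      · subst hwc
        obtain ⟨a, ha, -, rfl⟩ := D.exists_of_mem_arm hc hq
        exact Or.inl (by linarith [D.height_add_half_le h_heavy ha.le])
      · have h_far := ih c hc hcw hwc
        rw [D.isFar_heavy h_heavy, D.height_heavy h_heavy,
          (D.star v).heavy_pathDist c h_heavy] at h_far
        exact h_far (by linarith [P.y_nonneg v])
          (by linarith [D.height_add_y_le hh h_heavy, P.y_nonneg v])
    · exact Or.inr ⟨(st v).pos, P.y v,
        D.lightRegion_subset_ball hh h_light (D.arm_subset_lightRegion hG hh h_light hcw hq),
        by rwa [dist_eq_norm], D.height_pos_nonneg hG.connected hh v⟩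

theorem isFar_of_mem_arm_heavy [Finite V] (D : IsPlanDrawing P st) (hG : G.IsTree)
    (hh : IsHeavyChoice G r h) (hv : h z = some v) (hw : Desc G r v w) (hwv : w ≠ v) {q : ℂ}
    (hq : q ∈ arm r st w) :
    (st z).IsFar ((st z).pathDist + P.y z) ((st z).height (st v).pos) q := by
  rw [← D.isFar_heavy hv, ← D.height_heavy hv]
  refine D.isFar_of_mem_arm hG hh hw hwv ?_ le_rfl hq
  linarith [(D.star z).heavy_pathDist v hv, P.y_nonneg z]

theorem disjoint_lightRegion_arm_heavy [Finite V] (D : IsPlanDrawing P st) (hG : G.IsTree)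
    (hh : IsHeavyChoice G r h) (hc : IsLightChild G r h z c) (hv : h z = some v)
    (hw : Desc G r v w) : Disjoint (lightRegion P st c) (arm r st w) := by
  rw [Set.disjoint_left]
  intro q hqc hqw
  have hzv := hh.isChild z v hv
  by_cases hwv : w = v
  · subst hwv
    obtain ⟨U, hU⟩ := D.exists_isSpokeDirs z
    obtain ⟨a, ha, -, rfl⟩ := D.exists_of_mem_arm hzv hqw
    rw [← hU.child w hzv] at hqc
    exact D.add_smul_notMem_lightRegion hU hc hzv.1 (fun hl => hl.2 hv) ha.le hqc
  · have h_ball : dist q (st z).pos < P.y z := D.lightRegion_subset_ball hh hc hqc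
    have h_height := (D.valid z).height_sub_le_dist q (st z).pos
    have h_dist := (D.isFar_of_mem_arm_heavy hG hh hv hw hwv hqw).lt_dist
      (by linarith [D.height_add_y_le hh hv])
    rw [VertexState.pathDist, ← dist_eq_norm] at h_dist
    linarith [dist_triangle q (st z).pos (st z).top]

theorem not_isFar_of_mem_arm (D : IsPlanDrawing P st) (hG : G.Connected)
    (hh : IsHeavyChoice G r h) (hv : h z = some v) {q : ℂ} (hq : q ∈ arm r st z) :
    ¬ (st z).IsFar ((st z).pathDist + P.y z) ((st z).height (st v).pos) q := by
  intro h_far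
  have h_height := D.height_add_y_le hh hv
  have y_pos : 0 < P.y z := by linarith [P.half_le_y hv]
  by_cases hz : IsTop h z
  · obtain ⟨a, ha, -, rfl⟩ := hq
    rw [D.pathDist_of_isTop hG hz, ← D.top_eq_pos hG hz, ← D.axis_eq_dir hG hz, zero_add] at h_far
    rw [D.height_pos_of_isTop hG hz, zero_add] at h_height
    exact (D.valid z).not_isFar_sub_smul_axis y_pos.le (y_pos.trans_le h_height) ha h_far
  · obtain ⟨u, hu⟩ : ∃ u, h u = some z := by simpa [IsTop] using hz
    have h_near := D.arm_heavy_subset_closedBall hh hu hq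
    obtain ⟨a, ha, -, rfl⟩ := hq
    have h_low : (st z).height ((st z).pos - a • (st z).dir) ≤ (st z).height (st z).pos := by
      rw [sub_eq_add_neg, ← neg_smul, VertexState.height_add_smul]
      nlinarith [(D.valid z).half_le_inner]
    have h_dist := h_far.lt_dist (by linarith)
    rw [Metric.mem_closedBall] at h_near
    linarith

theorem disjoint_arm_of_desc [Finite V] (D : IsPlanDrawing P st) (hG : G.IsTree)
    (hh : IsHeavyChoice G r h) (hc : IsChild G r z c) (hw : Desc G r c w) :
    Disjoint (arm r st z) (arm r st w) := by
  rcases hc.heavy_or_light h with h_heavy | h_light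
  · by_cases hwc : w = c
    · exact hwc ▸ D.disjoint_arm_child hG.connected hc
    · exact Set.disjoint_left.2 fun q hqz hqw => D.not_isFar_of_mem_arm hG.connected hh h_heavy hqz
        (D.isFar_of_mem_arm_heavy hG hh h_heavy hw hwc hqw)
  · exact (D.disjoint_arm_lightRegion hG.connected h_light).mono_right
      (D.arm_subset_lightRegion hG hh h_light hw)

theorem disjoint_arm_of_siblings [Finite V] (D : IsPlanDrawing P st) (hG : G.IsTree)
    (hh : IsHeavyChoice G r h) {c' w' : V} (hc : IsChild G r z c) (hc' : IsChild G r z c')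
    (hcc' : c ≠ c') (hw : Desc G r c w) (hw' : Desc G r c' w') :
    Disjoint (arm r st w) (arm r st w') := by
  rcases hc.heavy_or_light h with h_heavy | h_light <;>
  rcases hc'.heavy_or_light h with h_heavy' | h_light'
  · exact absurd (Option.some.inj (h_heavy.symm.trans h_heavy')) hcc'
  · exact (D.disjoint_lightRegion_arm_heavy hG hh h_light' h_heavy hw).symm.mono_right
      (D.arm_subset_lightRegion hG hh h_light' hw')
  · exact (D.disjoint_lightRegion_arm_heavy hG hh h_light h_heavy' hw').mono_left
      (D.arm_subset_lightRegion hG hh h_light hw)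
  · exact (D.disjoint_lightRegion h_light h_light' hcc').mono
      (D.arm_subset_lightRegion hG hh h_light hw) (D.arm_subset_lightRegion hG hh h_light' hw')

theorem disjoint_arm [Finite V] (D : IsPlanDrawing P st) (hG : G.IsTree)
    (hh : IsHeavyChoice G r h) (hvw : v ≠ w) : Disjoint (arm r st v) (arm r st w) := by
  rcases desc_trichotomy (r := r) hG.connected hvw with
    ⟨c, hc, hcw⟩ | ⟨c, hc, hcv⟩ | ⟨z, c, c', hc, hc', hcc', hcv, hcw⟩
  · exact D.disjoint_arm_of_desc hG hh hc hcw
  · exact (D.disjoint_arm_of_desc hG hh hc hcv).symm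
  · exact D.disjoint_arm_of_siblings hG hh hc hc' hcc' hcv hcw

theorem eq_of_mem_arm [Finite V] (D : IsPlanDrawing P st) (hG : G.IsTree)
    (hh : IsHeavyChoice G r h) {q : ℂ} (hv : q ∈ arm r st v) (hw : q ∈ arm r st w) : v = w := by
  by_contra hvw
  exact Set.disjoint_left.1 (D.disjoint_arm hG hh hvw) hv hw

end IsPlanDrawing

end Wedge

section Planarity

variable {V : Type*} {G : SimpleGraph V} {r : V} {h : V → Option V} {P : Plan G r h}
  {st : V → VertexState} {z v : V}

theorem exists_isChild_of_adj {p : V → ℂ} (hG : G.IsTree) (r : V) {u v : V} (huv : G.Adj u v) :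
    ∃ z c, IsChild G r z c ∧ s(u, v) = s(z, c) ∧ ({u, v} : Set V) = {z, c} ∧
      segment ℝ (p u) (p v) = segment ℝ (p z) (p c) := by
  rcases isChild_or_isChild hG r huv with hc | hc
  · exact ⟨u, v, hc, rfl, rfl, rfl⟩
  · exact ⟨v, u, hc, Sym2.eq_swap, Set.pair_comm u v, segment_symm ℝ (p u) (p v)⟩

variable [Finite V]

namespace IsPlanDrawing

theorem injective_pos (D : IsPlanDrawing P st) (hG : G.IsTree) (hh : IsHeavyChoice G r h) :
    Function.Injective fun v => (st v).pos := fun v w (h_eq : (st v).pos = (st w).pos) =>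
  D.eq_of_mem_arm hG hh (h_eq ▸ pos_mem_arm r st v) (pos_mem_arm r st w)

theorem eq_or_eq_of_pos_mem_segment (D : IsPlanDrawing P st) (hG : G.IsTree)
    (hh : IsHeavyChoice G r h) {w : V} (hv : IsChild G r z v)
    (hw : (st w).pos ∈ segment ℝ (st z).pos (st v).pos) : w = z ∨ w = v :=
  (D.segment_subset_insert_arm hv hw).imp (fun h_eq => D.injective_pos hG hh h_eq)
    fun h_mem => D.eq_of_mem_arm hG hh (pos_mem_arm r st w) h_mem

theorem segment_inter_segment_subset (D : IsPlanDrawing P st) (hG : G.IsTree)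
    (hh : IsHeavyChoice G r h) {z' v' : V} (hv : IsChild G r z v) (hv' : IsChild G r z' v')
    (h_ne : s(z, v) ≠ s(z', v')) :
    segment ℝ (st z).pos (st v).pos ∩ segment ℝ (st z').pos (st v').pos ⊆
      (fun v => (st v).pos) '' (({z, v} : Set V) ∩ {z', v'}) := by
  rintro q ⟨hq, hq'⟩
  rcases D.segment_subset_insert_arm hv hq with rfl | hqv
  · exact ⟨z, ⟨Or.inl rfl, D.eq_or_eq_of_pos_mem_segment hG hh hv' hq'⟩, rfl⟩
  rcases D.segment_subset_insert_arm hv' hq' with rfl | hqv'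
  · exact ⟨z', ⟨D.eq_or_eq_of_pos_mem_segment hG hh hv hq, Or.inl rfl⟩, rfl⟩
  · obtain rfl := D.eq_of_mem_arm hG hh hqv hqv'
    exact absurd (by rw [hv.unique hG hv']) h_ne

theorem isPlanarStraightLine (D : IsPlanDrawing P st) (hG : G.IsTree)
    (hh : IsHeavyChoice G r h) : IsPlanarStraightLine G fun v => (st v).pos := by
  refine ⟨D.injective_pos hG hh, fun u v w huv hw => ?_, fun u v u' v' huv huv' h_ne => ?_⟩
  · obtain ⟨z, c, hc, -, h_pair, h_segment⟩ :=
      exists_isChild_of_adj (p := fun v => (st v).pos) hG r huv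
    have h_mem : w ∈ ({z, c} : Set V) := D.eq_or_eq_of_pos_mem_segment hG hh hc (h_segment ▸ hw)
    rwa [← h_pair] at h_mem
  · obtain ⟨z, c, hc, h_edge, h_pair, h_segment⟩ :=
      exists_isChild_of_adj (p := fun v => (st v).pos) hG r huv
    obtain ⟨z', c', hc', h_edge', h_pair', h_segment'⟩ :=
      exists_isChild_of_adj (p := fun v => (st v).pos) hG r huv'
    rw [h_edge, h_edge'] at h_ne
    rw [h_segment, h_segment', h_pair, h_pair']
    exact D.segment_inter_segment_subset hG hh hc hc' h_ne

end IsPlanDrawing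

end Planarity

section Properties

variable {V : Type*} {G : SimpleGraph V} {r : V} {h : V → Option V} {P : Plan G r h}
  {st : V → VertexState} {u v w z : V} {U : V → ℂ}

theorem isTop_root (hh : IsHeavyChoice G r h) : IsTop h r :=
  fun w hw => (hh.isChild w r hw).ne_root rfl

theorem OnHeavyPath.total (hz : OnHeavyPath h u z) (hw : OnHeavyPath h u w) :
    OnHeavyPath h z w ∨ OnHeavyPath h w z :=
  Relation.ReflTransGen.total_of_right_unique
    (fun _ _ _ hb hc => Option.some.inj (hb.symm.trans hc)) hz hw

theorem IsSpokeDirs.two_pi_div_le_angle (hU : IsSpokeDirs P st z U) (hv : G.Adj z v)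
    (hw : G.Adj z w) (hvw : v ≠ w) :
    2 * π / deg G z ≤ InnerProductGeometry.angle (U v) (U w) := by
  have hsv := P.spoke_lt hv
  have hsw := P.spoke_lt hw
  have hs := P.spoke_ne hv hw hvw
  have h_deg : 2 ≤ deg G z := by omega
  rw [InnerProductGeometry.angle, hU.norm, hU.norm, hU.inner, mul_one, div_one,
    ← arccos_cos (by positivity) (two_pi_div_le_pi h_deg)]
  exact arccos_le_arccos (spokeCos_le_cos_two_pi_div hsv hsw hs)

namespace IsPlanDrawing

theorem one_le_len [Finite V] (D : IsPlanDrawing P st) (hh : IsHeavyChoice G r h)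
    (hv : IsChild G r z v) : 1 ≤ (st v).len := by
  rcases hv.heavy_or_light h with h_heavy | h_light
  · linarith [D.le_len_heavy hh h_heavy, P.half_le_y h_heavy, P.y_nonneg v]
  · exact (P.one_le_X hh v).trans (D.X_le_len h_light)

theorem one_le_dist [Finite V] (D : IsPlanDrawing P st) (hG : G.IsTree)
    (hh : IsHeavyChoice G r h) (huv : G.Adj u v) : 1 ≤ dist (st u).pos (st v).pos := by
  rcases isChild_or_isChild hG r huv with hc | hc
  · exact (D.one_le_len hh hc).trans_eq (D.dist_child hc).symm
  · exact (D.one_le_len hh hc).trans_eq ((D.dist_child hc).symm.trans (dist_comm _ _))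

theorem exists_pos_eq_of_adj (D : IsPlanDrawing P st) (hG : G.IsTree)
    (hU : IsSpokeDirs P st z U) (hw : G.Adj z w) :
    ∃ t : ℝ, 0 < t ∧ (st w).pos = (st z).pos + t • U w := by
  rcases isChild_or_isChild hG r hw with hc | hc
  · exact ⟨(st w).len, (D.star z).len_pos w hc, by rw [hU.child w hc, (D.star z).pos_eq w hc]⟩
  · refine ⟨(st z).len, (D.star w).len_pos z hc, ?_⟩
    rw [hU.parent w hc, (D.star w).pos_eq z hc, smul_neg, add_neg_cancel_right]

theorem isGreedyStar (D : IsPlanDrawing P st) (hG : G.IsTree) (u : V) :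
    IsGreedyStar G r h (fun v => (st v).pos) P.X u (P.x u) := by
  obtain ⟨θ, ε, hε, hU⟩ := D.exists_isSpokeDirs_spokeDir u
  refine ⟨P.L u, P.F u, θ, ε, hε, (P.size u).nodup, (P.size u).mem_iff, (P.size u).sorted,
    P.nodup_F u, P.mem_F u, ?_, ?_, rfl⟩
  · rw [(P.star u).placed, List.forall₂_map_right_iff, List.forall₂_same]
    intro v hv
    have hv := ((P.size u).mem_iff v).1 hv
    rw [← Complex.real_smul]
    exact (D.pos_light hv).trans (by rw [← hU.child v hv.1])
  · rw [(P.star u).free, List.forall₂_map_right_iff, List.forall₂_same]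
    intro v hv
    simp only [← Complex.real_smul]
    exact D.exists_pos_eq_of_adj hG hU ((P.mem_F u v).1 hv).1

theorem top_onHeavyPath (D : IsPlanDrawing P st) (hw : OnHeavyPath h z w) :
    (st w).top = (st z).top := by
  induction hw with
  | refl => rfl
  | @tail a b _ hb ih => exact ((D.star a).heavy_top b hb).trans ih

theorem outerRadius_onHeavyPath (D : IsPlanDrawing P st) (hw : OnHeavyPath h z w) :
    outerRadius P st w = outerRadius P st z := by
  induction hw with
  | refl => rfl
  | tail _ hb ih => exact (D.outerRadius_heavy hb).trans ih

theorem pathDist_add_le_of_onHeavyPath (D : IsPlanDrawing P st) (hw : OnHeavyPath h z w)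
    (hwz : w ≠ z) : (st z).pathDist + P.y z + P.y w ≤ (st w).pathDist := by
  induction hw with
  | refl => exact absurd rfl hwz
  | @tail a b _ hb ih =>
    rw [(D.star a).heavy_pathDist b hb]
    by_cases haz : a = z
    · subst haz
      linarith [P.y_nonneg a]
    · linarith [ih haz, P.y_nonneg a]

theorem x_add_x_le_dist (D : IsPlanDrawing P st) (hh : IsHeavyChoice G r h)
    (hw : OnHeavyPath h z w) (hwz : w ≠ z) : P.x z + P.x w ≤ dist (st z).pos (st w).pos := by
  have h_dist := D.pathDist_add_le_of_onHeavyPath hw hwz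
  have h_triangle := dist_triangle_left (st w).pos (st z).top (st z).pos
  rw [VertexState.pathDist, VertexState.pathDist, D.top_onHeavyPath hw, ← dist_eq_norm,
    ← dist_eq_norm] at h_dist
  linarith [P.x_le_y hh z, P.x_le_y hh w]

theorem outerRadius_le_X [Finite V] (D : IsPlanDrawing P st) (hG : G.Connected)
    (hh : IsHeavyChoice G r h) (hu : IsTop h u) : outerRadius P st u ≤ P.X u := by
  cases hv : h u with
  | none =>
    rw [outerRadius, D.pathDist_of_isTop hG hu, P.y_leaf hv, P.Z_leaf hv]
    linarith [P.one_le_X hh u]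
  | some v => exact (D.outerRadius_lt_X hG hu hv).le

theorem dist_add_x_le_X [Finite V] (D : IsPlanDrawing P st) (hG : G.Connected)
    (hh : IsHeavyChoice G r h) (hu : IsTop h u) (hz : OnHeavyPath h u z) :
    dist (st u).pos (st z).pos + P.x z ≤ P.X u := by
  have h_outer := pathDist_add_y_le_outerRadius (P := P) hh st z
  rw [D.outerRadius_onHeavyPath hz, VertexState.pathDist, D.top_onHeavyPath hz,
    D.top_eq_pos hG hu, ← dist_eq_norm, dist_comm] at h_outer
  linarith [P.x_le_y hh z, D.outerRadius_le_X hG hh hu]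

theorem pos_mem_closedBall [Finite V] (D : IsPlanDrawing P st) (hG : G.IsTree)
    (hh : IsHeavyChoice G r h) (hu : IsTop h u) (hw : w ∈ subtree G r u) :
    (st w).pos ∈ Metric.closedBall (st u).pos (P.X u) := by
  by_cases hwu : w = u
  · exact hwu ▸ Metric.mem_closedBall_self (zero_le_one.trans (P.one_le_X hh w))
  · rw [← D.top_eq_pos hG.connected hu]
    exact Metric.closedBall_subset_closedBall (D.outerRadius_le_X hG.connected hh hu)
      (D.arm_subset_closedBall hG hh ((mem_subtree_iff hG.connected).1 hw) hwu
        (pos_mem_arm r st w))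

theorem isGreedyHeavyPathDrawing [Finite V] (D : IsPlanDrawing P st) (hG : G.IsTree)
    (hh : IsHeavyChoice G r h) :
    IsGreedyHeavyPathDrawing G r h (fun v => (st v).pos) P.X P.x where
  leaf u _ hu := (P.size u).leaf hu
  star u := D.isGreedyStar hG u
  cover_disjoint u z z' _ hz hz' h_ne := by
    rcases hz.total hz' with h_path | h_path
    · exact D.x_add_x_le_dist hh h_path h_ne.symm
    · rw [add_comm, dist_comm]
      exact D.x_add_x_le_dist hh h_path h_ne
  cover_subset _ _ hu hz := D.dist_add_x_le_X hG.connected hh hu hz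
  subtree_subset _ hu _ hw := D.pos_mem_closedBall hG hh hu hw
  parent_outside _ _ hv := (D.X_le_len hv).trans_eq (D.dist_child hv.1).symm

theorem hasPerfectAngularResolution (D : IsPlanDrawing P st) (hG : G.IsTree) :
    HasPerfectAngularResolution G fun v => (st v).pos := by
  intro z v w hv hw hvw
  obtain ⟨U, hU⟩ := D.exists_isSpokeDirs z
  obtain ⟨a, ha, hva⟩ := D.exists_pos_eq_of_adj hG hU hv
  obtain ⟨b, hb, hwb⟩ := D.exists_pos_eq_of_adj hG hU hw
  simp only [EuclideanGeometry.angle, vsub_eq_sub, hva, hwb, add_sub_cancel_left]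
  rw [InnerProductGeometry.angle_smul_left_of_pos _ _ ha,
    InnerProductGeometry.angle_smul_right_of_pos _ _ hb]
  exact hU.two_pi_div_le_angle hv hw hvw

theorem drawing_subset [Finite V] (D : IsPlanDrawing P st) (hG : G.IsTree)
    (hh : IsHeavyChoice G r h) :
    drawing G (fun v => (st v).pos) ⊆ Metric.closedBall (st r).pos (P.X r) := by
  have pos_mem : ∀ w, (st w).pos ∈ Metric.closedBall (st r).pos (P.X r) := fun w =>
    D.pos_mem_closedBall hG hh (isTop_root hh) (by rw [subtree_root]; trivial)
  rintro q (⟨v, rfl⟩ | ⟨u, v, -, hq⟩)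
  · exact pos_mem v
  · exact (convex_closedBall _ _).segment_subset (pos_mem u) (pos_mem v) hq

end IsPlanDrawing

end Properties

end BalloonTree

theorem mainTheorem4 {V : Type*} [Fintype V] (G : SimpleGraph V) (hG : G.IsTree) (r : V)
    (h : V → Option V) (hh : BalloonTree.IsHeavyChoice G r h) :
    (∃ (p : V → ℂ) (X x : V → ℝ),
      BalloonTree.IsGreedyHeavyPathDrawing G r h p X x ∧
      BalloonTree.IsPlanarStraightLine G p ∧
      BalloonTree.HasPerfectAngularResolution G p ∧
      (∀ u v, G.Adj u v → 1 ≤ dist (p u) (p v)) ∧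
      ∃ c : ℂ, BalloonTree.drawing G p ⊆ Metric.closedBall c
        ((Fintype.card V : ℝ) ^ 2 * (Fintype.card V : ℝ) ^ Real.logb 2 BalloonTree.kappa)) ∧
    (2 ≤ Fintype.card V →
      (Fintype.card V : ℝ) ^ 2 * (Fintype.card V : ℝ) ^ Real.logb 2 BalloonTree.kappa <
        (Fintype.card V : ℝ) ^ (3.0367 : ℝ)) := by
  refine ⟨?_, fun hn => BalloonTree.sq_mul_rpow_logb_kappa_lt (by exact_mod_cast hn)⟩
  obtain ⟨P⟩ := BalloonTree.exists_plan hG hh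
  obtain ⟨st, D⟩ := BalloonTree.exists_isPlanDrawing P hG hh
  have card_bound : P.X r ≤
      (Fintype.card V : ℝ) ^ 2 * (Fintype.card V : ℝ) ^ Real.logb 2 BalloonTree.kappa := by
    simpa only [Nat.card_eq_fintype_card] using P.X_root_le hG hh
  exact ⟨fun v => (st v).pos, P.X, P.x, D.isGreedyHeavyPathDrawing hG hh,
    D.isPlanarStraightLine hG hh, D.hasPerfectAngularResolution hG,
    fun u v huv => D.one_le_dist hG hh huv, (st r).pos,
    (D.drawing_subset hG hh).trans (Metric.closedBall_subset_closedBall card_bound)⟩
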